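/- Let $\mathbb T^3=\mathbb R^3/2\pi\mathbb Z^3$ and $0<T<\infty$. All fields are real: $L^2=L^2(\mathbb T^3;\mathbb R^3)$, and for $s\ge 0$, $H^s$ is the space of $f\in L^2$ with $\|f\|_{H^s}^2=\sum_{k\in\mathbb Z^3}(1+|k|^{2s})|\hat f_k|^2<\infty$. Let $\mathbb P$ be the Leray projection, i.e. the orthogonal projection of $L^2$ onto the weakly divergence-free fields. Write $(\cdot,\cdot)$ for the $L^2$ inner product and $((\nabla u)^\top w)_i=\sum_j(\partial_iu_j)w_j$. A function $u:[0,T)\to L^2$ with $u\in L^\infty(0,T;L^2)\cap L^2(0,T;H^1)$ is a weak solution of the Navier–Stokes equations with initial value $u_0\in L^2$ if $u(t)$ is weakly divergence-free for all $t\in[0,T)$ and $$(u(t),\psi(t))+\int_0^t \big[((u\cdot\nabla)u,\psi)+(\nabla u,\nabla\psi)\big]\,ds=(u_0,\psi(0))+\int_0^t(u,\partial_t\psi)\,ds$$ for all $t\in[0,T)$ and all $\psi\in C_c^\infty([0,T)\times\mathbb T^3;\mathbb R^3)$ with $\nabla\cdot\psi\equiv0$. For $u\in L^\infty(0,T;H^{1/2})\cap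 L^2(0,T;H^{3/2})$ and $w_0\in H^{1/2}$, a function $w:[0,T)\to L^2$ with $w\in L^\infty(0,T;H^{1/2})\cap L^2(0,T;H^{3/2})$ is a strong solution of the linear magnetization equation $w_t+(u\cdot\nabla)w+(\nabla u)^\top w-\Delta w=0$ with coefficient $u$ and initial value $w_0$ if $$(w(t),\phi(t))+\int_0^t ((u\cdot\nabla)w+(\nabla u)^\top w,\phi)\,ds=(w_0,\phi(0))+\int_0^t(w,\partial_t\phi)\,ds-\int_0^t(\nabla w,\nabla\phi)\,ds$$ for all $t\in[0,T)$ and all $\phi\in C_c^\infty([0,T)\times\mathbb T^3;\mathbb R^3)$. **Proposition.** Let $u\in L^\infty(0,T;H^{1/2})\cap L^2(0,T;H^{3/2})$ be a weak solution of the Navier–Stokes equations with initial value $u_0$, and let $w_0\in H^{1/2}$ satisfy $\mathbb P w_0=u_0$. Then there is exactly one strong solution $w$ of the linear magnetization equation with coefficient $u$ and initial value $w_0$ (any two such solutions agree in $L^2$ at every $t\in[0,T)$), and it satisfies $\mathbb P w(t)=u(t)$ for all $t\in[0,T)$. -/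

import Mathlib

open MeasureTheory Set
open scoped ContDiff

noncomputable section

namespace Magnetization

instance fact_two_pi_pos : Fact ((0 : ℝ) < 2 * Real.pi) := ⟨Real.two_pi_pos⟩

/-- The torus `ℝ³ / 2πℤ³`; its `volume` is Lebesgue measure, of total mass `(2π)³`. -/
abbrev T3 : Type := Fin 3 → AddCircle (2 * Real.pi)

/-- Euclidean `ℝ³`, in which the vector fields take their values. -/
abbrev E3 : Type := EuclideanSpace ℝ (Fin 3)

/-- `L²(𝕋³; ℝ³)`. -/
abbrev L2 : Type := Lp E3 2 (volume : Measure T3)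

/-! ### Smooth functions on the torus -/

/-- The quotient map `ℝ³ → 𝕋³`. -/
def toT3 (x : Fin 3 → ℝ) : T3 := fun i => (x i : AddCircle (2 * Real.pi))

/-- `f` is `C^∞` on the torus: its periodic lift to `ℝ³` is `C^∞`. -/
def SmoothT3 {F : Type*} [NormedAddCommGroup F] [NormedSpace ℝ F] (f : T3 → F) : Prop :=
  ContDiff ℝ ∞ (fun x : Fin 3 → ℝ => f (toT3 x))

/-- The classical partial derivative `∂ᵢ f` of a function on the torus. -/
def pd {F : Type*} [NormedAddCommGroup F] [NormedSpace ℝ F] (i : Fin 3) (f : T3 → F) (x : T3) : F :=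
  deriv (fun h : ℝ => f (x + Pi.single i (h : AddCircle (2 * Real.pi)))) 0

/-- The classical gradient `∇ψ` of a scalar function. -/
def grad (ψ : T3 → ℝ) (x : T3) : E3 := WithLp.toLp 2 (fun i => pd i ψ x)

/-- The classical divergence `∇ · φ` of a vector field. -/
def divergence (φ : T3 → E3) (x : T3) : ℝ := ∑ i, pd i φ x i

/-! ### Divergence-free fields and the Leray projection -/

/-- The closed subspace of `L²` of weakly divergence-free fields: the `f` with
`∫ f · ∇ψ = 0` for every smooth scalar function `ψ` on the torus. -/
def solenoidal : Submodule ℝ L2 :=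
  (Submodule.span ℝ {g : L2 | ∃ ψ : T3 → ℝ, SmoothT3 ψ ∧ g =ᵐ[volume] grad ψ})ᗮ

instance instSolenoidalProjection : solenoidal.HasOrthogonalProjection :=
  haveI : CompleteSpace solenoidal := (Submodule.isClosed_orthogonal _).completeSpace_coe
  Submodule.HasOrthogonalProjection.ofCompleteSpace solenoidal

/-- The Leray projection `ℙ`: the orthogonal projection of `L²` onto the divergence-free fields. -/
def leray : L2 →L[ℝ] L2 := solenoidal.starProjection

/-! ### Sobolev norms -/

/-- The `j`-th component of the Fourier coefficient
`f̂ₖ = (2π)⁻³ ∫ f(x) e^{-i k·x} dx`. -/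
def fourierCoef (f : L2) (k : Fin 3 → ℤ) (j : Fin 3) : ℂ :=
  ((2 * Real.pi : ℝ) ^ 3 : ℝ)⁻¹ • ∫ x : T3, (∏ i, fourier (-(k i)) (x i)) * ((f x j : ℝ) : ℂ)

/-- The squared Sobolev norm `‖f‖²_{H^s} = ∑ₖ (1 + |k|^{2s}) |f̂ₖ|²`, in `[0, ∞]`;
`f ∈ H^s` means that it is finite. -/
def hsNormSq (s : ℝ) (f : L2) : ENNReal :=
  ∑' k : Fin 3 → ℤ,
    ENNReal.ofReal (1 + Real.sqrt (∑ i, (k i : ℝ) ^ 2) ^ (2 * s)) * ∑ j, ‖fourierCoef f k j‖ₑ ^ 2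

/-- `u ∈ L^∞(0, T; H^s)`. -/
def MemLinftyHs (T s : ℝ) (u : ℝ → L2) : Prop :=
  AEStronglyMeasurable u (volume.restrict (Ioo 0 T)) ∧
    ∃ C : ENNReal, C < ⊤ ∧ ∀ᵐ t ∂(volume.restrict (Ioo 0 T)), hsNormSq s (u t) ≤ C

/-- `u ∈ L²(0, T; H^s)`. -/
def MemL2Hs (T s : ℝ) (u : ℝ → L2) : Prop :=
  AEStronglyMeasurable u (volume.restrict (Ioo 0 T)) ∧
    ∫⁻ t in Ioo 0 T, hsNormSq s (u t) < ⊤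

/-! ### Weak derivatives -/

/-- `g ∈ L²` is the weak partial derivative `∂ᵢ f` of `f ∈ L²`. -/
def IsWeakPD (i : Fin 3) (f g : L2) : Prop :=
  ∀ ψ : T3 → ℝ, SmoothT3 ψ → ∫ x, pd i ψ x • f x = -∫ x, ψ x • g x

open scoped Classical in
/-- The weak partial derivative `∂ᵢ f ∈ L²` (unique where it exists, in particular for `f ∈ H¹`);
`0` by convention if there is none in `L²`. -/
def wpd (i : Fin 3) (f : L2) : L2 :=
  if h : ∃ g, IsWeakPD i f g then h.choose else 0

/-- The field `(u · ∇) w = ∑ⱼ uⱼ ∂ⱼ w`. -/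
def advect (u w : L2) (x : T3) : E3 := ∑ j, (u x j) • (wpd j w x)

/-- The field `(∇u)ᵀ w`, whose `i`-th component is `∑ⱼ (∂ᵢ uⱼ) wⱼ`. -/
def gradTranspose (u w : L2) (x : T3) : E3 :=
  WithLp.toLp 2 (fun i => ∑ j, (wpd i u x j) * (w x j))

/-- The `L²` inner product `(f, g)` of two vector fields. -/
def pairing (f g : T3 → E3) : ℝ := ∫ x, inner ℝ (f x) (g x)

/-- `(∇w, ∇φ) = ∑ᵢ (∂ᵢ w, ∂ᵢ φ)`. -/
def gradPairing (w : L2) (φ : T3 → E3) : ℝ := ∑ i, pairing (wpd i w) (pd i φ)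

/-! ### Test functions and solutions -/

/-- `φ ∈ C_c^∞([0, T) × 𝕋³; ℝ³)`, given through a smooth function of all times `t ∈ ℝ`
that vanishes from some time before `T` on. -/
def IsTestField (T : ℝ) (φ : ℝ → T3 → E3) : Prop :=
  ContDiff ℝ ∞ (fun p : ℝ × (Fin 3 → ℝ) => φ p.1 (toT3 p.2)) ∧
    ∃ T' < T, ∀ t ≥ T', ∀ x, φ t x = 0

/-- The time derivative `∂ₜ φ (s)`. -/
def timeDeriv (φ : ℝ → T3 → E3) (s : ℝ) (x : T3) : E3 := deriv (fun τ => φ τ x) s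

/-- `u` is a weak solution on `[0, T)` of the Navier–Stokes equations
`uₜ + (u · ∇)u - Δu + ∇p = 0`, `∇ · u = 0` with initial value `u₀`. -/
structure IsWeakNavierStokes (T : ℝ) (u₀ : L2) (u : ℝ → L2) : Prop where
  memLinfty : MemLinftyHs T 0 u
  memL2 : MemL2Hs T 1 u
  divFree : ∀ t ∈ Ico 0 T, u t ∈ solenoidal
  weakForm : ∀ ψ : ℝ → T3 → E3, IsTestField T ψ →
    (∀ t ∈ Ico 0 T, ∀ x, divergence (ψ t) x = 0) →
    ∀ t ∈ Ico 0 T,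
      pairing (u t) (ψ t)
          + ∫ s in (0 : ℝ)..t, (pairing (advect (u s) (u s)) (ψ s) + gradPairing (u s) (ψ s))
        = pairing u₀ (ψ 0) + ∫ s in (0 : ℝ)..t, pairing (u s) (timeDeriv ψ s)

/-- `w` is a strong solution on `[0, T)` of the linear magnetization equation
`wₜ + (u · ∇)w + (∇u)ᵀ w - Δw = 0` with coefficient `u` and initial value `w₀`. -/
structure IsStrongMagnetization (T : ℝ) (u : ℝ → L2) (w₀ : L2) (w : ℝ → L2) : Prop where
  memLinfty : MemLinftyHs T (1 / 2) w
  memL2 : MemL2Hs T (3 / 2) w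
  weakForm : ∀ φ : ℝ → T3 → E3, IsTestField T φ →
    ∀ t ∈ Ico 0 T,
      pairing (w t) (φ t)
          + ∫ s in (0 : ℝ)..t,
              pairing (fun x => advect (u s) (w s) x + gradTranspose (u s) (w s) x) (φ s)
        = pairing w₀ (φ 0) + (∫ s in (0 : ℝ)..t, pairing (w s) (timeDeriv φ s))
          - ∫ s in (0 : ℝ)..t, gradPairing (w s) (φ s)

end Magnetization

end

/-! The equation is linear in `w`, so existence, uniqueness and the identity for the projection all
follow from one a priori estimate, carried out on Fourier coefficients. A field becomes its family
of modes and the magnetization equation becomes the system `y' + |k|² y + bil u y = 0`, one ordinary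
differential equation for each mode (`IsModeSol`). In this notation `sob s` is equivalent to the
squared norm of `H^{s/2}`.

The estimate has two ingredients. First, `(u·∇)w + (∇u)ᵀw` maps `H¹ × H¹` to `H^{-1/2}`: each
summand is a product of an `H¹` function and an `L²` function, and the lattice sums are those of
`tsum_convolution_sq_le` (see `tsum_bil_sq_le`). Second, a coefficient in `L^∞ H^{1/2} ∩ L² H^{3/2}`
lies in `L⁴ H¹` by interpolation, so there is an integrable `g ≥ 1` above `‖u‖⁴_{H¹}`. Testing the
system in `H^{1/2}` with the weight `exp(-λ ∫ g)` controls `∫ exp(-λ ∫ g) (λ g ‖y‖²_{H^{1/2}} +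
‖y‖²_{H^{3/2}})` by the data and the forcing in `H^{-1/2}` (`mode_energy_le`, `energy_le`). By the
arithmetic-geometric mean inequality the forcing `bil u v` costs only a small multiple of the same
quantity for `v` once `λ` is large (`energy_le_of_bound`). No smallness of `u` or of the time
interval is needed.

Existence: the map solving the heat equation mode by mode with forcing `bil u v` is a contraction in
the weighted space, and its fixed point is a solution (`exists_modeSol`). The fixed point may be
complex; its real part solves the same equation because `u` is real (`exists_regular_solution`).
Uniqueness: a difference of solutions has zero data and forcing of the admissible size, so its norm
is at most a fraction of itself (`modes_eq_zero`).

Projection: `(u·∇)∇q + (∇u)ᵀ∇q = ∇(u·∇q)`, so the gradient part of `w` contributes only a gradient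
(`bil_gradient`) and `ℙw` solves `y' + |k|² y + ℙ bil u y = 0`. Since `(∇u)ᵀu = ∇(|u|²/2)`
(`stretch_self`), the Navier–Stokes equations say that `u` solves this too. The data agree, and the
same estimate gives `ℙw = u` (`leray_eq`).

The passage between weak formulations and modes goes one way by testing with trigonometric fields
times a time cutoff (`modes_eq`), and back by the product rule for absolutely continuous functions,
summed over the lattice (`weakForm_of_modes`). -/

noncomputable section
namespace Magnetization

open scoped ComplexConjugate ENNReal

/-! ### The Fourier basis of `L²(𝕋³; ℂ)` -/

/-- The lattice `ℤ³` of frequencies. -/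
abbrev Freq : Type := Fin 3 → ℤ

/-- The exponential `x ↦ e^{i k·x}` on the torus. -/
def expo (k : Freq) : C(T3, ℂ) where
  toFun x := ∏ i, fourier (k i) (x i)
  continuous_toFun := by fun_prop

lemma expo_apply (k : Freq) (x : T3) : expo k x = ∏ i, fourier (k i) (x i) := rfl

lemma expo_neg (k : Freq) (x : T3) : expo (-k) x = conj (expo k x) := by
  simp only [expo_apply, Pi.neg_apply, fourier_neg, map_prod]

lemma expo_add (k l : Freq) (x : T3) : expo (k + l) x = expo k x * expo l x := by
  simp only [expo_apply, Pi.add_apply, fourier_add, ← Finset.prod_mul_distrib]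

lemma expo_zero (x : T3) : expo 0 x = 1 := by simp [expo_apply]

lemma norm_expo_apply (k : Freq) (x : T3) : ‖expo k x‖ = 1 := by
  simp only [expo_apply, fourier_apply, norm_prod, Circle.norm_coe, Finset.prod_const_one]

lemma norm_expo (k : Freq) : ‖expo k‖ = 1 := by
  apply le_antisymm
  · exact (ContinuousMap.norm_le _ zero_le_one).mpr fun x => (norm_expo_apply k x).le
  · exact (norm_expo_apply k 0).symm.le.trans ((expo k).norm_coe_le_norm 0)

lemma expo_single (i : Fin 3) (x : T3) : expo (Pi.single i 1) x = fourier 1 (x i) := by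
  rw [expo_apply, Finset.prod_eq_single i]
  · simp
  · intro j _ hj; simp [hj]
  · simp

/-- The star subalgebra of `C(𝕋³, ℂ)` generated by the exponentials. -/
def expoSubalgebra : StarSubalgebra ℂ C(T3, ℂ) where
  toSubalgebra := Algebra.adjoin ℂ (range expo)
  star_mem' := by
    change Algebra.adjoin ℂ (range expo) ≤ star (Algebra.adjoin ℂ (range expo))
    refine Algebra.adjoin_le ?_
    rintro _ ⟨n, rfl⟩
    refine Algebra.subset_adjoin ⟨-n, ?_⟩
    ext1 x
    simp only [expo_neg, starRingEnd_apply, ContinuousMap.star_apply]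

theorem expoSubalgebra_coe :
    expoSubalgebra.toSubalgebra.toSubmodule = Submodule.span ℂ (range expo) := by
  apply Algebra.adjoin_eq_span_of_subset
  refine .trans (fun x => Submonoid.closure_induction (fun _ => id) ⟨0, ?_⟩ ?_)
    Submodule.subset_span
  · ext z
    simp [expo_zero]
  · rintro _ _ _ _ ⟨m, rfl⟩ ⟨n, rfl⟩
    refine ⟨m + n, ?_⟩
    ext z
    simp [expo_add]

theorem expoSubalgebra_separatesPoints : expoSubalgebra.SeparatesPoints := by
  intro x y hxy
  rw [Ne, funext_iff, not_forall] at hxy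
  obtain ⟨i, hi⟩ := hxy
  refine ⟨_, ⟨expo (Pi.single i 1), Algebra.subset_adjoin ⟨Pi.single i 1, rfl⟩, rfl⟩, ?_⟩
  dsimp only
  rw [expo_single, expo_single, fourier_one, fourier_one]
  contrapose! hi
  exact AddCircle.injective_toCircle Real.two_pi_pos.ne' (Circle.ext hi)

theorem span_expo_closure_eq_top :
    (Submodule.span ℂ (range expo)).topologicalClosure = ⊤ := by
  rw [← expoSubalgebra_coe]
  exact congr_arg (Subalgebra.toSubmodule <| StarSubalgebra.toSubalgebra ·)
    (ContinuousMap.starSubalgebra_topologicalClosure_eq_top_of_separatesPoints _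
      expoSubalgebra_separatesPoints)

/-- The exponential as an element of `L²(𝕋³; ℂ)`. -/
abbrev expoLp (k : Freq) : Lp ℂ 2 (volume : Measure T3) :=
  ContinuousMap.toLp (E := ℂ) 2 volume ℂ (expo k)

theorem coeFn_expoLp (k : Freq) : expoLp k =ᵐ[volume] expo k :=
  ContinuousMap.coeFn_toLp volume (expo k)

theorem span_expoLp_closure_eq_top :
    (Submodule.span ℂ (range expoLp)).topologicalClosure = ⊤ := by
  simpa only [Submodule.map_span, ContinuousLinearMap.coe_coe, ← range_comp,
    Function.comp_def] using
    (ContinuousMap.toLp_denseRange ℂ (volume : Measure T3) ℂ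
      (p := 2) (by simp)).topologicalClosure_map_submodule span_expo_closure_eq_top

/-- The volume `(2π)³` of the torus. -/
def vol : ℝ := (2 * Real.pi) ^ 3

lemma vol_pos : 0 < vol := by unfold vol; positivity

lemma integral_fourier_addCircle (n : ℤ) :
    ∫ x : AddCircle (2 * Real.pi), (fourier n x : ℂ) = if n = 0 then (2 * Real.pi : ℂ) else 0 := by
  rw [AddCircle.volume_eq_smul_haarAddCircle, integral_smul_measure]
  have h := orthonormal_iff_ite.mp (orthonormal_fourier (T := 2 * Real.pi)) 0 n
  rw [ContinuousMap.inner_toLp] at h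
  simp only [fourier_zero, map_one, mul_one] at h
  rw [h, ENNReal.toReal_ofReal Real.two_pi_pos.le]
  by_cases hn : n = 0
  · simp [hn]
  · simp [hn, Ne.symm hn]

lemma integral_expo (k : Freq) : ∫ x, expo k x = if k = 0 then (vol : ℂ) else 0 := by
  simp only [expo_apply]
  rw [MeasureTheory.integral_fintype_prod_volume_eq_prod
    (f := fun i (x : AddCircle (2 * Real.pi)) => (fourier (k i) x : ℂ))]
  simp only [integral_fourier_addCircle]
  split_ifs with h
  · simp [h, vol]
  · obtain ⟨i, hi⟩ := Function.ne_iff.mp h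
    exact Finset.prod_eq_zero (Finset.mem_univ i) (by simpa using hi)

lemma inner_expoLp (k : Freq) (f : Lp ℂ 2 (volume : Measure T3)) :
    inner ℂ (expoLp k) f = ∫ x, expo (-k) x * f x := by
  rw [MeasureTheory.L2.inner_def]
  refine integral_congr_ae ?_
  filter_upwards [coeFn_expoLp k] with x hx
  rw [hx, expo_neg, RCLike.inner_apply, mul_comm]

lemma inner_expoLp_expoLp (k l : Freq) :
    inner ℂ (expoLp k) (expoLp l) = if k = l then (vol : ℂ) else 0 := by
  rw [ContinuousMap.inner_toLp]
  simp only [← expo_neg, ← expo_add, integral_expo]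
  congr 1
  simp [← sub_eq_add_neg, sub_eq_zero, eq_comm]

/-- The normalized exponentials. -/
def expoN (k : Freq) : Lp ℂ 2 (volume : Measure T3) := ((Real.sqrt vol)⁻¹ : ℂ) • expoLp k

lemma sqrt_vol_mul_self : (Real.sqrt vol : ℂ) * Real.sqrt vol = vol := by
  rw [← Complex.ofReal_mul, Real.mul_self_sqrt vol_pos.le]

lemma sqrt_vol_ne : (Real.sqrt vol : ℂ) ≠ 0 := by
  exact_mod_cast (Real.sqrt_pos.mpr vol_pos).ne'

lemma vol_ne : (vol : ℂ) ≠ 0 := by exact_mod_cast vol_pos.ne'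

theorem orthonormal_expoN : Orthonormal ℂ expoN := by
  rw [orthonormal_iff_ite]
  intro k l
  simp only [expoN, inner_smul_left, inner_smul_right, inner_expoLp_expoLp]
  split_ifs
  · rw [map_inv₀, Complex.conj_ofReal, ← sqrt_vol_mul_self]
    have := sqrt_vol_ne
    field_simp
  · simp

/-- The Hilbert basis of normalized exponentials. -/
def expoBasis : HilbertBasis Freq ℂ (Lp ℂ 2 (volume : Measure T3)) :=
  HilbertBasis.mk orthonormal_expoN <| by
    rw [← span_expoLp_closure_eq_top]
    apply Submodule.topologicalClosure_mono
    rw [Submodule.span_le]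
    rintro _ ⟨k, rfl⟩
    have : expoLp k = (Real.sqrt vol : ℂ) • expoN k := by
      rw [expoN, smul_smul, mul_inv_cancel₀ sqrt_vol_ne, one_smul]
    rw [this]
    exact Submodule.smul_mem _ _ (Submodule.subset_span ⟨k, rfl⟩)

lemma expoBasis_apply (k : Freq) : expoBasis k = expoN k :=
  congr_fun (HilbertBasis.coe_mk _ _) k

/-- The Fourier coefficient of a complex function on the torus. -/
def coef (F : T3 → ℂ) (k : Freq) : ℂ := (vol : ℂ)⁻¹ * ∫ x, expo (-k) x * F x

lemma coef_congr_ae {F G : T3 → ℂ} (h : F =ᵐ[volume] G) (k : Freq) : coef F k = coef G k := by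
  unfold coef
  congr 1
  refine integral_congr_ae ?_
  filter_upwards [h] with x hx
  rw [hx]

lemma inner_expoN (k : Freq) (f : Lp ℂ 2 (volume : Measure T3)) :
    inner ℂ (expoN k) f = (Real.sqrt vol : ℂ) * coef f k := by
  rw [expoN, inner_smul_left, inner_expoLp, coef, ← sqrt_vol_mul_self, map_inv₀,
    Complex.conj_ofReal]
  have := sqrt_vol_ne
  field_simp

/-- Parseval for the orthonormal basis `expoN`. The inner product with a basis vector is `√vol`
times `coef`, which leaves the factor `vol⁻¹` on the integral. -/
theorem hasSum_conj_coef_mul_coef (f g : Lp ℂ 2 (volume : Measure T3)) :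
    HasSum (fun k => conj (coef f k) * coef g k) ((vol : ℂ)⁻¹ * ∫ x, conj (f x) * g x) := by
  have h := expoBasis.hasSum_inner_mul_inner f g
  simp only [expoBasis_apply, inner_expoN] at h
  have h2 : ∀ k, inner ℂ f (expoN k) = (Real.sqrt vol : ℂ) * conj (coef f k) := by
    intro k
    rw [← inner_conj_symm, inner_expoN, map_mul, Complex.conj_ofReal]
  simp only [h2] at h
  have h3 := h.mul_left (vol : ℂ)⁻¹
  rw [MeasureTheory.L2.inner_def] at h3
  convert! h3 using 1
  · ext k
    rw [← sqrt_vol_mul_self]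
    have := sqrt_vol_ne
    field_simp
  · congr 2; ext x; rw [RCLike.inner_apply, mul_comm]

lemma coef_toLp (F : C(T3, ℂ)) (k : Freq) :
    coef (ContinuousMap.toLp (E := ℂ) 2 volume ℂ F) k = coef F k :=
  coef_congr_ae (ContinuousMap.coeFn_toLp _ F) k

lemma hasSum_coef_smul_expoLp (f : Lp ℂ 2 (volume : Measure T3)) :
    HasSum (fun k => coef f k • expoLp k) f := by
  have h := expoBasis.hasSum_repr f
  simp only [HilbertBasis.repr_apply_apply, expoBasis_apply, inner_expoN] at h
  convert! h using 1
  ext1 k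
  rw [expoN, smul_smul, mul_right_comm, mul_inv_cancel₀ sqrt_vol_ne, one_mul]

/-- A continuous function with summable Fourier coefficients is the sum of its Fourier series. -/
theorem hasSum_coef_mul_expo (F : C(T3, ℂ)) (h : Summable (coef F)) (x : T3) :
    HasSum (fun k => coef F k * expo k x) (F x) := by
  have h2 := hasSum_coef_smul_expoLp (ContinuousMap.toLp (E := ℂ) 2 volume ℂ F)
  simp only [coef_toLp] at h2
  -- The exponentials have sup norm one, so the series converges uniformly; its limit is `F` because
  -- the series also converges to `F` in `L²`.
  have h3 : HasSum (fun k => coef F k • expo k) F := by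
    refine ContinuousMap.hasSum_of_hasSum_Lp (p := 2) (μ := (volume : Measure T3)) (𝕜 := ℂ)
      (.of_norm ?_) h2
    simpa only [norm_smul, norm_expo, mul_one] using h.norm
  simpa only [map_smul] using! (ContinuousMap.evalCLM ℂ x).hasSum h3

/-! ### Fourier coefficients of real vector fields -/

/-- The inclusion of the `j`-th coordinate of `ℝ³` in `ℂ`. -/
def coordC (j : Fin 3) : E3 →L[ℝ] ℂ :=
  Complex.ofRealCLM.comp (EuclideanSpace.proj j)

lemma coordC_apply (j : Fin 3) (v : E3) : coordC j v = ((v j : ℝ) : ℂ) := rfl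

/-- The `j`-th component of a vector field, as a complex function. -/
def compC (j : Fin 3) : L2 →L[ℝ] Lp ℂ 2 (volume : Measure T3) := (coordC j).compLpL 2 volume

lemma compC_ae (j : Fin 3) (f : L2) : compC j f =ᵐ[volume] fun x => ((f x j : ℝ) : ℂ) :=
  (coordC j).coeFn_compLpL f

lemma fourierCoef_eq_coef (f : L2) (k : Freq) (j : Fin 3) :
    fourierCoef f k j = coef (fun x => ((f x j : ℝ) : ℂ)) k := by
  rw [fourierCoef, coef, Complex.real_smul, Complex.ofReal_inv]
  rfl

lemma fourierCoef_eq_coef_compC (f : L2) (k : Freq) (j : Fin 3) :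
    fourierCoef f k j = coef (compC j f) k := by
  rw [fourierCoef_eq_coef]
  exact coef_congr_ae (compC_ae j f).symm k

lemma fourierCoef_eq_inner (f : L2) (k : Freq) (j : Fin 3) :
    fourierCoef f k j = (Real.sqrt vol : ℂ)⁻¹ * inner ℂ (expoN k) (compC j f) := by
  rw [fourierCoef_eq_coef_compC, inner_expoN, ← mul_assoc, inv_mul_cancel₀ sqrt_vol_ne, one_mul]

/-- The Fourier coefficient as a continuous linear functional. -/
def fourierCoefL (k : Freq) (j : Fin 3) : L2 →L[ℝ] ℂ :=
  (Real.sqrt vol : ℂ)⁻¹ • (((innerSL ℂ (expoN k)).restrictScalars ℝ).comp (compC j))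

lemma fourierCoefL_apply (f : L2) (k : Freq) (j : Fin 3) :
    fourierCoefL k j f = fourierCoef f k j := by
  rw [fourierCoef_eq_inner]; rfl

lemma coef_conj (F : T3 → ℂ) (k : Freq) : coef (fun x => conj (F x)) k = conj (coef F (-k)) := by
  unfold coef
  rw [map_mul, map_inv₀, Complex.conj_ofReal, ← integral_conj]
  congr 2
  ext x
  rw [map_mul, expo_neg, neg_neg]

lemma coef_ofReal_neg (F : T3 → ℝ) (k : Freq) :
    coef (fun x => (F x : ℂ)) (-k) = conj (coef (fun x => (F x : ℂ)) k) := by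
  have := coef_conj (fun x => (F x : ℂ)) (-k)
  simpa only [Complex.conj_ofReal, neg_neg] using this

lemma fourierCoef_neg (f : L2) (k : Freq) (j : Fin 3) :
    fourierCoef f (-k) j = conj (fourierCoef f k j) := by
  rw [fourierCoef_eq_coef, coef_ofReal_neg, fourierCoef_eq_coef]

/-- The Fourier coefficients of a product are the convolution of the Fourier coefficients. -/
theorem hasSum_fourierCoef_convolution (f g : L2) (j i : Fin 3) (m : Freq) :
    HasSum (fun k => fourierCoef f k j * fourierCoef g (m - k) i)
      (coef (fun x => ((f x j * g x i : ℝ) : ℂ)) m) := by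
  -- the function `e_{-m} g_i` as an `L²` function
  have hmem : MemLp (fun x => expo (-m) x * compC i g x) 2 volume := by
    refine (Lp.memLp (compC i g)).of_le ?_ (Filter.Eventually.of_forall fun x => ?_)
    · exact (expo (-m)).continuous.aestronglyMeasurable.mul (Lp.memLp _).1
    · rw [norm_mul, norm_expo_apply, one_mul]
  have h := hasSum_conj_coef_mul_coef (compC j f) hmem.toLp
  have hc : ∀ k, coef hmem.toLp k = fourierCoef g (k + m) i := by
    intro k
    rw [fourierCoef_eq_coef_compC, coef_congr_ae hmem.coeFn_toLp]
    unfold coef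
    congr 2; ext x
    rw [← mul_assoc, ← expo_add]
    congr 3; abel
  simp only [hc, ← fourierCoef_eq_coef_compC, ← fourierCoef_neg] at h
  -- For real `f`, conjugating a coefficient negates its frequency; the substitution `k ↦ -k`
  -- therefore turns Parseval for `f_j` and `e_{-m} g_i` into a convolution.
  have h2 := (Equiv.neg Freq).hasSum_iff.mpr h
  convert! h2 using 1
  · ext1 k
    simp [sub_eq_neg_add]
  · unfold coef
    congr 1
    refine integral_congr_ae ?_
    filter_upwards [compC_ae j f, compC_ae i g, hmem.coeFn_toLp] with x h1 h2 h3
    rw [h3, h1, h2, Complex.conj_ofReal]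
    push_cast
    ring

/-- Parseval's identity for real vector fields. -/
theorem hasSum_inner_fourierCoef (f g : L2) :
    HasSum (fun k => ∑ j, fourierCoef f k j * conj (fourierCoef g k j))
      ((vol : ℂ)⁻¹ * (inner ℝ f g : ℝ)) := by
  have h : ∀ j, HasSum (fun k => fourierCoef f k j * conj (fourierCoef g k j))
      ((vol : ℂ)⁻¹ * ∫ x, ((f x j * g x j : ℝ) : ℂ)) := by
    intro j
    have := hasSum_fourierCoef_convolution f g j j 0
    simp only [zero_sub, fourierCoef_neg] at this
    convert! this using 1
    simp [coef, expo_zero]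
  convert! hasSum_sum (s := Finset.univ) fun j _ => h j using 1
  rw [← Finset.mul_sum, MeasureTheory.L2.inner_def]
  congr 1
  have hint : ∀ j ∈ Finset.univ, Integrable (fun x => f x j * g x j) volume := by
    intro j _
    have hf := (Lp.memLp f).continuousLinearMap_comp (EuclideanSpace.proj j : E3 →L[ℝ] ℝ)
    have hg := (Lp.memLp g).continuousLinearMap_comp (EuclideanSpace.proj j : E3 →L[ℝ] ℝ)
    exact hf.integrable_mul hg
  simp only [integral_complex_ofReal]
  rw [← Complex.ofReal_sum, ← integral_finsetSum _ hint]
  congr 1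
  refine integral_congr_ae (Filter.Eventually.of_forall fun x => ?_)
  simp [PiLp.inner_apply, mul_comm]

theorem hasSum_norm_sq_fourierCoef (f : L2) :
    HasSum (fun k => ∑ j, ‖fourierCoef f k j‖ ^ 2) (vol⁻¹ * ‖f‖ ^ 2) := by
  have h := Complex.hasSum_re (hasSum_inner_fourierCoef f f)
  simp only [real_inner_self_eq_norm_sq] at h
  convert! h using 1
  · ext1 k
    rw [Complex.re_sum]
    refine Finset.sum_congr rfl fun j _ => ?_
    rw [Complex.mul_conj, Complex.normSq_eq_norm_sq, Complex.ofReal_re]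
  · rw [← Complex.ofReal_inv, ← Complex.ofReal_mul, Complex.ofReal_re]

/-- Parseval's identity makes the `L²` norm of the difference vanish. -/
theorem ext_fourierCoef {f g : L2} (h : ∀ k j, fourierCoef f k j = fourierCoef g k j) : f = g := by
  have h0 : ∀ k j, fourierCoef (f - g) k j = 0 := by
    intro k j
    rw [← fourierCoefL_apply, map_sub, fourierCoefL_apply, fourierCoefL_apply, h, sub_self]
  have := hasSum_norm_sq_fourierCoef (f - g)
  simp only [h0, norm_zero, ne_eq, OfNat.ofNat_ne_zero, not_false_eq_true, zero_pow,
    Finset.sum_const_zero] at this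
  have h1 := this.unique hasSum_zero
  have h2 := vol_pos
  rw [← sub_eq_zero, ← norm_eq_zero]
  simpa [h2.ne'] using h1

/-! ### Reconstruction of a real field from its Fourier coefficients -/

/-- The map `z ↦ (Re z) eⱼ`. -/
def reCoord (j : Fin 3) : ℂ →L[ℝ] E3 :=
  Complex.reCLM.smulRight (EuclideanSpace.single j (1 : ℝ))

lemma reCoord_apply (i j : Fin 3) (z : ℂ) : reCoord j z i = if i = j then z.re else 0 := by
  simp only [reCoord, ContinuousLinearMap.smulRight_apply, Complex.reCLM_apply, PiLp.smul_apply,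
    PiLp.single_apply, smul_eq_mul, mul_ite, mul_one, mul_zero]

/-- The square-summable sequences on `ℤ³`. -/
abbrev SqSeq : Type := lp (fun _ : Freq => ℂ) 2

/-- The complex function with given Fourier coefficients. -/
def synthC : SqSeq →L[ℂ] Lp ℂ 2 (volume : Measure T3) :=
  (Real.sqrt vol : ℂ) • (expoBasis.repr.symm.toContinuousLinearEquiv : SqSeq →L[ℂ] _)

lemma coef_synthC (a : SqSeq) (k : Freq) : coef (synthC a) k = a k := by
  have h : inner ℂ (expoN k) (synthC a) = (Real.sqrt vol : ℂ) * a k := by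
    rw [synthC, _root_.smul_apply, inner_smul_right, ← expoBasis_apply,
      ← HilbertBasis.repr_apply_apply]
    simp
  rw [inner_expoN] at h
  exact mul_left_cancel₀ sqrt_vol_ne h

/-- The real vector field `Re ∑ₖ aₖ e^{ik·x}`. -/
def synth (a : Fin 3 → SqSeq) : L2 := ∑ j, (reCoord j).compLpL 2 volume (synthC (a j))

lemma compC_synth (a : Fin 3 → SqSeq) (j : Fin 3) :
    compC j (synth a) =ᵐ[volume]
      fun x => (1 / 2 : ℂ) * (synthC (a j) x + conj (synthC (a j) x)) := by
  have h1 : ∀ i, (reCoord i).compLpL 2 volume (synthC (a i)) =ᵐ[volume]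
      fun x => reCoord i (synthC (a i) x) := fun i => (reCoord i).coeFn_compLpL _
  have h2 : synth a =ᵐ[volume] fun x => ∑ i, reCoord i (synthC (a i) x) := by
    rw [synth, Fin.sum_univ_three]
    filter_upwards [h1 0, h1 1, h1 2, Lp.coeFn_add ((reCoord 0).compLpL 2 volume (synthC (a 0)) +
      (reCoord 1).compLpL 2 volume (synthC (a 1))) ((reCoord 2).compLpL 2 volume (synthC (a 2))),
      Lp.coeFn_add ((reCoord 0).compLpL 2 volume (synthC (a 0)))
      ((reCoord 1).compLpL 2 volume (synthC (a 1)))] with x e0 e1 e2 e3 e4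
    rw [e3, Pi.add_apply, e4, Pi.add_apply, e0, e1, e2, Fin.sum_univ_three]
  filter_upwards [compC_ae j (synth a), h2] with x e1 e2
  rw [e1, e2, Complex.add_conj]
  have : (∑ i, reCoord i (synthC (a i) x)) j = (synthC (a j) x).re := by
    rw [WithLp.ofLp_sum, Finset.sum_apply]
    simp [reCoord_apply]
  rw [this]
  push_cast; ring

/-- Taking the real part averages a function with its conjugate, and conjugation reflects the
frequency. The sequence `a` itself is recovered exactly when it has the Hermitian symmetry of a real
field. -/
theorem fourierCoef_synth (a : Fin 3 → SqSeq) (k : Freq) (j : Fin 3) :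
    fourierCoef (synth a) k j = (1 / 2 : ℂ) * (a j k + conj (a j (-k))) := by
  rw [fourierCoef_eq_coef_compC, coef_congr_ae (compC_synth a j)]
  have hi : ∀ F : T3 → ℂ, Integrable F volume → Integrable (fun x => expo (-k) x * F x) volume := by
    intro F hF
    refine hF.mono ((expo (-k)).continuous.aestronglyMeasurable.mul hF.1)
      (Filter.Eventually.of_forall fun x => ?_)
    rw [norm_mul, norm_expo_apply, one_mul]
  have hF : Integrable (synthC (a j)) volume := (Lp.memLp (synthC (a j))).integrable (by norm_num)
  have hG : Integrable (fun x => conj (synthC (a j) x)) volume := by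
    have := (Complex.conjCLE : ℂ →L[ℝ] ℂ).integrable_comp hF
    exact this
  have key : coef (fun x => (1 / 2 : ℂ) * (synthC (a j) x + conj (synthC (a j) x))) k
      = (1 / 2 : ℂ) * (coef (synthC (a j)) k + coef (fun x => conj (synthC (a j) x)) k) := by
    have h2 : ∫ x, expo (-k) x * ((1 / 2 : ℂ) * (synthC (a j) x + conj (synthC (a j) x)))
        = (1 / 2 : ℂ) * ∫ x, (expo (-k) x * synthC (a j) x
          + expo (-k) x * conj (synthC (a j) x)) := by
      rw [← integral_const_mul]
      refine integral_congr_ae (Filter.Eventually.of_forall fun x => ?_)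
      simp only
      ring
    unfold coef
    rw [h2, integral_add (hi _ hF) (hi _ hG)]
    ring
  rw [key, coef_conj, coef_synthC, coef_synthC]

end Magnetization
end

noncomputable section
namespace Magnetization
open scoped ComplexConjugate ENNReal

/-! ### Sums over the lattice -/

/-- The weight `1 + |k|`. -/
def wt (k : Freq) : ℝ := 1 + Real.sqrt (∑ i, (k i : ℝ) ^ 2)

lemma one_le_wt (k : Freq) : 1 ≤ wt k := le_add_of_nonneg_right (Real.sqrt_nonneg _)

lemma wt_pos (k : Freq) : 0 < wt k := one_pos.trans_le (one_le_wt k)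

lemma abs_le_sqrt_sum (k : Freq) (i : Fin 3) : |(k i : ℝ)| ≤ Real.sqrt (∑ i, (k i : ℝ) ^ 2) := by
  rw [← Real.sqrt_sq_eq_abs]
  exact Real.sqrt_le_sqrt (Finset.single_le_sum (f := fun i => (k i : ℝ) ^ 2)
    (fun j _ => sq_nonneg _) (Finset.mem_univ i))

lemma one_add_abs_le_wt (k : Freq) (i : Fin 3) : 1 + |(k i : ℝ)| ≤ wt k := by
  have := abs_le_sqrt_sum k i
  unfold wt; linarith

lemma abs_le_wt (k : Freq) (i : Fin 3) : |(k i : ℝ)| ≤ wt k := by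
  have := one_add_abs_le_wt k i
  linarith

/-- The weight `1 + |k|` in `[0, ∞]`. -/
def ewt (k : Freq) : ℝ≥0∞ := ENNReal.ofReal (wt k)

lemma ewt_ne_zero (k : Freq) : ewt k ≠ 0 := by
  simp [ewt, wt_pos k]

lemma ewt_ne_top (k : Freq) : ewt k ≠ ⊤ := ENNReal.ofReal_ne_top

lemma one_le_ewt (k : Freq) : 1 ≤ ewt k := by
  simpa [ewt] using one_le_wt k

/-- One coordinate is fixed and the other two range over an interval of `2|n| + 1` integers. -/
lemma card_dominated_le (i : Fin 3) (n : ℤ) :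
    ∑' k : Freq, (if k i = n ∧ ∀ j, |k j| ≤ |k i| then (1 : ℝ≥0∞) else 0)
      ≤ ((2 * n.natAbs + 1) ^ 2 : ℕ) := by
  classical
  set s : Finset Freq := Fintype.piFinset
    (fun j => if j = i then {n} else Finset.Icc (-|n|) |n|) with hs
  have hcard : s.card = (2 * n.natAbs + 1) ^ 2 := by
    rw [hs, Fintype.card_piFinset]
    have h1 : (Finset.Icc (-|n|) |n|).card = 2 * n.natAbs + 1 := by
      rw [Int.card_Icc, Int.abs_eq_natAbs]; omega
    have : ∀ j, (if j = i then {n} else Finset.Icc (-|n|) |n|).card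
        = if j = i then 1 else 2 * n.natAbs + 1 := by
      intro j; split_ifs <;> simp [h1]
    simp only [this]
    fin_cases i <;> simp [Fin.prod_univ_three, sq]
  rw [tsum_eq_sum (s := s)]
  · rw [← hcard]
    calc _ ≤ ∑ _k ∈ s, (1 : ℝ≥0∞) := Finset.sum_le_sum fun k _ => by split_ifs <;> simp
      _ = _ := by simp
  · intro k hk
    rw [if_neg]
    rintro ⟨h1, h2⟩
    apply hk
    rw [hs, Fintype.mem_piFinset]
    intro j
    split_ifs with hj
    · simp [hj, h1]
    · rw [Finset.mem_Icc, ← abs_le, ← h1]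
      exact h2 j

/-- A sum over `ℤ³` of a function dominated by a function of the largest coordinate. -/
theorem tsum_freq_le (F : Freq → ℝ≥0∞) (φ : ℤ → ℝ≥0∞)
    (h : ∀ k i, (∀ j, |k j| ≤ |k i|) → F k ≤ φ (k i)) :
    ∑' k, F k ≤ 3 * ∑' n : ℤ, φ n * ((2 * n.natAbs + 1) ^ 2 : ℕ) := by
  classical
  have hF : ∀ k, F k ≤ ∑ i, ∑' n : ℤ, φ n *
      (if k i = n ∧ ∀ j, |k j| ≤ |k i| then (1 : ℝ≥0∞) else 0) := by
    intro k
    -- Charge `k` to a coordinate of largest modulus. Summing over all three coordinates counts ties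
    -- more than once, which is harmless in an upper bound and gives the factor 3.
    obtain ⟨i, -, hi⟩ := Finset.exists_max_image Finset.univ (fun i => |k i|) Finset.univ_nonempty
    refine (h k i fun j => hi j (Finset.mem_univ j)).trans ?_
    refine le_trans ?_ (Finset.single_le_sum (f := fun i => ∑' n : ℤ, φ n *
      (if k i = n ∧ ∀ j, |k j| ≤ |k i| then (1 : ℝ≥0∞) else 0)) (fun _ _ => zero_le)
      (Finset.mem_univ i))
    refine le_trans ?_ (ENNReal.le_tsum (k i))
    rw [if_pos ⟨rfl, fun j => hi j (Finset.mem_univ j)⟩, mul_one]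
  calc ∑' k, F k ≤ ∑' k : Freq, ∑ i, ∑' n : ℤ, φ n *
        (if k i = n ∧ ∀ j, |k j| ≤ |k i| then (1 : ℝ≥0∞) else 0) := ENNReal.tsum_le_tsum hF
    _ = ∑ i, ∑' n : ℤ, φ n * ∑' k : Freq,
        (if k i = n ∧ ∀ j, |k j| ≤ |k i| then (1 : ℝ≥0∞) else 0) := by
      rw [Summable.tsum_finsetSum (fun _ _ => ENNReal.summable)]
      refine Finset.sum_congr rfl fun i _ => ?_
      rw [ENNReal.tsum_comm]
      simp only [ENNReal.tsum_mul_left]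
    _ ≤ ∑ _i : Fin 3, ∑' n : ℤ, φ n * ((2 * n.natAbs + 1) ^ 2 : ℕ) := by
      refine Finset.sum_le_sum fun i _ => ENNReal.tsum_le_tsum fun n => ?_
      gcongr
      exact card_dominated_le i n
    _ = _ := by simp

lemma tsum_int_indicator_le (R : ℝ) (hR : 1 ≤ R) :
    ∑' n : ℤ, (if 1 + |(n : ℝ)| ≤ R then (1 : ℝ≥0∞) else 0) ≤ ENNReal.ofReal (2 * R) := by
  classical
  set N := ⌊R - 1⌋ with hN
  have hN0 : 0 ≤ N := Int.floor_nonneg.mpr (by linarith)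
  rw [tsum_eq_sum (s := Finset.Icc (-N) N)]
  · calc _ ≤ ∑ _k ∈ Finset.Icc (-N) N, (1 : ℝ≥0∞) :=
          Finset.sum_le_sum fun k _ => by split_ifs <;> simp
      _ = ((Finset.Icc (-N) N).card : ℝ≥0∞) := by simp
      _ = ENNReal.ofReal ((Finset.Icc (-N) N).card : ℝ) := by simp
      _ ≤ _ := by
        apply ENNReal.ofReal_le_ofReal
        rw [Int.card_Icc]
        have h1 : ((N + 1 - -N).toNat : ℝ) = 2 * N + 1 := by
          have : ((N + 1 - -N).toNat : ℤ) = 2 * N + 1 := by omega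
          exact_mod_cast this
        rw [h1]
        have := Int.floor_le (R - 1)
        linarith
  · intro n hn
    rw [if_neg]
    intro h
    apply hn
    rw [Finset.mem_Icc, ← abs_le, hN, Int.le_floor]
    push_cast
    linarith

/-- The sum of `(1 + |k|)^{-s}` over a ball of radius `R`, for `s ≤ 2`. -/
theorem tsum_wt_inv_pow_le (R : ℝ) (hR : 1 ≤ R) {s t : ℕ} (hst : s + t = 2) :
    ∑' k : Freq, (if wt k ≤ R then ENNReal.ofReal ((wt k)⁻¹ ^ s) else 0)
      ≤ 24 * ENNReal.ofReal (R ^ (t + 1)) := by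
  have h1 := tsum_freq_le (fun k => if wt k ≤ R then ENNReal.ofReal ((wt k)⁻¹ ^ s) else 0)
    (fun n => if 1 + |(n : ℝ)| ≤ R then ENNReal.ofReal ((1 + |(n : ℝ)|)⁻¹ ^ s) else 0) (by
      intro k i _
      have hk := one_add_abs_le_wt k i
      by_cases h : wt k ≤ R
      · rw [if_pos h, if_pos (hk.trans h)]
        apply ENNReal.ofReal_le_ofReal
        have h0 : 0 < 1 + |(k i : ℝ)| := by positivity
        have h2 : 0 ≤ (wt k)⁻¹ := (inv_pos.mpr (wt_pos k)).le
        gcongr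
      · rw [if_neg h]; exact zero_le)
  refine h1.trans ?_
  -- The shell has at most `(2|n| + 1)² ≤ 4 (1 + |n|)²` points, and `s` of the two powers are
  -- cancelled by the summand. At most `2R` integers `n` contribute, so the final constant is `3 · 4
  -- · 2 = 24`.
  have h2 : ∀ n : ℤ, (if 1 + |(n : ℝ)| ≤ R then ENNReal.ofReal ((1 + |(n : ℝ)|)⁻¹ ^ s) else 0)
        * ((2 * n.natAbs + 1) ^ 2 : ℕ)
      ≤ ENNReal.ofReal (4 * R ^ t) * (if 1 + |(n : ℝ)| ≤ R then (1 : ℝ≥0∞) else 0) := by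
    intro n
    split_ifs with h
    · rw [mul_one, ← ENNReal.ofReal_natCast, ← ENNReal.ofReal_mul (by positivity)]
      apply ENNReal.ofReal_le_ofReal
      push_cast
      rw [Nat.cast_natAbs, Int.cast_abs]
      set x := 1 + |(n : ℝ)| with hx
      have hx1 : 1 ≤ x := by rw [hx]; linarith [abs_nonneg (n : ℝ)]
      have hx0 : 0 < x := by linarith
      calc x⁻¹ ^ s * (2 * |(n : ℝ)| + 1) ^ 2 ≤ x⁻¹ ^ s * (2 * x) ^ 2 := by
            gcongr
            rw [hx]; linarith
        _ = 4 * x ^ t := by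
            have hxx : x ^ 2 = x ^ s * x ^ t := by rw [← hst, pow_add]
            rw [inv_pow, mul_pow, hxx]
            field_simp
            norm_num
        _ ≤ 4 * R ^ t := by gcongr
    · simp
  calc _ ≤ 3 * ∑' n : ℤ, ENNReal.ofReal (4 * R ^ t) *
        (if 1 + |(n : ℝ)| ≤ R then (1 : ℝ≥0∞) else 0) := by
        exact mul_le_mul_right (ENNReal.tsum_le_tsum h2) _
    _ ≤ 3 * (ENNReal.ofReal (4 * R ^ t) * ENNReal.ofReal (2 * R)) := by
        rw [ENNReal.tsum_mul_left]
        gcongr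
        exact tsum_int_indicator_le R hR
    _ = _ := by
        rw [← ENNReal.ofReal_mul (by positivity)]
        rw [show (3 : ℝ≥0∞) = ENNReal.ofReal 3 by simp, show (24 : ℝ≥0∞) = ENNReal.ofReal 24 by simp,
          ← ENNReal.ofReal_mul (by positivity), ← ENNReal.ofReal_mul (by positivity)]
        congr 1; ring

/-- The function `1 / (1 + ∑ kᵢ⁴)` is summable on `ℤ³`. -/
theorem summable_inv_one_add_sum_pow_four :
    Summable fun k : Freq => (1 + ∑ i, (k i : ℝ) ^ 4)⁻¹ := by
  have h1 := tsum_freq_le (fun k => ENNReal.ofReal ((1 + ∑ i, (k i : ℝ) ^ 4)⁻¹))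
    (fun n => ENNReal.ofReal ((1 + (n : ℝ) ^ 4)⁻¹)) (by
      intro k i _
      apply ENNReal.ofReal_le_ofReal
      have h0 : ∀ j ∈ Finset.univ, 0 ≤ (k j : ℝ) ^ 4 := fun j _ => by positivity
      have := Finset.single_le_sum h0 (Finset.mem_univ i)
      have h2 : (0 : ℝ) < 1 + (k i : ℝ) ^ 4 := by positivity
      gcongr)
  -- The 9 comes from `(2x + 1)² ≤ 9x²` for `x ≥ 1`. At `n = 0` the quotient is `1 / 0 = 0`, so a
  -- separate term is added to majorize the summand there.
  have hs : Summable fun n : ℤ => (9 : ℝ) * ((1 : ℝ) / |(n : ℝ)| ^ 2) + (if n = 0 then 9 else 0) := by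
    refine Summable.add (Summable.mul_left _ ?_) ?_
    · have := Real.summable_one_div_int_pow (p := 2) |>.mpr (by norm_num)
      simpa [sq_abs] using this
    · exact summable_of_ne_finset_zero (s := {0}) (by intro n hn; simp at hn; simp [hn])
  have h3 : ∑' n : ℤ, ENNReal.ofReal ((1 + (n : ℝ) ^ 4)⁻¹) * ((2 * n.natAbs + 1) ^ 2 : ℕ) ≠ ⊤ := by
    refine ne_top_of_le_ne_top (hs.tsum_ofReal_ne_top) ?_
    refine ENNReal.tsum_le_tsum fun n => ?_
    rw [← ENNReal.ofReal_natCast, ← ENNReal.ofReal_mul (by positivity)]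
    apply ENNReal.ofReal_le_ofReal
    push_cast
    rw [Nat.cast_natAbs, Int.cast_abs]
    by_cases hn : n = 0
    · simp [hn]
    · have hx : 1 ≤ |(n : ℝ)| := by
        rw [← Int.cast_abs]; exact_mod_cast Int.one_le_abs hn
      rw [if_neg hn, add_zero, show (n : ℝ) ^ 4 = |(n : ℝ)| ^ 4 by rw [pow_abs, abs_of_nonneg (by positivity)]]
      set x := |(n : ℝ)|
      have hx0 : 0 < x := by linarith
      rw [mul_one_div, inv_mul_eq_div, div_le_div_iff₀ (by positivity) (by positivity)]
      have : (2 * x + 1) ^ 2 ≤ 9 * x ^ 2 := by nlinarith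
      calc (2 * x + 1) ^ 2 * x ^ 2 ≤ 9 * x ^ 2 * x ^ 2 := by gcongr
        _ ≤ 9 * (1 + x ^ 4) := by nlinarith
  have h4 : ∑' k : Freq, ENNReal.ofReal ((1 + ∑ i, (k i : ℝ) ^ 4)⁻¹) ≠ ⊤ :=
    ne_top_of_le_ne_top (ENNReal.mul_ne_top (by simp) h3) h1
  refine (ENNReal.summable_toReal h4).congr fun k => ?_
  rw [ENNReal.toReal_ofReal (by positivity)]

/-! ### Convolution estimate -/

/-- The Cauchy–Schwarz inequality for sums in `[0, ∞]`. -/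
theorem tsum_mul_sq_le {α : Type*} (f g : α → ℝ≥0∞) :
    (∑' k, f k * g k) ^ 2 ≤ (∑' k, f k ^ 2) * ∑' k, g k ^ 2 := by
  let _ : MeasurableSpace α := ⊤
  have h := ENNReal.lintegral_mul_le_Lp_mul_Lq (Measure.count : Measure α)
    (Real.HolderConjugate.two_two) (f := f) (g := g) (Measurable.of_discrete.aemeasurable)
    (Measurable.of_discrete.aemeasurable)
  simp only [lintegral_count, Pi.mul_apply] at h
  calc _ ≤ ((∑' k, f k ^ (2 : ℝ)) ^ (1 / (2 : ℝ)) * (∑' k, g k ^ (2 : ℝ)) ^ (1 / (2 : ℝ))) ^ 2 := by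
        gcongr
    _ = _ := by
        rw [mul_pow, ← ENNReal.rpow_natCast, ← ENNReal.rpow_natCast, ← ENNReal.rpow_mul,
          ← ENNReal.rpow_mul]
        norm_num

lemma add_sq_le_two_mul (a b : ℝ≥0∞) : (a + b) ^ 2 ≤ 2 * a ^ 2 + 2 * b ^ 2 := by
  have h := ENNReal.rpow_add_le_mul_rpow_add_rpow a b (p := 2) (by norm_num)
  norm_num at h
  rwa [mul_add] at h

lemma tsum_sub_left (g : Freq → ℝ≥0∞) (m : Freq) : ∑' k, g (m - k) = ∑' k, g k :=
  (Equiv.subLeft m).tsum_eq g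

lemma tsum_sub_right (g : Freq → ℝ≥0∞) (m : Freq) : ∑' k, g (k - m) = ∑' k, g k :=
  (Equiv.subRight m).tsum_eq g

/-- This is the product estimate `H¹ · L² ⊆ H^{-1/2}` in three dimensions. Split the frequencies `k`
of `a` according to whether they are below or above the output frequency `m`. Below, the weight `(1
+ |k|)²` is inserted in Cauchy–Schwarz, and the sum of its inverse over the ball grows like `1 +
|m|`, which the negative weight absorbs. Above, the sum over `m` is done last and costs `(1 +
|k|)²`. The constant is `2 · 24 + 2 · 24`. -/
theorem tsum_convolution_sq_le (a b : Freq → ℝ≥0∞) :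
    ∑' m, (ewt m)⁻¹ * (∑' k, a k * b (m - k)) ^ 2
      ≤ 96 * ((∑' k, ewt k ^ 2 * a k ^ 2) * ∑' k, b k ^ 2) := by
  set A := ∑' k, ewt k ^ 2 * a k ^ 2 with hA
  set Bs := ∑' k, b k ^ 2 with hB
  -- low frequencies of `a`
  have hlow : ∀ m, (ewt m)⁻¹ * (∑' k, (if wt k ≤ wt m then a k else 0) * b (m - k)) ^ 2
      ≤ 24 * ∑' k, ewt k ^ 2 * a k ^ 2 * b (m - k) ^ 2 := by
    intro m
    have h1 : ∀ k, (if wt k ≤ wt m then a k else 0) * b (m - k)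
        = (if wt k ≤ wt m then (ewt k)⁻¹ else 0) * (ewt k * a k * b (m - k)) := by
      intro k
      split_ifs
      · rw [← mul_assoc, ← mul_assoc, ENNReal.inv_mul_cancel (ewt_ne_zero k) (ewt_ne_top k), one_mul]
      · simp
    simp only [h1]
    have h2 := tsum_wt_inv_pow_le (wt m) (one_le_wt m) (s := 2) (t := 0) rfl
    have h3 : ∑' k, (if wt k ≤ wt m then (ewt k)⁻¹ else 0) ^ 2 ≤ 24 * ewt m := by
      simp only [zero_add, pow_one] at h2
      refine le_trans (le_of_eq (tsum_congr fun k => ?_)) h2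
      split_ifs
      · rw [ewt, ENNReal.ofReal_pow (inv_pos.mpr (wt_pos k)).le, ENNReal.ofReal_inv_of_pos (wt_pos k)]
      · simp
    calc _ ≤ (ewt m)⁻¹ * ((24 * ewt m) * ∑' k, (ewt k * a k * b (m - k)) ^ 2) := by
          gcongr
          exact (tsum_mul_sq_le _ _).trans (mul_le_mul_left h3 _)
      _ = ((ewt m)⁻¹ * ewt m) * (24 * ∑' k, (ewt k * a k * b (m - k)) ^ 2) := by ring
      _ = _ := by
          rw [ENNReal.inv_mul_cancel (ewt_ne_zero m) (ewt_ne_top m), one_mul]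
          refine congrArg _ (tsum_congr fun k => ?_)
          rw [mul_pow, mul_pow]
  -- High frequencies of `a`: Cauchy–Schwarz without a weight, keeping the constraint `wt m ≤ wt k`
  -- for the later summation over `m`.
  have hhigh : ∀ m, (ewt m)⁻¹ * (∑' k, (if wt k ≤ wt m then 0 else a k) * b (m - k)) ^ 2
      ≤ Bs * ∑' k, (if wt m ≤ wt k then (ewt m)⁻¹ else 0) * a k ^ 2 := by
    intro m
    calc _ ≤ (ewt m)⁻¹ * ((∑' k, (if wt k ≤ wt m then 0 else a k) ^ 2) * Bs) := by
          gcongr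
          refine (tsum_mul_sq_le _ _).trans ?_
          rw [tsum_sub_left (fun k => b k ^ 2)]
      _ = Bs * ∑' k, (ewt m)⁻¹ * (if wt k ≤ wt m then 0 else a k) ^ 2 := by
          rw [ENNReal.tsum_mul_left]; ring
      _ ≤ _ := by
          refine mul_le_mul_right (ENNReal.tsum_le_tsum fun k => ?_) _
          by_cases h : wt k ≤ wt m
          · simp [h]
          · simp [h, (not_le.mp h).le]
  have hsplit : ∀ m, (ewt m)⁻¹ * (∑' k, a k * b (m - k)) ^ 2
      ≤ 2 * (24 * ∑' k, ewt k ^ 2 * a k ^ 2 * b (m - k) ^ 2)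
        + 2 * (Bs * ∑' k, (if wt m ≤ wt k then (ewt m)⁻¹ else 0) * a k ^ 2) := by
    intro m
    have : ∑' k, a k * b (m - k) = (∑' k, (if wt k ≤ wt m then a k else 0) * b (m - k))
        + ∑' k, (if wt k ≤ wt m then 0 else a k) * b (m - k) := by
      rw [← ENNReal.tsum_add]
      refine tsum_congr fun k => ?_
      split_ifs <;> simp
    rw [this]
    calc _ ≤ (ewt m)⁻¹ * (2 * (∑' k, (if wt k ≤ wt m then a k else 0) * b (m - k)) ^ 2
          + 2 * (∑' k, (if wt k ≤ wt m then 0 else a k) * b (m - k)) ^ 2) := by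
          gcongr; exact add_sq_le_two_mul _ _
      _ = 2 * ((ewt m)⁻¹ * (∑' k, (if wt k ≤ wt m then a k else 0) * b (m - k)) ^ 2)
          + 2 * ((ewt m)⁻¹ * (∑' k, (if wt k ≤ wt m then 0 else a k) * b (m - k)) ^ 2) := by ring
      _ ≤ _ := add_le_add (mul_le_mul_right (hlow m) _) (mul_le_mul_right (hhigh m) _)
  refine (ENNReal.tsum_le_tsum hsplit).trans ?_
  rw [ENNReal.tsum_add, ENNReal.tsum_mul_left, ENNReal.tsum_mul_left, ENNReal.tsum_mul_left,
    ENNReal.tsum_mul_left]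
  have e1 : ∑' m, ∑' k, ewt k ^ 2 * a k ^ 2 * b (m - k) ^ 2 = A * Bs := by
    rw [ENNReal.tsum_comm]
    simp only [ENNReal.tsum_mul_left, tsum_sub_right (fun k => b k ^ 2)]
    rw [ENNReal.tsum_mul_right]
  -- After exchanging the sums, `(1 + |m|)⁻¹` is summed over the ball `wt m ≤ wt k`, which gives `24
  -- (wt k)²`, the `H¹` weight of `a`.
  have e2 : ∑' m, ∑' k, (if wt m ≤ wt k then (ewt m)⁻¹ else 0) * a k ^ 2 ≤ 24 * A := by
    rw [ENNReal.tsum_comm, hA, ← ENNReal.tsum_mul_left]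
    refine ENNReal.tsum_le_tsum fun k => ?_
    rw [ENNReal.tsum_mul_right, ← mul_assoc]
    gcongr
    have h2 := tsum_wt_inv_pow_le (wt k) (one_le_wt k) (s := 1) (t := 1) rfl
    rw [ENNReal.ofReal_pow (wt_pos k).le] at h2
    refine le_trans (le_of_eq (tsum_congr fun m => ?_)) h2
    split_ifs
    · rw [ewt, pow_one, ENNReal.ofReal_inv_of_pos (wt_pos m)]
    · rfl
  rw [e1]
  calc _ ≤ 2 * (24 * (A * Bs)) + 2 * (Bs * (24 * A)) := by gcongr
    _ = _ := by ring

end Magnetization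
end

noncomputable section
namespace Magnetization
open scoped ComplexConjugate ENNReal

/-! ### The bilinear terms on the Fourier side -/

/-- Sequences of Fourier coefficients of vector fields. -/
abbrev Modes : Type := Freq → Fin 3 → ℂ

/-- The squared weighted norm `∑ (1 + |k|)^s |wₖ|²`. -/
def sob (s : ℕ) (w : Modes) : ℝ≥0∞ := ∑' k, ewt k ^ s * ∑ j, ‖w k j‖ₑ ^ 2

lemma sob_mono {s t : ℕ} (h : s ≤ t) (w : Modes) : sob s w ≤ sob t w := by
  unfold sob
  gcongr with k
  exact one_le_ewt k

/-- The `ℓ¹` size of the `k`-th coefficient. -/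
def size (w : Modes) (k : Freq) : ℝ≥0∞ := ∑ j, ‖w k j‖ₑ

lemma enorm_le_size (w : Modes) (k : Freq) (j : Fin 3) : ‖w k j‖ₑ ≤ size w k :=
  Finset.single_le_sum (f := fun j => ‖w k j‖ₑ) (fun _ _ => zero_le) (Finset.mem_univ j)

lemma sum_sq_le_three_mul (f : Fin 3 → ℝ≥0∞) : (∑ j, f j) ^ 2 ≤ 3 * ∑ j, f j ^ 2 := by
  have := tsum_mul_sq_le (fun _ : Fin 3 => (1 : ℝ≥0∞)) f
  simpa [tsum_fintype] using this

lemma size_sq_le (w : Modes) (k : Freq) : size w k ^ 2 ≤ 3 * ∑ j, ‖w k j‖ₑ ^ 2 :=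
  sum_sq_le_three_mul _

lemma tsum_size_sq_le (w : Modes) (s : ℕ) : ∑' k, ewt k ^ s * size w k ^ 2 ≤ 3 * sob s w := by
  rw [sob, ← ENNReal.tsum_mul_left]
  refine ENNReal.tsum_le_tsum fun k => ?_
  rw [mul_left_comm]
  gcongr
  exact size_sq_le w k

lemma enorm_I_mul_intCast_le (k : Freq) (j : Fin 3) : ‖Complex.I * (k j : ℂ)‖ₑ ≤ ewt k := by
  rw [← ofReal_norm, norm_mul, Complex.norm_I, one_mul, Complex.norm_intCast]
  exact ENNReal.ofReal_le_ofReal (abs_le_wt k j)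

/-- The Fourier coefficients of `(u · ∇) w`. -/
def transport (u w : Modes) : Modes := fun m i =>
  ∑' k, ∑ j, u k j * (Complex.I * ((m - k) j : ℤ) * w (m - k) i)

/-- The Fourier coefficients of `(∇u)ᵀ w`. -/
def stretch (u w : Modes) : Modes := fun m i =>
  ∑' k, ∑ j, Complex.I * (k i : ℤ) * u k j * w (m - k) j

/-- The Fourier coefficients of `(u · ∇) w + (∇u)ᵀ w`. -/
def bil (u w : Modes) : Modes := fun m i => transport u w m i + stretch u w m i

lemma enorm_transport_term_le (u w : Modes) (m k : Freq) (i : Fin 3) :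
    ‖∑ j, u k j * (Complex.I * ((m - k) j : ℤ) * w (m - k) i)‖ₑ
      ≤ size u k * (ewt (m - k) * size w (m - k)) := by
  refine (enorm_sum_le _ _).trans ?_
  rw [size, Finset.sum_mul]
  refine Finset.sum_le_sum fun j _ => ?_
  rw [enorm_mul, enorm_mul]
  gcongr
  · exact enorm_I_mul_intCast_le _ _
  · exact enorm_le_size _ _ _

lemma enorm_stretch_term_le (u w : Modes) (m k : Freq) (i : Fin 3) :
    ‖∑ j, Complex.I * (k i : ℤ) * u k j * w (m - k) j‖ₑ
      ≤ ewt k * size u k * size w (m - k) := by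
  refine (enorm_sum_le _ _).trans ?_
  rw [size, Finset.mul_sum, Finset.sum_mul]
  refine Finset.sum_le_sum fun j _ => ?_
  rw [enorm_mul, enorm_mul]
  gcongr
  · exact enorm_I_mul_intCast_le _ _
  · exact enorm_le_size _ _ _

lemma tsum_transport_bound_sq_le (u w : Modes) (m : Freq) :
    (∑' k, size u k * (ewt (m - k) * size w (m - k))) ^ 2 ≤ 9 * (sob 2 u * sob 2 w) := by
  refine (tsum_mul_sq_le _ _).trans ?_
  rw [tsum_sub_left (fun k => (ewt k * size w k) ^ 2)]
  simp only [mul_pow]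
  have h1 := tsum_size_sq_le u 0
  simp only [pow_zero, one_mul] at h1
  calc _ ≤ (3 * sob 0 u) * (3 * sob 2 w) := mul_le_mul' h1 (tsum_size_sq_le w 2)
    _ ≤ (3 * sob 2 u) * (3 * sob 2 w) := by gcongr; exact sob_mono (by norm_num) u
    _ = _ := by ring

lemma tsum_stretch_bound_sq_le (u w : Modes) (m : Freq) :
    (∑' k, ewt k * size u k * size w (m - k)) ^ 2 ≤ 9 * (sob 2 u * sob 2 w) := by
  refine (tsum_mul_sq_le _ _).trans ?_
  rw [tsum_sub_left (fun k => (size w k) ^ 2)]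
  simp only [mul_pow]
  have h1 := tsum_size_sq_le w 0
  simp only [pow_zero, one_mul] at h1
  calc _ ≤ (3 * sob 2 u) * (3 * sob 0 w) := mul_le_mul' (tsum_size_sq_le u 2) h1
    _ ≤ (3 * sob 2 u) * (3 * sob 2 w) := by gcongr; exact sob_mono (by norm_num) w
    _ = _ := by ring

lemma ne_top_of_sq_le {a b : ℝ≥0∞} (h : a ^ 2 ≤ b) (hb : b ≠ ⊤) : a ≠ ⊤ := by
  rintro rfl
  simp at h
  exact hb h

section Finite

variable {u w w' : Modes}

lemma nine_mul_sob_ne_top (hu : sob 2 u ≠ ⊤) (hw : sob 2 w ≠ ⊤) :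
    9 * (sob 2 u * sob 2 w) ≠ ⊤ := by finiteness

theorem summable_transport (hu : sob 2 u ≠ ⊤) (hw : sob 2 w ≠ ⊤) (m : Freq) (i : Fin 3) :
    Summable fun k => ∑ j, u k j * (Complex.I * ((m - k) j : ℤ) * w (m - k) i) :=
  .of_enorm <| ne_top_of_le_ne_top
    (ne_top_of_sq_le (tsum_transport_bound_sq_le u w m) (nine_mul_sob_ne_top hu hw))
    (ENNReal.tsum_le_tsum fun k => enorm_transport_term_le u w m k i)

theorem summable_stretch (hu : sob 2 u ≠ ⊤) (hw : sob 2 w ≠ ⊤) (m : Freq) (i : Fin 3) :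
    Summable fun k => ∑ j, Complex.I * (k i : ℤ) * u k j * w (m - k) j :=
  .of_enorm <| ne_top_of_le_ne_top
    (ne_top_of_sq_le (tsum_stretch_bound_sq_le u w m) (nine_mul_sob_ne_top hu hw))
    (ENNReal.tsum_le_tsum fun k => enorm_stretch_term_le u w m k i)

theorem bil_sub (hu : sob 2 u ≠ ⊤) (hw : sob 2 w ≠ ⊤) (hw' : sob 2 w' ≠ ⊤) (m : Freq)
    (i : Fin 3) : bil u (w - w') m i = bil u w m i - bil u w' m i := by
  simp only [bil, transport, stretch]
  rw [add_sub_add_comm, ← (summable_transport hu hw m i).tsum_sub (summable_transport hu hw' m i),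
    ← (summable_stretch hu hw m i).tsum_sub (summable_stretch hu hw' m i)]
  congr 1
  · refine tsum_congr fun k => ?_
    rw [← Finset.sum_sub_distrib]
    refine Finset.sum_congr rfl fun j _ => ?_
    simp only [Pi.sub_apply]; ring
  · refine tsum_congr fun k => ?_
    rw [← Finset.sum_sub_distrib]
    refine Finset.sum_congr rfl fun j _ => ?_
    simp only [Pi.sub_apply]; ring

/-- On gradients the bilinear term is a gradient. -/
theorem bil_gradient (q : Freq → ℂ) (hu : sob 2 u ≠ ⊤)
    (hw : sob 2 (fun k j => (k j : ℂ) * q k) ≠ ⊤) (m : Freq) :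
    ∃ c : ℂ, ∀ i, bil u (fun k j => (k j : ℂ) * q k) m i = (m i : ℂ) * c := by
  -- The witness is the `m`-th coefficient of `u · ∇q`, up to normalization: the factor `(m - k)ᵢ`
  -- from the transport term and `kᵢ` from the stretching term add up to `mᵢ`.
  refine ⟨∑' k, ∑ j, u k j * (Complex.I * ((m - k) j : ℤ)) * q (m - k), fun i => ?_⟩
  simp only [bil, transport, stretch]
  rw [← (summable_transport hu hw m i).tsum_add (summable_stretch hu hw m i), ← tsum_mul_left]
  refine tsum_congr fun k => ?_
  rw [← Finset.sum_add_distrib, Finset.mul_sum]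
  refine Finset.sum_congr rfl fun j _ => ?_
  simp only [Pi.sub_apply, Int.cast_sub]; ring

/-- The field `(∇u)ᵀ u` is a gradient. -/
theorem stretch_self (hu : sob 2 u ≠ ⊤) (m : Freq) :
    ∃ c : ℂ, ∀ i, stretch u u m i = (m i : ℂ) * c := by
  -- The witness is `i` times the `m`-th coefficient of `|u|²/2`. Averaging the sum with its image
  -- under `k ↦ m - k` replaces `kᵢ` by `(kᵢ + (m - k)ᵢ)/2 = mᵢ/2`.
  refine ⟨∑' k, ∑ j, (1 / 2 : ℂ) * Complex.I * u k j * u (m - k) j, fun i => ?_⟩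
  have h1 := summable_stretch hu hu m i
  have h2 := (Equiv.subLeft m).summable_iff.mpr h1
  have h3 : stretch u u m i = ∑' k, ∑ j, Complex.I * ((m - k) i : ℤ) * u (m - k) j * u k j := by
    rw [stretch, ← (Equiv.subLeft m).tsum_eq]
    refine tsum_congr fun k => ?_
    simp
  have h4 : stretch u u m i = (1 / 2 : ℂ) * (stretch u u m i + stretch u u m i) := by ring
  rw [h4]
  nth_rewrite 2 [h3]
  rw [stretch, ← h1.tsum_add, ← tsum_mul_left, ← tsum_mul_left]
  · refine tsum_congr fun k => ?_
    rw [← Finset.sum_add_distrib, Finset.mul_sum, Finset.mul_sum]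
    refine Finset.sum_congr rfl fun j _ => ?_
    simp only [Pi.sub_apply, Int.cast_sub]; ring
  · refine h2.congr fun k => ?_
    simp

end Finite

lemma enorm_bil_le (u w : Modes) (m : Freq) (i : Fin 3) :
    ‖bil u w m i‖ₑ ≤ (∑' k, size u k * (ewt (m - k) * size w (m - k)))
      + ∑' k, ewt k * size u k * size w (m - k) := by
  refine (enorm_add_le _ _).trans (add_le_add ?_ ?_)
  · exact (enorm_tsum_le_tsum_enorm).trans
      (ENNReal.tsum_le_tsum fun k => enorm_transport_term_le u w m k i)
  · exact (enorm_tsum_le_tsum_enorm).trans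
      (ENNReal.tsum_le_tsum fun k => enorm_stretch_term_le u w m k i)

/-- A crude bound for each single mode, with no decay in `m`; it serves to make each mode integrable
in time and to dominate the series in the weak formulation. -/
theorem enorm_bil_sq_le (u w : Modes) (m : Freq) (i : Fin 3) :
    ‖bil u w m i‖ₑ ^ 2 ≤ 36 * (sob 2 u * sob 2 w) := by
  calc _ ≤ ((∑' k, size u k * (ewt (m - k) * size w (m - k)))
      + ∑' k, ewt k * size u k * size w (m - k)) ^ 2 := by gcongr; exact enorm_bil_le u w m i
    _ ≤ _ := add_sq_le_two_mul _ _
    _ ≤ 2 * (9 * (sob 2 u * sob 2 w)) + 2 * (9 * (sob 2 u * sob 2 w)) :=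
        add_le_add (mul_le_mul_right (tsum_transport_bound_sq_le u w m) _)
          (mul_le_mul_right (tsum_stretch_bound_sq_le u w m) _)
    _ = _ := by ring

/-- The bilinear term maps `H¹ × H¹` to `H^{-1/2}`. -/
theorem tsum_bil_sq_le (u w : Modes) :
    ∑' m, (ewt m)⁻¹ * ∑ i, ‖bil u w m i‖ₑ ^ 2 ≤ 10368 * (sob 2 u * sob 2 w) := by
  set X := fun m => ∑' k, size u k * (ewt (m - k) * size w (m - k))
  set Y := fun m => ∑' k, ewt k * size u k * size w (m - k)
  have hX : ∑' m, (ewt m)⁻¹ * X m ^ 2 ≤ 864 * (sob 2 u * sob 2 w) := by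
    refine (tsum_convolution_sq_le (size u) (fun k => ewt k * size w k)).trans ?_
    simp only [mul_pow]
    calc _ ≤ 96 * ((3 * sob 2 u) * (3 * sob 2 w)) :=
          mul_le_mul_right (mul_le_mul' (tsum_size_sq_le u 2) (tsum_size_sq_le w 2)) _
      _ = _ := by ring
  -- In the stretching term the derivative falls on `u`. The substitution `k ↦ m - k` exchanges the
  -- two factors, and the convolution estimate applies with `w` as the `H¹` factor.
  have hY : ∑' m, (ewt m)⁻¹ * Y m ^ 2 ≤ 864 * (sob 2 u * sob 2 w) := by
    have hsw : ∀ m, Y m = ∑' k, size w k * (ewt (m - k) * size u (m - k)) := by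
      intro m
      rw [← (Equiv.subLeft m).tsum_eq]
      refine tsum_congr fun k => ?_
      simp [mul_comm]
    simp only [hsw]
    refine (tsum_convolution_sq_le (size w) (fun k => ewt k * size u k)).trans ?_
    simp only [mul_pow]
    calc _ ≤ 96 * ((3 * sob 2 w) * (3 * sob 2 u)) :=
          mul_le_mul_right (mul_le_mul' (tsum_size_sq_le w 2) (tsum_size_sq_le u 2)) _
      _ = _ := by ring
  have hm : ∀ m, (ewt m)⁻¹ * ∑ i, ‖bil u w m i‖ₑ ^ 2
      ≤ 6 * ((ewt m)⁻¹ * X m ^ 2) + 6 * ((ewt m)⁻¹ * Y m ^ 2) := by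
    intro m
    calc _ ≤ (ewt m)⁻¹ * ∑ _i : Fin 3, (2 * X m ^ 2 + 2 * Y m ^ 2) := by
          refine mul_le_mul_right (Finset.sum_le_sum fun i _ => ?_) _
          exact (pow_le_pow_left' (enorm_bil_le u w m i) 2).trans (add_sq_le_two_mul _ _)
      _ = _ := by
          simp only [Finset.sum_const, Finset.card_univ, Fintype.card_fin, nsmul_eq_mul]
          push_cast; ring
  refine (ENNReal.tsum_le_tsum hm).trans ?_
  rw [ENNReal.tsum_add, ENNReal.tsum_mul_left, ENNReal.tsum_mul_left]
  calc _ ≤ 6 * (864 * (sob 2 u * sob 2 w)) + 6 * (864 * (sob 2 u * sob 2 w)) :=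
        add_le_add (mul_le_mul_right hX _) (mul_le_mul_right hY _)
    _ = _ := by ring

end Magnetization
end

noncomputable section
namespace Magnetization
open scoped ComplexConjugate ENNReal

/-! ### Absolutely continuous functions -/

/-- On `[0, τ]` the function `f` is the integral of the integrable function `f'`. -/
def IsPrim {E : Type*} [NormedAddCommGroup E] [NormedSpace ℝ E] (τ : ℝ) (f f' : ℝ → E) : Prop :=
  IntervalIntegrable f' volume 0 τ ∧ ∀ t ∈ Icc 0 τ, f t = f 0 + ∫ s in (0 : ℝ)..t, f' s

namespace IsPrim

variable {E : Type*} [NormedAddCommGroup E] {τ : ℝ}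

lemma intervalIntegrable_left {f : ℝ → E} {t : ℝ} (h : IntervalIntegrable f volume 0 τ)
    (ht : t ∈ Icc 0 τ) : IntervalIntegrable f volume 0 t :=
  h.mono_set (by
    rw [uIcc_of_le ht.1, uIcc_of_le (ht.1.trans ht.2)]
    exact Icc_subset_Icc_right ht.2)

variable [NormedSpace ℝ E]

lemma mono {f f' : ℝ → E} {t : ℝ} (h : IsPrim τ f f') (ht : t ∈ Icc 0 τ) : IsPrim t f f' :=
  ⟨intervalIntegrable_left h.1 ht, fun s hs => h.2 s ⟨hs.1, hs.2.trans ht.2⟩⟩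

lemma continuousOn {f f' : ℝ → E} (hτ : 0 ≤ τ) (h : IsPrim τ f f') : ContinuousOn f (Icc 0 τ) := by
  have h1 := intervalIntegral.continuousOn_primitive_interval' h.1 (a := 0) (by simp)
  rw [uIcc_of_le hτ] at h1
  exact (continuousOn_const.add h1).congr fun t ht => h.2 t ht

lemma congr {f f' g g' : ℝ → E} (hτ : 0 ≤ τ) (h : IsPrim τ f f') (hf : EqOn f g (Icc 0 τ))
    (hf' : ∀ᵐ t, t ∈ Ioc 0 τ → f' t = g' t) : IsPrim τ g g' := by
  refine ⟨h.1.congr_ae ?_, fun t ht => ?_⟩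
  · rw [uIoc_of_le hτ]
    exact (ae_restrict_iff' measurableSet_Ioc).mpr hf'
  · rw [← hf ht, ← hf ⟨le_rfl, hτ⟩, h.2 t ht]
    congr 1
    refine intervalIntegral.integral_congr_ae ?_
    filter_upwards [hf'] with s hs hs'
    rw [uIoc_of_le ht.1] at hs'
    exact hs ⟨hs'.1, hs'.2.trans ht.2⟩

lemma add {f f' g g' : ℝ → E} (h : IsPrim τ f f') (h2 : IsPrim τ g g') :
    IsPrim τ (fun t => f t + g t) (fun t => f' t + g' t) := by
  refine ⟨h.1.add h2.1, fun t ht => ?_⟩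
  beta_reduce
  rw [intervalIntegral.integral_add (intervalIntegrable_left h.1 ht)
    (intervalIntegrable_left h2.1 ht), h.2 t ht, h2.2 t ht]
  abel

lemma clm {F : Type*} [NormedAddCommGroup F] [NormedSpace ℝ F] [CompleteSpace E] [CompleteSpace F]
    {f f' : ℝ → E} (L : E →L[ℝ] F) (h : IsPrim τ f f') :
    IsPrim τ (fun t => L (f t)) (fun t => L (f' t)) := by
  refine ⟨?_, fun t ht => ?_⟩
  · exact ⟨L.integrable_comp h.1.1, L.integrable_comp h.1.2⟩
  · beta_reduce
    rw [L.intervalIntegral_comp_comm (intervalIntegrable_left h.1 ht), h.2 t ht, map_add]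

lemma sub [CompleteSpace E] {f f' g g' : ℝ → E} (h : IsPrim τ f f') (h2 : IsPrim τ g g') :
    IsPrim τ (fun t => f t - g t) (fun t => f' t - g' t) := by
  have := h.add (h2.clm (-ContinuousLinearMap.id ℝ E))
  simpa [sub_eq_add_neg] using this

lemma finsetSum {ι : Type*} (s : Finset ι) {f f' : ι → ℝ → E} (h : ∀ i ∈ s, IsPrim τ (f i) (f' i)) :
    IsPrim τ (fun t => ∑ i ∈ s, f i t) (fun t => ∑ i ∈ s, f' i t) := by
  classical
  induction s using Finset.induction_on with
  | empty => exact ⟨by simp, by simp⟩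
  | insert i s hi ih =>
    simp only [Finset.sum_insert hi]
    exact (h i (by simp)).add (ih fun j hj => h j (by simp [hj]))

/-- The fundamental theorem of calculus for absolutely continuous functions. -/
lemma of_absolutelyContinuous {f f' : ℝ → ℝ} (hτ : 0 ≤ τ)
    (hf : AbsolutelyContinuousOnInterval f 0 τ)
    (hd : ∀ᵐ x, x ∈ uIcc 0 τ → HasDerivAt f (f' x) x) : IsPrim τ f f' := by
  have hae : ∀ᵐ x, x ∈ uIcc 0 τ → deriv f x = f' x := by
    filter_upwards [hd] with x hx hx'
    exact (hx hx').deriv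
  refine ⟨hf.intervalIntegrable_deriv.congr_ae ?_, fun t ht => ?_⟩
  · refine (ae_restrict_iff' measurableSet_uIoc).mpr ?_
    filter_upwards [hae] with x hx hx'
    exact hx (uIoc_subset_uIcc hx')
  · have hsub : uIcc 0 t ⊆ uIcc 0 τ := by
      rw [uIcc_of_le ht.1, uIcc_of_le hτ]
      exact Icc_subset_Icc_right ht.2
    have h1 := (hf.mono hsub).integral_deriv_eq_sub
    have h2 : ∫ x in (0 : ℝ)..t, deriv f x = ∫ x in (0 : ℝ)..t, f' x := by
      refine intervalIntegral.integral_congr_ae ?_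
      filter_upwards [hae] with x hx hx'
      exact hx (hsub (uIoc_subset_uIcc hx'))
    rw [← h2, h1]; ring

/-- The relation constrains `f` only on `[0, τ]`, so it need not be differentiable at the endpoints
as a function on the line. Its integral formula makes sense everywhere, and the calculus of
absolutely continuous functions applies to that. -/
lemma exists_absolutelyContinuous {f f' : ℝ → ℝ} (h : IsPrim τ f f') :
    ∃ F : ℝ → ℝ, EqOn F f (Icc 0 τ) ∧ AbsolutelyContinuousOnInterval F 0 τ ∧
      ∀ᵐ x, x ∈ uIcc 0 τ → HasDerivAt F (f' x) x := by
  refine ⟨fun t => f 0 + ∫ s in (0 : ℝ)..t, f' s, fun t ht => (h.2 t ht).symm, ?_, ?_⟩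
  · have hc : AbsolutelyContinuousOnInterval (fun _ : ℝ => f 0) 0 τ :=
      (LipschitzWith.const (f 0)).lipschitzOnWith.absolutelyContinuousOnInterval
    exact hc.fun_add
      (h.1.absolutelyContinuousOnInterval_intervalIntegral (c := 0) (by simp))
  · filter_upwards [h.1.ae_hasDerivAt_integral] with x hx hx'
    exact (hx hx' 0 (by simp)).const_add _

lemma mul_real {f f' g g' : ℝ → ℝ} (hτ : 0 ≤ τ) (h : IsPrim τ f f') (h2 : IsPrim τ g g') :
    IsPrim τ (fun t => f t * g t) (fun t => f' t * g t + f t * g' t) := by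
  obtain ⟨F, hF, hFac, hFd⟩ := h.exists_absolutelyContinuous
  obtain ⟨G, hG, hGac, hGd⟩ := h2.exists_absolutelyContinuous
  have h3 : IsPrim τ (fun t => F t * G t) (fun t => f' t * G t + F t * g' t) := by
    refine of_absolutelyContinuous hτ (hFac.fun_mul hGac) ?_
    filter_upwards [hFd, hGd] with x hx1 hx2 hx
    exact (hx1 hx).fun_mul (hx2 hx)
  refine h3.congr hτ (fun t ht => ?_) (Filter.Eventually.of_forall fun t ht => ?_)
  · simp only [hF ht, hG ht]
  · have ht' : t ∈ Icc 0 τ := Ioc_subset_Icc_self ht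
    simp only [hF ht', hG ht']

lemma of_re_im {f f' : ℝ → ℂ} (hr : IsPrim τ (fun t => (f t).re) (fun t => (f' t).re))
    (hi : IsPrim τ (fun t => (f t).im) (fun t => (f' t).im)) : IsPrim τ f f' := by
  have h1 := hr.clm Complex.ofRealCLM
  have h2 := hi.clm ((ContinuousLinearMap.mul ℝ ℂ Complex.I).comp Complex.ofRealCLM)
  convert! h1.add h2 using 1 <;>
  · ext t
    simp [mul_comm Complex.I, Complex.re_add_im]

lemma mul {f f' g g' : ℝ → ℂ} (hτ : 0 ≤ τ) (h : IsPrim τ f f') (h2 : IsPrim τ g g') :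
    IsPrim τ (fun t => f t * g t) (fun t => f' t * g t + f t * g' t) := by
  have fr := h.clm Complex.reCLM
  have fi := h.clm Complex.imCLM
  have gr := h2.clm Complex.reCLM
  have gi := h2.clm Complex.imCLM
  simp only [Complex.reCLM_apply, Complex.imCLM_apply] at fr fi gr gi
  refine of_re_im ?_ ?_
  · refine ((fr.mul_real hτ gr).sub (fi.mul_real hτ gi)).congr hτ (fun t _ => ?_)
      (.of_forall fun t _ => ?_)
    · simp
    · simp; ring
  · refine ((fr.mul_real hτ gi).add (fi.mul_real hτ gr)).congr hτ (fun t _ => ?_)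
      (.of_forall fun t _ => ?_)
    · simp
    · simp; ring

lemma of_hasDerivAt [CompleteSpace E] {f f' : ℝ → E} (hd : ∀ t, HasDerivAt f (f' t) t)
    (hc : Continuous f') : IsPrim τ f f' := by
  refine ⟨hc.intervalIntegrable _ _, fun t _ => ?_⟩
  rw [intervalIntegral.integral_eq_sub_of_hasDerivAt (fun x _ => hd x) (hc.intervalIntegrable _ _)]
  abel

/-- The chain rule for `exp (-Λ)`, where `Λ` is the primitive of a nonnegative function. -/
lemma exp_neg {g : ℝ → ℝ} (hτ : 0 ≤ τ) (hg : IntervalIntegrable g volume 0 τ)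
    (h0 : ∀ t, 0 ≤ g t) :
    IsPrim τ (fun t => Real.exp (-∫ s in (0 : ℝ)..t, g s))
      (fun t => -(g t * Real.exp (-∫ s in (0 : ℝ)..t, g s))) := by
  have hac := hg.absolutelyContinuousOnInterval_intervalIntegral (c := 0) (by simp)
  refine of_absolutelyContinuous hτ ?_ ?_
  · unfold AbsolutelyContinuousOnInterval at hac ⊢
    refine squeeze_zero' (Filter.Eventually.of_forall fun E =>
      Finset.sum_nonneg fun _ _ => dist_nonneg) ?_ hac
    have hmem : ∀ᶠ E in (AbsolutelyContinuousOnInterval.totalLengthFilter (X := ℝ) ⊓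
        Filter.principal (AbsolutelyContinuousOnInterval.disjWithin 0 τ)),
        E ∈ AbsolutelyContinuousOnInterval.disjWithin 0 τ :=
      Filter.mem_inf_of_right (Filter.mem_principal_self _)
    filter_upwards [hmem] with E hE
    refine Finset.sum_le_sum fun i hi => ?_
    have hE' := hE.1 i hi
    rw [uIcc_of_le hτ] at hE'
    have hpos : ∀ t ∈ Icc 0 τ, 0 ≤ ∫ s in (0 : ℝ)..t, g s := fun t ht =>
      intervalIntegral.integral_nonneg ht.1 fun s _ => h0 s
    -- The primitive of `g` is nonnegative on `[0, τ]`, and `x ↦ exp(-x)` is 1-Lipschitz on `[0,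
    -- ∞)`; hence the composition inherits the modulus of absolute continuity of the primitive.
    have hl : LipschitzOnWith 1 (fun x : ℝ => Real.exp (-x)) (Ici 0) := by
      refine (convex_Ici 0).lipschitzOnWith_of_nnnorm_deriv_le (fun x _ => by fun_prop) ?_
      intro x hx
      have : deriv (fun x : ℝ => Real.exp (-x)) x = -Real.exp (-x) := by
        simpa using (hasDerivAt_neg x).exp.deriv
      rw [this, ← NNReal.coe_le_coe]
      simpa using hx
    simpa using hl.dist_le_mul _ (hpos _ hE'.1) _ (hpos _ hE'.2)
  · filter_upwards [hg.ae_hasDerivAt_integral] with x hx hx'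
    have h1 := (hx hx' 0 (by simp)).neg.exp
    convert! h1 using 1
    simp only [Pi.neg_apply]; ring

end IsPrim

/-! ### The energy inequality for one mode -/

/-- The exponential weight `exp (-λ ∫₀ᵗ g)`. -/
def decay (lam : ℝ) (g : ℝ → ℝ) (t : ℝ) : ℝ := Real.exp (-∫ s in (0 : ℝ)..t, lam * g s)

lemma decay_pos (lam : ℝ) (g : ℝ → ℝ) (t : ℝ) : 0 < decay lam g t := Real.exp_pos _

/-- Integrate the derivative of `D |y|²`, where `D = exp(-λ ∫ g)`, and multiply by the `H^{1/2}`
weight `r`. The derivative of `D` supplies `λ g r |y|²`, the viscosity supplies `r³ |y|²` up to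
lower order, and half of both remains on the left after the forcing has been absorbed. The
hypothesis `hrκ` is the form in which the viscosity enters, and `lam ≥ 4` with `g ≥ 1` pays for the
low frequencies. -/
theorem mode_energy_le {τ κ r lam : ℝ} (hτ : 0 ≤ τ) (hr : 1 ≤ r)
    (hrκ : r ^ 2 ≤ 2 * (1 + κ)) (hlam : 4 ≤ lam) {g : ℝ → ℝ} (hg1 : ∀ t, 1 ≤ g t)
    (hg : IntervalIntegrable g volume 0 τ) {y G : ℝ → ℂ}
    (hy : IsPrim τ y (fun s => -(G s + κ * y s))) :
    ENNReal.ofReal (decay lam g τ * r) * ‖y τ‖ₑ ^ 2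
      + 2⁻¹ * ∫⁻ s in Ioc 0 τ, ENNReal.ofReal (decay lam g s * (lam * g s * r + r ^ 3)) * ‖y s‖ₑ ^ 2
      ≤ ENNReal.ofReal r * ‖y 0‖ₑ ^ 2
        + 2 * ∫⁻ s in Ioc 0 τ, ENNReal.ofReal (decay lam g s * r⁻¹) * ‖G s‖ₑ ^ 2 := by
  have hr0 : 0 < r := by linarith
  have en : ∀ (c : ℝ) (z : ℂ), 0 ≤ c →
      ENNReal.ofReal c * ‖z‖ₑ ^ 2 = ENNReal.ofReal (c * ‖z‖ ^ 2) := by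
    intro c z hc
    rw [ENNReal.ofReal_mul hc, ENNReal.ofReal_pow (norm_nonneg _), ofReal_norm]
  have hlg : IntervalIntegrable (fun s => lam * g s) volume 0 τ := hg.const_mul lam
  have hD := IsPrim.exp_neg hτ hlg (fun t => by have := hg1 t; positivity)
  change IsPrim τ (decay lam g) (fun t => -(lam * g t * decay lam g t)) at hD
  have hyc := hy.continuousOn hτ
  have hDc := hD.continuousOn hτ
  set Q : ℝ → ℝ := fun s => decay lam g s * r⁻¹ * ‖G s‖ ^ 2 with hQ
  set P : ℝ → ℝ := fun s => decay lam g s * (lam * g s * r + r ^ 3) * ‖y s‖ ^ 2 with hP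
  have hQ0 : ∀ s, 0 ≤ Q s := fun s => by have := decay_pos lam g s; positivity
  have hP0 : ∀ s, 0 ≤ P s := fun s => by
    have := decay_pos lam g s; have := hg1 s; positivity
  have eQ : ∀ s, ENNReal.ofReal (decay lam g s * r⁻¹) * ‖G s‖ₑ ^ 2 = ENNReal.ofReal (Q s) :=
    fun s => en _ _ (by have := decay_pos lam g s; positivity)
  have eP : ∀ s, ENNReal.ofReal (decay lam g s * (lam * g s * r + r ^ 3)) * ‖y s‖ₑ ^ 2
      = ENNReal.ofReal (P s) :=
    fun s => en _ _ (by have := decay_pos lam g s; have := hg1 s; positivity)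
  simp only [eQ, eP]
  rw [en _ _ (by have := decay_pos lam g τ; positivity), en _ _ hr0.le]
  -- If the forcing integral is infinite there is nothing to prove; otherwise `Q` is integrable and
  -- the argument takes place in real numbers.
  by_cases htop : ∫⁻ s in Ioc 0 τ, ENNReal.ofReal (Q s) = ⊤
  · rw [htop]; simp
  -- measurability and integrability
  have hym : AEStronglyMeasurable y (volume.restrict (Ioc 0 τ)) :=
    (hyc.mono Ioc_subset_Icc_self).aestronglyMeasurable measurableSet_Ioc
  have hDm : AEStronglyMeasurable (decay lam g) (volume.restrict (Ioc 0 τ)) :=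
    (hDc.mono Ioc_subset_Icc_self).aestronglyMeasurable measurableSet_Ioc
  have hGm : AEStronglyMeasurable G (volume.restrict (Ioc 0 τ)) := by
    have h1 := hy.1.1.1.neg.sub (hym.const_mul (κ : ℂ))
    refine h1.congr (Filter.Eventually.of_forall fun s => ?_)
    simp
  have hQm : AEStronglyMeasurable Q (volume.restrict (Ioc 0 τ)) :=
    (hDm.mul_const _).mul (hGm.norm.pow 2)
  have hQi : IntervalIntegrable Q volume 0 τ := by
    rw [intervalIntegrable_iff_integrableOn_Ioc_of_le hτ]
    refine ⟨hQm, ?_⟩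
    rw [hasFiniteIntegral_iff_ofReal (Filter.Eventually.of_forall hQ0)]
    exact lt_top_iff_ne_top.mpr htop
  have hPi : IntervalIntegrable P volume 0 τ := by
    have h1 : IntervalIntegrable (fun s => lam * g s * r + r ^ 3) volume 0 τ :=
      (hlg.mul_const r).add (by simp)
    have h2 : ContinuousOn (fun s => decay lam g s * ‖y s‖ ^ 2) (uIcc 0 τ) := by
      rw [uIcc_of_le hτ]
      exact hDc.mul (hyc.norm.pow 2)
    refine (h1.mul_continuousOn h2).congr fun s _ => ?_
    simp only [hP]; ring
  -- the energy identity
  have hre := hy.clm Complex.reCLM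
  have him := hy.clm Complex.imCLM
  have hh := hD.mul_real hτ ((hre.mul_real hτ hre).add (him.mul_real hτ him))
  simp only [Complex.reCLM_apply, Complex.imCLM_apply] at hh
  have hid := hh.2 τ ⟨hτ, le_rfl⟩
  beta_reduce at hid
  have hD0 : decay lam g 0 = 1 := by simp [decay]
  rw [hD0, one_mul] at hid
  have hsq : ∀ z : ℂ, z.re * z.re + z.im * z.im = ‖z‖ ^ 2 := fun z => by
    rw [← Complex.normSq_apply, Complex.normSq_eq_norm_sq]
  rw [hsq, hsq] at hid
  have hmono := intervalIntegral.integral_mono_on hτ (((hh.1).const_mul r).add (hPi.const_mul 2⁻¹))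
    (hQi.const_mul 2) (fun s _ => by
      have hD := decay_pos lam g s
      have hg := hg1 s
      set a := (y s).re with ha
      set b := (y s).im with hb
      set c := (G s).re with hc
      set d := (G s).im with hd
      have e1 : ‖y s‖ ^ 2 = a * a + b * b := (hsq _).symm
      have e2 : ‖G s‖ ^ 2 = c * c + d * d := (hsq _).symm
      simp only [hP, hQ, e1, e2, Complex.neg_re, Complex.neg_im, Complex.add_re, Complex.add_im,
        Complex.mul_re, Complex.mul_im, Complex.ofReal_re, Complex.ofReal_im, ← ha, ← hb, ← hc,
        ← hd]
      -- Young's inequality `-2r Re(ȳG) ≤ r³|y|²/2 + 2r⁻¹|G|²` is the square `h1`. By `hrκ`, `-2rκ ≤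
      -- -r³ + 2r`, and the leftover `2r|y|²` is at most `λ g r |y|²/2` because `λ g ≥ 4`.
      have key : r * (-(lam * g s) * (a * a + b * b) + 2 * (a * -(c + κ * a) + b * -(d + κ * b)))
          + 2⁻¹ * ((lam * g s * r + r ^ 3) * (a * a + b * b)) ≤ 2 * (r⁻¹ * (c * c + d * d)) := by
        have h1 : 0 ≤ (r ^ 2 * a + 2 * c) ^ 2 + (r ^ 2 * b + 2 * d) ^ 2 := by positivity
        have h2 : 0 ≤ (lam * g s - 4) * (a * a + b * b) :=
          mul_nonneg (by nlinarith) (add_nonneg (mul_self_nonneg a) (mul_self_nonneg b))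
        have h3 : 0 ≤ (2 * (1 + κ) - r ^ 2) * (a * a + b * b) :=
          mul_nonneg (by linarith) (add_nonneg (mul_self_nonneg a) (mul_self_nonneg b))
        have h4 : 2 * (r⁻¹ * (c * c + d * d)) = (2 * (c * c + d * d)) / r := by
          field_simp
        rw [h4, le_div_iff₀ hr0]
        have h5 : 0 ≤ r ^ 2 * ((lam * g s - 4) * (a * a + b * b)) :=
          mul_nonneg (by positivity) h2
        have h6 : 0 ≤ r ^ 2 * ((2 * (1 + κ) - r ^ 2) * (a * a + b * b)) :=
          mul_nonneg (by positivity) h3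
        nlinarith
      have := mul_le_mul_of_nonneg_left key hD.le
      nlinarith)
  rw [intervalIntegral.integral_add (hh.1.const_mul r) (hPi.const_mul 2⁻¹),
    intervalIntegral.integral_const_mul, intervalIntegral.integral_const_mul,
    intervalIntegral.integral_const_mul] at hmono
  have hfin : decay lam g τ * r * ‖y τ‖ ^ 2 + 2⁻¹ * ∫ s in (0 : ℝ)..τ, P s
      ≤ r * ‖y 0‖ ^ 2 + 2 * ∫ s in (0 : ℝ)..τ, Q s := by
    have e : decay lam g τ * r * ‖y τ‖ ^ 2 = r * (decay lam g τ * ‖y τ‖ ^ 2) := by ring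
    rw [e, hid]
    linarith
  have lP : ∫⁻ s in Ioc 0 τ, ENNReal.ofReal (P s) = ENNReal.ofReal (∫ s in (0 : ℝ)..τ, P s) := by
    rw [intervalIntegral.integral_of_le hτ, ofReal_integral_eq_lintegral_ofReal
      ((intervalIntegrable_iff_integrableOn_Ioc_of_le hτ).mp hPi)
      (Filter.Eventually.of_forall hP0)]
  have lQ : ∫⁻ s in Ioc 0 τ, ENNReal.ofReal (Q s) = ENNReal.ofReal (∫ s in (0 : ℝ)..τ, Q s) := by
    rw [intervalIntegral.integral_of_le hτ, ofReal_integral_eq_lintegral_ofReal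
      ((intervalIntegrable_iff_integrableOn_Ioc_of_le hτ).mp hQi)
      (Filter.Eventually.of_forall hQ0)]
  have iP : 0 ≤ ∫ s in (0 : ℝ)..τ, P s := intervalIntegral.integral_nonneg hτ fun s _ => hP0 s
  have iQ : 0 ≤ ∫ s in (0 : ℝ)..τ, Q s := intervalIntegral.integral_nonneg hτ fun s _ => hQ0 s
  have hDτ := decay_pos lam g τ
  rw [lP, lQ, show (2 : ℝ≥0∞)⁻¹ = ENNReal.ofReal 2⁻¹ by
      rw [ENNReal.ofReal_inv_of_pos two_pos]; simp,
    show (2 : ℝ≥0∞) = ENNReal.ofReal 2 by simp,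
    ← ENNReal.ofReal_mul (by norm_num), ← ENNReal.ofReal_mul (by norm_num),
    ← ENNReal.ofReal_add (by positivity) (by positivity),
    ← ENNReal.ofReal_add (by positivity) (by positivity)]
  exact ENNReal.ofReal_le_ofReal hfin

end Magnetization
end

noncomputable section
namespace Magnetization
open scoped ComplexConjugate ENNReal

/-! ### Energy estimates for sequences of Fourier coefficients -/

/-- The symbol `|k|²` of `-Δ`. -/
def freqSq (k : Freq) : ℝ := ∑ i, (k i : ℝ) ^ 2

lemma freqSq_nonneg (k : Freq) : 0 ≤ freqSq k := Finset.sum_nonneg fun _ _ => sq_nonneg _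

/-- The viscosity controls the squared weight only up to a constant: at `k = 0` the symbol vanishes
while the weight is one. This is the source of the term that `g ≥ 1` has to absorb. -/
lemma wt_sq_le (k : Freq) : wt k ^ 2 ≤ 2 * (1 + freqSq k) := by
  have h : Real.sqrt (freqSq k) ^ 2 = freqSq k := Real.sq_sqrt (freqSq_nonneg k)
  have h1 : wt k = 1 + Real.sqrt (freqSq k) := rfl
  rw [h1]
  nlinarith [sq_nonneg (1 - Real.sqrt (freqSq k))]

/-- The modes `y` solve `∂ₜ yₖ + |k|² yₖ + Gₖ = 0` on `[0, τ]`. -/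
def IsModeSol (τ : ℝ) (G y : ℝ → Modes) : Prop :=
  ∀ k j, IsPrim τ (fun t => y t k j) (fun s => -(G s k j + freqSq k * y s k j))

/-- The growth rate in the exponential weight. -/
def rate : ℝ := (8 * 93312) ^ 2

/-- The weight of the `k`-th mode in the space-time norm. -/
def dens (g : ℝ → ℝ) (s : ℝ) (k : Freq) : ℝ≥0∞ :=
  ENNReal.ofReal (decay rate g s * (rate * g s * wt k + wt k ^ 3))

/-- The square of the weighted space-time norm. -/
def wnorm (g : ℝ → ℝ) (τ : ℝ) (y : ℝ → Modes) : ℝ≥0∞ :=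
  ∫⁻ s in Ioc 0 τ, ∑' k, dens g s k * ∑ j, ‖y s k j‖ₑ ^ 2

/-- The coefficient `u` is dominated by the integrable function `g ≥ 1`:
`‖u‖⁴_{H¹} ≤ g` almost everywhere. -/
structure Dominates (T : ℝ) (g : ℝ → ℝ) (u : ℝ → Modes) : Prop where
  one_le : ∀ t, 1 ≤ g t
  measurable : Measurable g
  intervalIntegrable : ∀ a b, IntervalIntegrable g volume a b
  sob_sq_le : ∀ᵐ s ∂(volume.restrict (Ioc 0 T)), sob 2 (u s) ^ 2 ≤ ENNReal.ofReal (g s)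

lemma continuous_decay {lam : ℝ} {g : ℝ → ℝ} (hg : ∀ a b, IntervalIntegrable g volume a b) :
    Continuous (decay lam g) := by
  unfold decay
  have := intervalIntegral.continuous_primitive (fun a b => (hg a b).const_mul lam) 0
  fun_prop

lemma decay_le_one {lam : ℝ} {g : ℝ → ℝ} (hl : 0 ≤ lam) (hg : ∀ t, 0 ≤ g t) {t : ℝ} (ht : 0 ≤ t) :
    decay lam g t ≤ 1 := by
  unfold decay
  rw [Real.exp_le_one_iff, neg_nonpos]
  exact intervalIntegral.integral_nonneg ht fun s _ => mul_nonneg hl (hg s)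

lemma decay_anti {lam : ℝ} {g : ℝ → ℝ} (hl : 0 ≤ lam) (hg : ∀ t, 0 ≤ g t)
    (hi : ∀ a b, IntervalIntegrable g volume a b) {s t : ℝ} (hst : s ≤ t) :
    decay lam g t ≤ decay lam g s := by
  unfold decay
  apply Real.exp_le_exp.mpr
  rw [neg_le_neg_iff, ← intervalIntegral.integral_add_adjacent_intervals
    ((hi 0 s).const_mul lam) ((hi s t).const_mul lam)]
  have : 0 ≤ ∫ x in s..t, lam * g x :=
    intervalIntegral.integral_nonneg hst fun x _ => mul_nonneg hl (hg x)
  linarith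

/-- Sum `mode_energy_le` with `r = wt k` over all modes and exchange sum and integral, which is free
for nonnegative terms. The forcing is measured in `H^{-1/2}`. -/
theorem energy_le {τ : ℝ} (hτ : 0 ≤ τ) {g : ℝ → ℝ} (hg1 : ∀ t, 1 ≤ g t)
    (hg : ∀ a b, IntervalIntegrable g volume a b) {G y : ℝ → Modes} (hy : IsModeSol τ G y) :
    ENNReal.ofReal (decay rate g τ) * sob 1 (y τ) + 2⁻¹ * wnorm g τ y
      ≤ sob 1 (y 0) + 2 * ∫⁻ s in Ioc 0 τ, ENNReal.ofReal (decay rate g s) *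
        ∑' k, (ewt k)⁻¹ * ∑ j, ‖G s k j‖ₑ ^ 2 := by
  have hym : ∀ k j, AEMeasurable (fun s => y s k j) (volume.restrict (Ioc 0 τ)) := fun k j =>
    (((hy k j).continuousOn hτ).mono Ioc_subset_Icc_self).aemeasurable measurableSet_Ioc
  have hGm : ∀ k j, AEMeasurable (fun s => G s k j) (volume.restrict (Ioc 0 τ)) := by
    intro k j
    have h1 := ((hy k j).1.1.1.aemeasurable.neg).sub ((hym k j).const_mul (freqSq k : ℂ))
    refine h1.congr (Filter.Eventually.of_forall fun s => ?_)
    simp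
  have hdm : AEMeasurable (decay rate g) (volume.restrict (Ioc 0 τ)) :=
    (continuous_decay hg).measurable.aemeasurable
  have hgm : AEMeasurable g (volume.restrict (Ioc 0 τ)) := (hg 0 τ).1.1.aemeasurable
  have hdens : ∀ k, AEMeasurable (fun s => dens g s k) (volume.restrict (Ioc 0 τ)) := by
    intro k
    unfold dens
    fun_prop
  have hsum := ENNReal.tsum_le_tsum (fun k => Finset.sum_le_sum (s := Finset.univ)
    fun j _ => mode_energy_le hτ (one_le_wt k) (wt_sq_le k) (lam := rate)
      (by norm_num [rate]) hg1 (hg 0 τ) (hy k j))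
  have eL : ∑' k, ∑ j, (ENNReal.ofReal (decay rate g τ * wt k) * ‖y τ k j‖ₑ ^ 2
      + 2⁻¹ * ∫⁻ s in Ioc 0 τ, ENNReal.ofReal (decay rate g s * (rate * g s * wt k + wt k ^ 3))
        * ‖y s k j‖ₑ ^ 2)
      = ENNReal.ofReal (decay rate g τ) * sob 1 (y τ) + 2⁻¹ * wnorm g τ y := by
    simp only [Finset.sum_add_distrib, ← Finset.mul_sum]
    rw [ENNReal.tsum_add, ENNReal.tsum_mul_left]
    congr 1
    · rw [sob, ← ENNReal.tsum_mul_left]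
      refine tsum_congr fun k => ?_
      rw [ENNReal.ofReal_mul (decay_pos _ _ _).le, pow_one, ewt, mul_assoc]
    · rw [wnorm, lintegral_tsum]
      · congr 1
        refine tsum_congr fun k => ?_
        rw [← lintegral_finsetSum']
        · simp only [← Finset.mul_sum, dens]
        · exact fun j _ => (hdens k).mul ((hym k j).enorm.pow_const 2)
      · exact fun k => (hdens k).mul
          (Finset.aemeasurable_fun_sum _ fun j _ => (hym k j).enorm.pow_const 2)
  have eR : ∑' k, ∑ j, (ENNReal.ofReal (wt k) * ‖y 0 k j‖ₑ ^ 2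
      + 2 * ∫⁻ s in Ioc 0 τ, ENNReal.ofReal (decay rate g s * (wt k)⁻¹) * ‖G s k j‖ₑ ^ 2)
      = sob 1 (y 0) + 2 * ∫⁻ s in Ioc 0 τ, ENNReal.ofReal (decay rate g s) *
        ∑' k, (ewt k)⁻¹ * ∑ j, ‖G s k j‖ₑ ^ 2 := by
    simp only [Finset.sum_add_distrib, ← Finset.mul_sum]
    rw [ENNReal.tsum_add, ENNReal.tsum_mul_left]
    congr 1
    · simp only [sob, pow_one, ewt]
    · simp only [← ENNReal.tsum_mul_left]
      rw [ENNReal.tsum_mul_left, lintegral_tsum]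
      · congr 1
        refine tsum_congr fun k => ?_
        rw [← lintegral_finsetSum']
        · refine lintegral_congr fun s => ?_
          rw [← Finset.mul_sum, ENNReal.ofReal_mul (decay_pos _ _ _).le,
            ENNReal.ofReal_inv_of_pos (wt_pos k), ← ewt, mul_assoc]
        · intro j _
          exact ((hdm.mul_const _).ennreal_ofReal).mul ((hGm k j).enorm.pow_const 2)
      · intro k
        refine hdm.ennreal_ofReal.mul (AEMeasurable.const_mul ?_ _)
        exact Finset.aemeasurable_fun_sum _ fun j _ => (hGm k j).enorm.pow_const 2
  calc _ = _ := eL.symm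
    _ ≤ _ := hsum
    _ = _ := eR

/-- The quadratic term is absorbed by the weighted norm. -/
theorem decay_mul_sob_mul_sob_le {g : ℝ → ℝ} (hg1 : ∀ t, 1 ≤ g t) {s : ℝ} {u v : Modes}
    (hu : sob 2 u ^ 2 ≤ ENNReal.ofReal (g s)) :
    ENNReal.ofReal (decay rate g s) * (sob 2 u * sob 2 v)
      ≤ ENNReal.ofReal (16 * 93312)⁻¹ * ∑' k, dens g s k * ∑ j, ‖v k j‖ₑ ^ 2 := by
  have hg0 : 0 ≤ g s := zero_le_one.trans (hg1 s)
  have h1 : sob 2 u ≤ ENNReal.ofReal (Real.sqrt (g s)) := by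
    rw [← ENNReal.pow_le_pow_left_iff two_ne_zero, ← ENNReal.ofReal_pow (Real.sqrt_nonneg _),
      Real.sq_sqrt hg0]
    exact hu
  calc _ ≤ ENNReal.ofReal (decay rate g s) * (ENNReal.ofReal (Real.sqrt (g s)) * sob 2 v) := by
        gcongr
    _ ≤ _ := by
      rw [sob, ← ENNReal.tsum_mul_left, ← ENNReal.tsum_mul_left, ← ENNReal.tsum_mul_left]
      refine ENNReal.tsum_le_tsum fun k => ?_
      rw [← mul_assoc, ← mul_assoc, ← mul_assoc]
      refine mul_le_mul_left ?_ _
      rw [dens, ewt, ← ENNReal.ofReal_pow (wt_pos k).le, ← ENNReal.ofReal_mul (decay_pos _ _ _).le,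
        ← ENNReal.ofReal_mul (mul_nonneg (decay_pos _ _ _).le (Real.sqrt_nonneg _)),
        ← ENNReal.ofReal_mul (by positivity)]
      apply ENNReal.ofReal_le_ofReal
      have hd := decay_pos rate g s
      have hw := wt_pos k
      -- This inequality determines `rate`. With `C = 93312` and `q = √g` it is the expansion of `wt
      -- · (8Cq - wt)² ≥ 0`, divided by `16C`.
      have key : Real.sqrt (g s) * wt k ^ 2
          ≤ (16 * 93312)⁻¹ * (rate * g s * wt k + wt k ^ 3) := by
        have hq := Real.sq_sqrt hg0
        set q := Real.sqrt (g s)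
        rw [← hq, rate]
        have := mul_nonneg hw.le (sq_nonneg (8 * 93312 * q - wt k))
        nlinarith
      have := mul_le_mul_of_nonneg_left key hd.le
      linarith

/-- The basic estimate behind existence and uniqueness. -/
theorem energy_le_of_bound {T τ : ℝ} (hτ : 0 ≤ τ) (hτT : τ ≤ T) {g : ℝ → ℝ} {u : ℝ → Modes}
    (hg : Dominates T g u) {G y v : ℝ → Modes} (hy : IsModeSol τ G y)
    (hG : ∀ᵐ s ∂(volume.restrict (Ioc 0 τ)), ∑' k, (ewt k)⁻¹ * ∑ j, ‖G s k j‖ₑ ^ 2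
      ≤ 93312 * (sob 2 (u s) * sob 2 (v s))) :
    ENNReal.ofReal (decay rate g τ) * sob 1 (y τ) + 2⁻¹ * wnorm g τ y
      ≤ sob 1 (y 0) + 8⁻¹ * wnorm g τ v := by
  refine (energy_le hτ hg.one_le hg.intervalIntegrable hy).trans (add_le_add le_rfl ?_)
  have hsub : ∀ᵐ s ∂(volume.restrict (Ioc 0 τ)), sob 2 (u s) ^ 2 ≤ ENNReal.ofReal (g s) :=
    ae_restrict_of_ae_restrict_of_subset (Ioc_subset_Ioc_right hτT) hg.sob_sq_le
  -- The bound `93312` on the forcing cancels against `(16 · 93312)⁻¹` in the absorption estimate.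
  -- With the factor 2 from `energy_le` this leaves `1/8`, to be compared with `1/2` on the left.
  have h1 : ∫⁻ s in Ioc 0 τ, ENNReal.ofReal (decay rate g s) *
      ∑' k, (ewt k)⁻¹ * ∑ j, ‖G s k j‖ₑ ^ 2 ≤ ENNReal.ofReal (16⁻¹) * wnorm g τ v := by
    rw [wnorm, ← lintegral_const_mul' _ _ (by finiteness)]
    refine lintegral_mono_ae ?_
    filter_upwards [hG, hsub] with s h1 h2
    calc _ ≤ ENNReal.ofReal (decay rate g s) * (93312 * (sob 2 (u s) * sob 2 (v s))) := by gcongr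
      _ = 93312 * (ENNReal.ofReal (decay rate g s) * (sob 2 (u s) * sob 2 (v s))) := by ring
      _ ≤ 93312 * (ENNReal.ofReal (16 * 93312)⁻¹ * ∑' k, dens g s k * ∑ j, ‖v s k j‖ₑ ^ 2) :=
          mul_le_mul_right (decay_mul_sob_mul_sob_le hg.one_le h2) _
      _ = _ := by
          rw [← mul_assoc, show (93312 : ℝ≥0∞) = ENNReal.ofReal 93312 by simp,
            ← ENNReal.ofReal_mul (by norm_num)]
          norm_num
  calc _ ≤ 2 * (ENNReal.ofReal (16⁻¹) * wnorm g τ v) := by gcongr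
    _ = _ := by
      rw [← mul_assoc, show (2 : ℝ≥0∞) = ENNReal.ofReal 2 by simp,
        ← ENNReal.ofReal_mul (by norm_num), show (8 : ℝ≥0∞) = ENNReal.ofReal 8 by simp,
        ← ENNReal.ofReal_inv_of_pos (by norm_num)]
      norm_num

/-- Uniqueness: a solution with zero initial value and a forcing of the size of the bilinear
term vanishes. -/
theorem modes_eq_zero {T τ : ℝ} (hτ : 0 ≤ τ) (hτT : τ ≤ T) {g : ℝ → ℝ} {u : ℝ → Modes}
    (hg : Dominates T g u) {G y : ℝ → Modes} (hy : IsModeSol τ G y)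
    (hG : ∀ᵐ s ∂(volume.restrict (Ioc 0 τ)), ∑' k, (ewt k)⁻¹ * ∑ j, ‖G s k j‖ₑ ^ 2
      ≤ 93312 * (sob 2 (u s) * sob 2 (y s)))
    (h0 : ∀ k j, y 0 k j = 0) (hfin : wnorm g τ y ≠ ⊤) (k : Freq) (j : Fin 3) : y τ k j = 0 := by
  have h := energy_le_of_bound hτ hτT hg hy hG
  have hs0 : sob 1 (y 0) = 0 := by simp [sob, h0]
  rw [hs0, zero_add] at h
  -- Here `v = y`, so half of the norm is at most an eighth of it; finiteness forces it to be zero.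
  -- The remaining energy term then kills every mode at time `τ`.
  have hw : wnorm g τ y = 0 := by
    by_contra hne
    have h1 : 2⁻¹ * wnorm g τ y ≤ 8⁻¹ * wnorm g τ y := le_trans le_add_self h
    have h2 := (ENNReal.mul_le_mul_iff_left hne hfin).mp h1
    rw [ENNReal.inv_le_inv] at h2
    norm_num at h2
  rw [hw, mul_zero, mul_zero, add_zero, nonpos_iff_eq_zero, mul_eq_zero] at h
  rcases h with h | h
  · rw [ENNReal.ofReal_eq_zero] at h
    exact absurd (decay_pos rate g τ) (not_lt.mpr h)
  · rw [sob, ENNReal.tsum_eq_zero] at h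
    have h1 := h k
    rw [mul_eq_zero] at h1
    rcases h1 with h1 | h1
    · exact absurd h1 (pow_ne_zero _ (ewt_ne_zero k))
    · rw [Finset.sum_eq_zero_iff] at h1
      simpa using h1 j (Finset.mem_univ j)

/-- The weighted norm is finite for fields in `L^∞ H^{1/2} ∩ L² H^{3/2}`. -/
theorem wnorm_ne_top {T τ : ℝ} {g : ℝ → ℝ} {u : ℝ → Modes} (hτ : 0 ≤ τ)
    (hg : Dominates T g u) {y : ℝ → Modes}
    {M : ℝ≥0∞} (hM : M ≠ ⊤) (h1 : ∀ᵐ s ∂(volume.restrict (Ioc 0 τ)), sob 1 (y s) ≤ M)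
    (h3 : ∫⁻ s in Ioc 0 τ, sob 3 (y s) ≠ ⊤) : wnorm g τ y ≠ ⊤ := by
  have hr : 0 ≤ rate := by unfold rate; positivity
  have hle : wnorm g τ y ≤ ∫⁻ s in Ioc 0 τ, (ENNReal.ofReal (rate * g s) * M + sob 3 (y s)) := by
    refine lintegral_mono_ae ?_
    filter_upwards [h1, ae_restrict_mem measurableSet_Ioc] with s hs hs'
    have hg0 : 0 ≤ g s := zero_le_one.trans (hg.one_le s)
    calc _ ≤ ∑' k, (ENNReal.ofReal (rate * g s) * (ewt k ^ 1 * ∑ j, ‖y s k j‖ₑ ^ 2)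
          + ewt k ^ 3 * ∑ j, ‖y s k j‖ₑ ^ 2) := by
          refine ENNReal.tsum_le_tsum fun k => ?_
          rw [← mul_assoc, ← add_mul]
          gcongr
          have hw := wt_pos k
          rw [dens, ewt, ← ENNReal.ofReal_pow hw.le, ← ENNReal.ofReal_pow hw.le,
            ← ENNReal.ofReal_mul (by positivity), ← ENNReal.ofReal_add (by positivity)
            (by positivity), pow_one]
          apply ENNReal.ofReal_le_ofReal
          have := decay_le_one hr (fun t => zero_le_one.trans (hg.one_le t)) hs'.1.le
          exact mul_le_of_le_one_left (by positivity) this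
      _ = ENNReal.ofReal (rate * g s) * sob 1 (y s) + sob 3 (y s) := by
          rw [ENNReal.tsum_add, ENNReal.tsum_mul_left]; rfl
      _ ≤ _ := by gcongr
  refine ne_top_of_le_ne_top ?_ hle
  have hgi : IntegrableOn (fun s => rate * g s) (Ioc 0 τ) volume :=
    (intervalIntegrable_iff_integrableOn_Ioc_of_le hτ).mp
      ((hg.intervalIntegrable 0 τ).const_mul rate)
  rw [lintegral_add_left (((hg.measurable.const_mul _).ennreal_ofReal).mul_const _)]
  refine ENNReal.add_ne_top.mpr ⟨?_, h3⟩
  rw [lintegral_mul_const' _ _ hM]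
  exact ENNReal.mul_ne_top hgi.lintegral_lt_top.ne hM

end Magnetization
end

noncomputable section
namespace Magnetization
open scoped ComplexConjugate ENNReal

/-! ### Existence for the system of Fourier coefficients -/

/-- Duhamel's formula for `y' + κ y + G = 0`, `y(0) = y₀`. -/
def duhamel (κ : ℝ) (y₀ : ℂ) (G : ℝ → ℂ) (t : ℝ) : ℂ :=
  (Real.exp (-κ * t) : ℂ) * (y₀ - ∫ s in (0 : ℝ)..t, (Real.exp (κ * s) : ℂ) * G s)

lemma duhamel_zero (κ : ℝ) (y₀ : ℂ) (G : ℝ → ℂ) : duhamel κ y₀ G 0 = y₀ := by simp [duhamel]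

lemma intervalIntegrable_exp_mul {κ a b : ℝ} {G : ℝ → ℂ} (hG : IntervalIntegrable G volume a b) :
    IntervalIntegrable (fun s => (Real.exp (κ * s) : ℂ) * G s) volume a b :=
  hG.continuousOn_mul (by fun_prop)

lemma isPrim_duhamel {κ τ : ℝ} (hτ : 0 ≤ τ) (y₀ : ℂ) {G : ℝ → ℂ}
    (hG : IntervalIntegrable G volume 0 τ) :
    IsPrim τ (duhamel κ y₀ G) (fun s => -(G s + κ * duhamel κ y₀ G s)) := by
  have h1 : IsPrim τ (fun t : ℝ => (Real.exp (-κ * t) : ℂ))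
      (fun t => ((Real.exp (-κ * t) * (-κ) : ℝ) : ℂ)) := by
    refine IsPrim.of_hasDerivAt (fun t => ?_) (by fun_prop)
    have h : HasDerivAt (fun t : ℝ => Real.exp (-κ * t)) (Real.exp (-κ * t) * (-κ)) t := by
      simpa using ((hasDerivAt_id t).const_mul (-κ)).exp
    exact h.ofReal_comp
  have h2 : IsPrim τ (fun t => y₀ - ∫ s in (0 : ℝ)..t, (Real.exp (κ * s) : ℂ) * G s)
      (fun s => -((Real.exp (κ * s) : ℂ) * G s)) := by
    refine ⟨(intervalIntegrable_exp_mul hG).neg, fun t _ => ?_⟩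
    beta_reduce
    rw [intervalIntegral.integral_neg]
    simp [sub_eq_add_neg]
  refine (h1.mul hτ h2).congr hτ (fun t _ => rfl) (.of_forall fun t _ => ?_)
  have he : (Real.exp (-κ * t) : ℂ) * (Real.exp (κ * t) : ℂ) = 1 := by
    rw [← Complex.ofReal_mul, ← Real.exp_add]; simp
  simp only [duhamel]
  rw [Complex.ofReal_mul, Complex.ofReal_neg]
  linear_combination (-G t) * he

lemma continuous_duhamel (κ : ℝ) (y₀ : ℂ) {G : ℝ → ℂ}
    (hG : ∀ a b, IntervalIntegrable G volume a b) : Continuous (duhamel κ y₀ G) := by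
  have h := intervalIntegral.continuous_primitive
    (fun a b => intervalIntegrable_exp_mul (κ := κ) (hG a b)) 0
  unfold duhamel
  fun_prop

lemma measurable_bil {u v : ℝ → Modes} (hu : ∀ k j, Measurable fun t => u t k j)
    (hv : ∀ k j, Measurable fun t => v t k j) (k : Freq) (i : Fin 3) :
    Measurable fun t => bil (u t) (v t) k i := by
  unfold bil transport stretch
  refine Measurable.add (Measurable.tsum fun l => ?_) (Measurable.tsum fun l => ?_)
  · exact Finset.measurable_fun_sum _ fun j _ => (hu l j).mul ((hv _ _).const_mul _)
  · exact Finset.measurable_fun_sum _ fun j _ => ((hu l j).const_mul _).mul (hv _ _)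

lemma measurable_dens {g : ℝ → ℝ} (hg : Measurable g)
    (hgi : ∀ a b, IntervalIntegrable g volume a b) (k : Freq) : Measurable fun s => dens g s k := by
  have := (continuous_decay (lam := rate) hgi).measurable
  unfold dens
  fun_prop

lemma ofReal_decay_ne_zero (lam : ℝ) (g : ℝ → ℝ) (t : ℝ) :
    ENNReal.ofReal (decay lam g t) ≠ 0 := by
  simp [decay_pos]

lemma rate_nonneg : 0 ≤ rate := by unfold rate; positivity

section

variable {T τ : ℝ} {g : ℝ → ℝ} {u v : ℝ → Modes}

/-- The weighted norm controls the unweighted integral because the exponential weight is decreasing,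
hence at least its positive value at `τ`. -/
lemma lintegral_sob_mul_sob_ne_top (hg : Dominates T g u) (hτT : τ ≤ T) (hv : wnorm g τ v ≠ ⊤) :
    ∫⁻ s in Ioc 0 τ, sob 2 (u s) * sob 2 (v s) ≠ ⊤ := by
  have h1 : ENNReal.ofReal (decay rate g τ) * ∫⁻ s in Ioc 0 τ, sob 2 (u s) * sob 2 (v s)
      ≤ ENNReal.ofReal (16 * 93312)⁻¹ * wnorm g τ v := by
    rw [wnorm, ← lintegral_const_mul' _ _ (by finiteness), ← lintegral_const_mul' _ _ (by finiteness)]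
    refine lintegral_mono_ae ?_
    filter_upwards [ae_restrict_of_ae_restrict_of_subset (Ioc_subset_Ioc_right hτT) hg.sob_sq_le,
      ae_restrict_mem measurableSet_Ioc] with s h2 hs
    refine le_trans ?_ (decay_mul_sob_mul_sob_le hg.one_le h2)
    gcongr
    exact decay_anti rate_nonneg (fun t => zero_le_one.trans (hg.one_le t)) hg.intervalIntegrable hs.2
  intro htop
  rw [htop, ENNReal.mul_top (ofReal_decay_ne_zero _ _ _)] at h1
  exact (ENNReal.mul_ne_top (by finiteness) hv) (top_le_iff.mp h1)

/-- The function is square integrable on an interval of finite length. -/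
lemma integrableOn_of_sq_le {G : ℝ → ℂ} {B : ℝ → ℝ≥0∞}
    (hG : AEStronglyMeasurable G (volume.restrict (Ioc 0 τ)))
    (hle : ∀ s, ‖G s‖ₑ ^ 2 ≤ 36 * B s) (hB : ∫⁻ s in Ioc 0 τ, B s ≠ ⊤) :
    IntegrableOn G (Ioc 0 τ) volume := by
  have h2 : ∫⁻ s in Ioc 0 τ, ‖G s‖ₑ ^ 2 < ⊤ := by
    refine lt_of_le_of_lt (lintegral_mono hle) ?_
    rw [lintegral_const_mul' _ _ (by finiteness)]
    exact ENNReal.mul_lt_top (by finiteness) hB.lt_top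
  have h3 : MemLp G 2 (volume.restrict (Ioc 0 τ)) := by
    refine ⟨hG, ?_⟩
    rw [eLpNorm_lt_top_iff_lintegral_rpow_enorm_lt_top (by simp) (by simp)]
    simpa using h2
  exact h3.integrable (by norm_num)

lemma integrableOn_bil (hg : Dominates T g u) (hτT : τ ≤ T) (hv : wnorm g τ v ≠ ⊤)
    (hum : ∀ k j, Measurable fun t => u t k j) (hvm : ∀ k j, Measurable fun t => v t k j)
    (k : Freq) (j : Fin 3) : IntegrableOn (fun s => bil (u s) (v s) k j) (Ioc 0 τ) volume :=
  integrableOn_of_sq_le (measurable_bil hum hvm k j).aestronglyMeasurable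
    (fun _ => enorm_bil_sq_le _ _ k j) (lintegral_sob_mul_sob_ne_top hg hτT hv)

lemma sob_two_ne_top_of_wnorm (hg : Dominates T g u) (hv : wnorm g τ v ≠ ⊤)
    (hvm : ∀ k j, Measurable fun t => v t k j) :
    ∀ᵐ s ∂(volume.restrict (Ioc 0 τ)), sob 2 (v s) ≠ ⊤ := by
  have hm : Measurable fun s => ∑' k, dens g s k * ∑ j, ‖v s k j‖ₑ ^ 2 :=
    Measurable.tsum fun k => (measurable_dens hg.measurable hg.intervalIntegrable k).mul
      (Finset.measurable_fun_sum _ fun j _ => (hvm k j).enorm.pow_const 2)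
  filter_upwards [ae_lt_top' hm.aemeasurable hv] with s hs
  have h1 : ENNReal.ofReal (decay rate g s) * sob 2 (v s) ≤ ∑' k, dens g s k * ∑ j, ‖v s k j‖ₑ ^ 2 := by
    rw [sob, ← ENNReal.tsum_mul_left]
    refine ENNReal.tsum_le_tsum fun k => ?_
    rw [← mul_assoc]
    refine mul_le_mul_left ?_ _
    rw [dens, ewt, ← ENNReal.ofReal_pow (wt_pos k).le, ← ENNReal.ofReal_mul (decay_pos _ _ _).le]
    apply ENNReal.ofReal_le_ofReal
    have h1 := one_le_wt k
    have h2 := mul_nonneg rate_nonneg (zero_le_one.trans (hg.one_le s))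
    have h3 : wt k ^ 2 ≤ wt k ^ 3 := pow_le_pow_right₀ h1 (by norm_num)
    exact mul_le_mul_of_nonneg_left (by nlinarith) (decay_pos _ _ _).le
  intro htop
  rw [htop, ENNReal.mul_top (ofReal_decay_ne_zero _ _ _)] at h1
  exact absurd hs (not_lt.mpr h1)

/-! ### The weighted space-time `L²` space and the Picard iteration on it -/

/-- The measure on `(0, T] × ℤ³ × {1,2,3}` whose `L²` norm is the weighted norm. -/
def modeMeasure (T : ℝ) (g : ℝ → ℝ) : Measure (ℝ × (Freq × Fin 3)) :=
  ((volume.restrict (Ioc 0 T)).prod Measure.count).withDensity fun p => dens g p.1 p.2.1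

lemma measurable_dens_prod (hg : Measurable g) (hgi : ∀ a b, IntervalIntegrable g volume a b) :
    Measurable fun p : ℝ × (Freq × Fin 3) => dens g p.1 p.2.1 :=
  measurable_from_prod_countable_left fun q => measurable_dens hg hgi q.1

lemma lintegral_modeMeasure (hg : Measurable g) (hgi : ∀ a b, IntervalIntegrable g volume a b)
    {f : ℝ × (Freq × Fin 3) → ℂ} (hf : Measurable f) :
    ∫⁻ p, ‖f p‖ₑ ^ 2 ∂(modeMeasure T g) = wnorm g T (fun t k j => f (t, (k, j))) := by
  have hd := measurable_dens_prod hg hgi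
  have hf2 : Measurable fun p => ‖f p‖ₑ ^ 2 := hf.enorm.pow_const 2
  rw [modeMeasure, lintegral_withDensity_eq_lintegral_mul₀ hd.aemeasurable hf2.aemeasurable,
    lintegral_prod _ (hd.mul hf2).aemeasurable, wnorm]
  refine lintegral_congr fun s => ?_
  rw [lintegral_count, ENNReal.tsum_prod']
  refine tsum_congr fun k => ?_
  rw [tsum_fintype, Finset.mul_sum]
  rfl

lemma dens_ne_zero (hg : ∀ t, 1 ≤ g t) (s : ℝ) (k : Freq) : dens g s k ≠ 0 := by
  have h1 := decay_pos rate g s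
  have h2 := wt_pos k
  have h3 : 0 ≤ rate * g s * wt k :=
    mul_nonneg (mul_nonneg rate_nonneg (zero_le_one.trans (hg s))) h2.le
  simp only [dens, ne_eq, ENNReal.ofReal_eq_zero, not_le]
  positivity

/-- One step of the Picard iteration. -/
def picard (T : ℝ) (w₀ : Modes) (u v : ℝ → Modes) : ℝ → Modes := fun t k j =>
  duhamel (freqSq k) (w₀ k j) ((Ioc 0 T).indicator fun s => bil (u s) (v s) k j) t

lemma intervalIntegrable_indicator_bil (hg : Dominates T g u) (hv : wnorm g T v ≠ ⊤)
    (hum : ∀ k j, Measurable fun t => u t k j) (hvm : ∀ k j, Measurable fun t => v t k j)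
    (k : Freq) (j : Fin 3) (a b : ℝ) :
    IntervalIntegrable ((Ioc 0 T).indicator fun s => bil (u s) (v s) k j) volume a b :=
  ((integrable_indicator_iff measurableSet_Ioc).mpr
    (integrableOn_bil hg le_rfl hv hum hvm k j)).intervalIntegrable

lemma isModeSol_picard (hT : 0 ≤ T) (hg : Dominates T g u) (hv : wnorm g T v ≠ ⊤)
    (hum : ∀ k j, Measurable fun t => u t k j) (hvm : ∀ k j, Measurable fun t => v t k j)
    (w₀ : Modes) : IsModeSol T (fun s => bil (u s) (v s)) (picard T w₀ u v) := by
  intro k j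
  refine (isPrim_duhamel hT (w₀ k j)
    (intervalIntegrable_indicator_bil hg hv hum hvm k j 0 T)).congr hT (fun t _ => rfl)
    (.of_forall fun t ht => ?_)
  rw [indicator_of_mem ht]
  rfl

lemma continuous_picard (hg : Dominates T g u) (hv : wnorm g T v ≠ ⊤)
    (hum : ∀ k j, Measurable fun t => u t k j) (hvm : ∀ k j, Measurable fun t => v t k j)
    (w₀ : Modes) (k : Freq) (j : Fin 3) : Continuous fun t => picard T w₀ u v t k j :=
  continuous_duhamel _ _ (intervalIntegrable_indicator_bil hg hv hum hvm k j)

lemma tsum_bil_sq_le' (u v : Modes) : ∑' k, (ewt k)⁻¹ * ∑ j, ‖bil u v k j‖ₑ ^ 2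
    ≤ 93312 * (sob 2 u * sob 2 v) :=
  (tsum_bil_sq_le u v).trans (mul_le_mul_left (by norm_num) _)

lemma two_inv_mul_le {a b c : ℝ≥0∞} (h : 2⁻¹ * a ≤ b + 8⁻¹ * c) : a ≤ 2 * b + 4⁻¹ * c := by
  have h1 : 2 * (2⁻¹ * a) ≤ 2 * (b + 8⁻¹ * c) := mul_le_mul_right h 2
  rw [← mul_assoc, ENNReal.mul_inv_cancel (by simp) (by simp), one_mul, mul_add, ← mul_assoc] at h1
  convert h1 using 3
  rw [show (8 : ℝ≥0∞) = 2 * 4 by norm_num, ENNReal.mul_inv (by simp) (by simp), ← mul_assoc,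
    ENNReal.mul_inv_cancel (by simp) (by simp), one_mul]

lemma wnorm_picard_ne_top (hT : 0 ≤ T) (hg : Dominates T g u) (hv : wnorm g T v ≠ ⊤)
    (hum : ∀ k j, Measurable fun t => u t k j) (hvm : ∀ k j, Measurable fun t => v t k j)
    {w₀ : Modes} (h0 : sob 1 w₀ ≠ ⊤) : wnorm g T (picard T w₀ u v) ≠ ⊤ := by
  have h := energy_le_of_bound hT le_rfl hg (isModeSol_picard hT hg hv hum hvm w₀)
    (.of_forall fun _ => tsum_bil_sq_le' _ _)
  have h2 : picard T w₀ u v 0 = w₀ := by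
    ext k j; exact duhamel_zero _ _ _
  rw [h2] at h
  have h3 := two_inv_mul_le (le_trans le_add_self h)
  exact ne_top_of_le_ne_top (by finiteness) h3

/-- The difference of two iterates starts from zero and is driven by `bil u (v - v')`, by linearity
in the second argument. The basic estimate gives the ratio of `1/8` to `1/2`. -/
lemma wnorm_picard_sub_le (hT : 0 ≤ T) (hg : Dominates T g u) {v v' : ℝ → Modes}
    (hv : wnorm g T v ≠ ⊤) (hv' : wnorm g T v' ≠ ⊤)
    (hum : ∀ k j, Measurable fun t => u t k j) (hvm : ∀ k j, Measurable fun t => v t k j)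
    (hvm' : ∀ k j, Measurable fun t => v' t k j) (w₀ : Modes) :
    wnorm g T (fun t => picard T w₀ u v t - picard T w₀ u v' t)
      ≤ 4⁻¹ * wnorm g T (fun t => v t - v' t) := by
  have hsol : IsModeSol T (fun s k j => bil (u s) (v s) k j - bil (u s) (v' s) k j)
      (fun t => picard T w₀ u v t - picard T w₀ u v' t) := by
    intro k j
    refine ((isModeSol_picard hT hg hv hum hvm w₀ k j).sub
      (isModeSol_picard hT hg hv' hum hvm' w₀ k j)).congr hT (fun t _ => rfl)
      (.of_forall fun t _ => ?_)
    simp only [Pi.sub_apply]; ring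
  have hu2 : ∀ᵐ s ∂(volume.restrict (Ioc 0 T)), sob 2 (u s) ≠ ⊤ := by
    filter_upwards [hg.sob_sq_le] with s hs
    exact ne_top_of_sq_le hs (by finiteness)
  have h := energy_le_of_bound hT le_rfl hg hsol (v := fun t => v t - v' t) (by
    filter_upwards [hu2, sob_two_ne_top_of_wnorm hg hv hvm, sob_two_ne_top_of_wnorm hg hv' hvm']
      with s h1 h2 h3
    simp only [← bil_sub h1 h2 h3]
    exact tsum_bil_sq_le' _ _)
  have h0 : sob 1 (picard T w₀ u v 0 - picard T w₀ u v' 0) = 0 := by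
    simp [sob, picard, duhamel_zero]
  rw [h0, zero_add] at h
  have h3 := two_inv_mul_le (b := 0) (by rw [zero_add]; exact le_trans le_add_self h)
  simpa using h3

lemma memLp_modeMeasure_iff (hg : Measurable g) (hgi : ∀ a b, IntervalIntegrable g volume a b)
    {f : ℝ × (Freq × Fin 3) → ℂ} (hf : Measurable f) :
    MemLp f 2 (modeMeasure T g) ↔ wnorm g T (fun t k j => f (t, (k, j))) ≠ ⊤ := by
  rw [← lintegral_modeMeasure hg hgi hf, MemLp,
    eLpNorm_lt_top_iff_lintegral_rpow_enorm_lt_top (by simp) (by simp), lt_top_iff_ne_top]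
  simp [hf.aestronglyMeasurable]

lemma eLpNorm_modeMeasure (hg : Measurable g) (hgi : ∀ a b, IntervalIntegrable g volume a b)
    {f : ℝ × (Freq × Fin 3) → ℂ} (hf : Measurable f) :
    eLpNorm f 2 (modeMeasure T g)
      = wnorm g T (fun t k j => f (t, (k, j))) ^ (1 / 2 : ℝ) := by
  rw [← lintegral_modeMeasure hg hgi hf, eLpNorm_eq_lintegral_rpow_enorm_toReal (by simp) (by simp)]
  simp

/-- Existence of a solution of the system of Fourier coefficients. -/
theorem exists_modeSol (hT : 0 ≤ T) (hg : Dominates T g u)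
    (hum : ∀ k j, Measurable fun t => u t k j) {w₀ : Modes} (h0 : sob 1 w₀ ≠ ⊤) :
    ∃ w : ℝ → Modes, w 0 = w₀ ∧ (∀ k j, Continuous fun t => w t k j) ∧
      IsModeSol T (fun s => bil (u s) (w s)) w ∧ wnorm g T w ≠ ⊤ := by
  have hgm := hg.measurable
  have hgi := hg.intervalIntegrable
  set X := Lp ℂ 2 (modeMeasure T g)
  let rep : X → ℝ → Modes := fun f t k j => f (t, (k, j))
  have hfm : ∀ f : X, Measurable f := fun f => (Lp.stronglyMeasurable f).measurable
  have hrm : ∀ f k j, Measurable fun t => rep f t k j := fun f k j =>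
    (hfm f).comp (measurable_id.prodMk measurable_const)
  have hrn : ∀ f, wnorm g T (rep f) ≠ ⊤ := fun f =>
    (memLp_modeMeasure_iff hgm hgi (hfm f)).mp (Lp.memLp f)
  let Φ : X → ℝ × (Freq × Fin 3) → ℂ := fun f p => picard T w₀ u (rep f) p.1 p.2.1 p.2.2
  have hΦm : ∀ f, Measurable (Φ f) := fun f => measurable_from_prod_countable_left fun q =>
    (continuous_picard hg (hrn f) hum (hrm f) w₀ q.1 q.2).measurable
  have hΦ : ∀ f, MemLp (Φ f) 2 (modeMeasure T g) := fun f =>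
    (memLp_modeMeasure_iff hgm hgi (hΦm f)).mpr
      (wnorm_picard_ne_top hT hg (hrn f) hum (hrm f) h0)
  let S : X → X := fun f => (hΦ f).toLp
  have hS : ContractingWith (1 / 2) S := by
    -- `wnorm` is a squared norm, so its contraction factor `1/4` becomes `1/2` for the distance.
    refine ⟨by rw [← NNReal.coe_lt_coe]; norm_num, fun f f' => ?_⟩
    rw [Lp.edist_toLp_toLp, Lp.edist_def, eLpNorm_modeMeasure hgm hgi ((hΦm f).sub (hΦm f')),
      eLpNorm_modeMeasure hgm hgi ((hfm f).sub (hfm f'))]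
    have h := wnorm_picard_sub_le hT hg (hrn f) (hrn f') hum (hrm f) (hrm f') w₀
    calc _ ≤ (4⁻¹ * wnorm g T (fun t => rep f t - rep f' t)) ^ (1 / 2 : ℝ) :=
          ENNReal.rpow_le_rpow h (by norm_num)
      _ = _ := by
          rw [ENNReal.mul_rpow_of_nonneg _ _ (by norm_num)]
          congr 1
          have : (4 : ℝ≥0∞)⁻¹ = (2⁻¹) ^ (2 : ℝ) := by
            rw [ENNReal.rpow_two, ← ENNReal.inv_pow]; norm_num
          rw [this, ← ENNReal.rpow_mul]
          norm_num
  set f := ContractingWith.fixedPoint S hS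
  have hfix : S f = f := hS.fixedPoint_isFixedPt
  have hae : Φ f =ᵐ[modeMeasure T g] f := by
    have := (hΦ f).coeFn_toLp
    change S f =ᵐ[modeMeasure T g] Φ f at this
    rw [hfix] at this
    exact this.symm
  -- The density never vanishes and the modes carry counting measure, so equality almost everywhere
  -- in the product is equality of all modes at almost every time.
  have hae2 : ∀ᵐ s ∂(volume.restrict (Ioc 0 T)), picard T w₀ u (rep f) s = rep f s := by
    have hae' := (ae_withDensity_iff (measurable_dens_prod hgm hgi)).mp hae
    filter_upwards [Measure.ae_ae_of_ae_prod hae'] with s hs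
    rw [Measure.ae_count_iff] at hs
    ext k j
    exact hs (k, j) (dens_ne_zero hg.one_le s k)
  -- The fixed point is only a class modulo null sets. The solution is the Picard image of a
  -- representative, which has continuous modes and the exact initial value.
  refine ⟨picard T w₀ u (rep f), ?_, continuous_picard hg (hrn f) hum (hrm f) w₀, ?_,
    wnorm_picard_ne_top hT hg (hrn f) hum (hrm f) h0⟩
  · ext k j; exact duhamel_zero _ _ _
  · intro k j
    refine (isModeSol_picard hT hg (hrn f) hum (hrm f) w₀ k j).congr hT (fun _ _ => rfl) ?_
    have h3 := (ae_restrict_iff' measurableSet_Ioc).mp hae2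
    filter_upwards [h3] with s hs hs'
    rw [hs hs']

end

end Magnetization
end

noncomputable section
namespace Magnetization
open scoped ComplexConjugate ENNReal

/-! ### Smooth functions of time and space -/

lemma integrable_of_continuous {F : Type*} [NormedAddCommGroup F] {f : T3 → F} (h : Continuous f) : Integrable f volume :=
  h.integrable_of_hasCompactSupport (HasCompactSupport.of_compactSpace f)

section Smooth

variable {F : Type*} [NormedAddCommGroup F] [NormedSpace ℝ F]

/-- `φ` is smooth on `ℝ × 𝕋³`. -/
def SmoothST (φ : ℝ → T3 → F) : Prop :=
  ContDiff ℝ ∞ (fun p : ℝ × (Fin 3 → ℝ) => φ p.1 (toT3 p.2))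

lemma SmoothT3.smoothST {f : T3 → F} (h : SmoothT3 f) : SmoothST (fun _ : ℝ => f) :=
  ContDiff.comp (g := fun y => f (toT3 y)) h contDiff_snd

lemma SmoothST.smoothT3 {φ : ℝ → T3 → F} (h : SmoothST φ) (t : ℝ) : SmoothT3 (φ t) :=
  ContDiff.comp (g := fun p : ℝ × (Fin 3 → ℝ) => φ p.1 (toT3 p.2)) h
    (contDiff_const.prodMk contDiff_id)

lemma isOpenQuotientMap_toT3 : IsOpenQuotientMap toT3 :=
  IsOpenQuotientMap.piMap fun _ => QuotientAddGroup.isOpenQuotientMap_mk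

lemma toT3_surjective : Function.Surjective toT3 := isOpenQuotientMap_toT3.surjective

lemma toT3_add_smul_single (y : Fin 3 → ℝ) (i : Fin 3) (h : ℝ) :
    toT3 (y + h • Pi.single i (1 : ℝ)) = toT3 y + Pi.single i (h : AddCircle (2 * Real.pi)) := by
  ext j
  by_cases hj : j = i
  · subst hj; simp [toT3]
  · simp [toT3, hj]

namespace SmoothST

variable {φ : ℝ → T3 → F}

lemma continuous (h : SmoothST φ) : Continuous fun p : ℝ × T3 => φ p.1 p.2 := by
  have hq : IsOpenQuotientMap (Prod.map id toT3 : ℝ × (Fin 3 → ℝ) → ℝ × T3) :=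
    IsOpenQuotientMap.id.prodMap isOpenQuotientMap_toT3
  rw [hq.isQuotientMap.continuous_iff]
  exact ContDiff.continuous h

lemma hasDerivAt_space_lift (h : SmoothST φ) (t : ℝ) (y : Fin 3 → ℝ) (i : Fin 3) :
    HasDerivAt (fun r : ℝ => φ t (toT3 y + Pi.single i (r : AddCircle (2 * Real.pi))))
      (fderiv ℝ (fun p : ℝ × (Fin 3 → ℝ) => φ p.1 (toT3 p.2)) (t, y) (0, Pi.single i 1)) 0 := by
  have hd : HasFDerivAt (fun p : ℝ × (Fin 3 → ℝ) => φ p.1 (toT3 p.2))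
      (fderiv ℝ (fun p : ℝ × (Fin 3 → ℝ) => φ p.1 (toT3 p.2)) (t, y)) (t, y) :=
    ((ContDiff.differentiable h (by simp)) (t, y)).hasFDerivAt
  have hl : HasDerivAt (fun r : ℝ => ((t, y + r • Pi.single i (1 : ℝ)) : ℝ × (Fin 3 → ℝ)))
      (0, Pi.single i 1) 0 := by
    refine (hasDerivAt_const _ _).prodMk ?_
    simpa using ((hasDerivAt_id (0 : ℝ)).smul_const (Pi.single i (1 : ℝ) : Fin 3 → ℝ)).const_add y
  have hd' : HasFDerivAt (fun p : ℝ × (Fin 3 → ℝ) => φ p.1 (toT3 p.2))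
      (fderiv ℝ (fun p : ℝ × (Fin 3 → ℝ) => φ p.1 (toT3 p.2)) (t, y))
      (t, y + (0 : ℝ) • Pi.single i (1 : ℝ)) := by simpa using hd
  have := hd'.comp_hasDerivAt (0 : ℝ) hl
  refine this.congr_of_eventuallyEq (Filter.Eventually.of_forall fun r => ?_)
  simp only [Function.comp_apply, toT3_add_smul_single]

lemma pd_toT3 (h : SmoothST φ) (t : ℝ) (y : Fin 3 → ℝ) (i : Fin 3) :
    pd i (φ t) (toT3 y)
      = fderiv ℝ (fun p : ℝ × (Fin 3 → ℝ) => φ p.1 (toT3 p.2)) (t, y) (0, Pi.single i 1) :=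
  (h.hasDerivAt_space_lift t y i).deriv

lemma hasDerivAt_space (h : SmoothST φ) (t : ℝ) (x : T3) (i : Fin 3) (r : ℝ) :
    HasDerivAt (fun r : ℝ => φ t (x + Pi.single i (r : AddCircle (2 * Real.pi))))
      (pd i (φ t) (x + Pi.single i (r : AddCircle (2 * Real.pi)))) r := by
  obtain ⟨y, hy⟩ := toT3_surjective (x + Pi.single i (r : AddCircle (2 * Real.pi)))
  have h1 := h.hasDerivAt_space_lift t y i
  rw [← h.pd_toT3, hy] at h1
  have h2 := HasDerivAt.comp_sub_const (x := r) (a := r)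
    (f := fun r : ℝ => φ t (x + Pi.single i (_ : AddCircle (2 * Real.pi)) +
      Pi.single i (r : AddCircle (2 * Real.pi)))) (by rw [sub_self]; exact h1)
  refine h2.congr_of_eventuallyEq (Filter.Eventually.of_forall fun r' => ?_)
  simp only
  congr 1
  rw [add_assoc, ← Pi.single_add, ← AddCircle.coe_add, add_sub_cancel]

lemma pd (h : SmoothST φ) (i : Fin 3) : SmoothST fun t => pd i (φ t) := by
  unfold SmoothST
  simp only [h.pd_toT3]
  exact ((ContDiff.fderiv_right h (m := ∞) (by simp)).clm_apply contDiff_const)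

lemma hasDerivAt_time (h : SmoothST φ) (t : ℝ) (x : T3) :
    HasDerivAt (fun τ => φ τ x) (deriv (fun τ => φ τ x) t) t := by
  obtain ⟨y, rfl⟩ := toT3_surjective x
  have h2 : ContDiff ℝ ∞ (fun τ => φ τ (toT3 y)) :=
    ContDiff.comp (g := fun p : ℝ × (Fin 3 → ℝ) => φ p.1 (toT3 p.2)) h
      (contDiff_id.prodMk contDiff_const)
  exact ((h2.differentiable (by simp)) t).hasDerivAt

lemma time_toT3 (h : SmoothST φ) (t : ℝ) (y : Fin 3 → ℝ) :
    deriv (fun τ => φ τ (toT3 y)) t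
      = fderiv ℝ (fun p : ℝ × (Fin 3 → ℝ) => φ p.1 (toT3 p.2)) (t, y) (1, 0) := by
  have hd : HasFDerivAt (fun p : ℝ × (Fin 3 → ℝ) => φ p.1 (toT3 p.2))
      (fderiv ℝ (fun p : ℝ × (Fin 3 → ℝ) => φ p.1 (toT3 p.2)) (t, y)) (t, y) :=
    ((ContDiff.differentiable h (by simp)) (t, y)).hasFDerivAt
  have hl : HasDerivAt (fun r : ℝ => ((r, y) : ℝ × (Fin 3 → ℝ))) (1, 0) t :=
    (hasDerivAt_id t).prodMk (hasDerivAt_const _ _)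
  exact (hd.comp_hasDerivAt t hl).deriv

lemma time (h : SmoothST φ) : SmoothST fun t x => deriv (fun τ => φ τ x) t := by
  unfold SmoothST
  simp only [h.time_toT3]
  exact ((ContDiff.fderiv_right h (m := ∞) (by simp)).clm_apply contDiff_const)

lemma clm {G : Type*} [NormedAddCommGroup G] [NormedSpace ℝ G] (L : F →L[ℝ] G)
    (h : SmoothST φ) : SmoothST fun t x => L (φ t x) :=
  L.contDiff.comp h

lemma pd_clm {G : Type*} [NormedAddCommGroup G] [NormedSpace ℝ G] (L : F →L[ℝ] G)
    (h : SmoothST φ) (i : Fin 3) (t : ℝ) (x : T3) :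
    Magnetization.pd i (fun x => L (φ t x)) x = L (Magnetization.pd i (φ t) x) := by
  have h1 := h.hasDerivAt_space t x i 0
  have h2 := L.hasFDerivAt.comp_hasDerivAt (0 : ℝ) h1
  have h3 : HasDerivAt (fun r : ℝ => L (φ t (x + Pi.single i (r : AddCircle (2 * Real.pi)))))
      (L (Magnetization.pd i (φ t) x)) 0 := by
    simpa [Function.comp_def] using h2
  exact h3.deriv

lemma time_clm {G : Type*} [NormedAddCommGroup G] [NormedSpace ℝ G] (L : F →L[ℝ] G)
    (h : SmoothST φ) (t : ℝ) (x : T3) :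
    deriv (fun τ => L (φ τ x)) t = L (deriv (fun τ => φ τ x) t) :=
  (L.hasFDerivAt.comp_hasDerivAt t (h.hasDerivAt_time t x)).deriv

lemma add {ψ : ℝ → T3 → F} (h : SmoothST φ) (h2 : SmoothST ψ) :
    SmoothST fun t x => φ t x + ψ t x := ContDiff.add h h2

lemma finsetSum {ι : Type*} (s : Finset ι) {ψ : ι → ℝ → T3 → F} (h : ∀ i ∈ s, SmoothST (ψ i)) :
    SmoothST fun t x => ∑ i ∈ s, ψ i t x := ContDiff.sum h

lemma exists_bound (h : SmoothST φ) (a b : ℝ) : ∃ C, ∀ t ∈ Icc a b, ∀ x, ‖φ t x‖ ≤ C := by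
  obtain ⟨C, hC⟩ := (isCompact_Icc.prod isCompact_univ).exists_bound_of_continuousOn
    (s := Icc a b ×ˢ (univ : Set T3)) h.continuous.continuousOn
  exact ⟨C, fun t ht x => hC (t, x) ⟨ht, mem_univ x⟩⟩

end SmoothST

lemma SmoothT3.continuous {f : T3 → F} (h : SmoothT3 f) : Continuous f :=
  h.smoothST.continuous.comp (Continuous.prodMk_right (0 : ℝ))

/-- The integral of a partial derivative over the torus vanishes. -/
theorem integral_pd [CompleteSpace F] {f : T3 → F} (h : SmoothT3 f) (i : Fin 3) :
    ∫ x, pd i f x = 0 := by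
  have hS := h.smoothST
  obtain ⟨C, hC⟩ := (hS.pd i).exists_bound 0 0
  have hc := h.continuous
  have hcp : Continuous (pd i f) := ((hS.pd i).smoothT3 0).continuous
  have hd := hasDerivAt_integral_of_dominated_loc_of_deriv_le (μ := (volume : Measure T3))
    (F := fun (r : ℝ) x => f (x + Pi.single i (r : AddCircle (2 * Real.pi))))
    (F' := fun (r : ℝ) x => pd i f (x + Pi.single i (r : AddCircle (2 * Real.pi))))
    (x₀ := 0) (s := univ) (bound := fun _ => C) Filter.univ_mem
    (Filter.Eventually.of_forall fun r => by
      exact (hc.comp (by fun_prop)).aestronglyMeasurable)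
    (integrable_of_continuous (hc.comp (by fun_prop)))
    ((hcp.comp (by fun_prop)).aestronglyMeasurable)
    (Filter.Eventually.of_forall fun x r _ => hC 0 ⟨le_rfl, le_rfl⟩ _)
    (integrable_const C)
    (Filter.Eventually.of_forall fun x r _ => hS.hasDerivAt_space 0 x i r)
  have h1 := hd.2
  -- By translation invariance the integral of the shifted function is constant in `r`, while its
  -- derivative at zero is the integral of the partial derivative.
  have h2 : (fun r : ℝ => ∫ x : T3, f (x + Pi.single i (r : AddCircle (2 * Real.pi))))
      = fun _ => ∫ x, f x := by
    ext r
    exact integral_add_right_eq_self f _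
  rw [h2] at h1
  have := h1.unique (hasDerivAt_const 0 _)
  simpa using this

end Smooth

/-! ### Exponentials -/

lemma expo_toT3 (k : Freq) (y : Fin 3 → ℝ) :
    expo k (toT3 y) = Complex.exp (Complex.I * ∑ i, (k i : ℂ) * (y i : ℂ)) := by
  rw [expo_apply, Finset.mul_sum, Complex.exp_sum]
  refine Finset.prod_congr rfl fun i _ => ?_
  rw [toT3, fourier_coe_apply]
  congr 1
  push_cast
  have : (Real.pi : ℂ) ≠ 0 := by exact_mod_cast Real.pi_ne_zero
  field_simp

lemma smoothT3_expo (k : Freq) : SmoothT3 (expo k) := by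
  unfold SmoothT3
  simp only [expo_toT3]
  refine ContDiff.cexp (contDiff_const.mul (ContDiff.sum fun i _ => contDiff_const.mul ?_))
  exact Complex.ofRealCLM.contDiff.comp (contDiff_apply ℝ ℝ i)

lemma expo_single_coe (k : Freq) (i : Fin 3) (r : ℝ) :
    expo k (Pi.single i (r : AddCircle (2 * Real.pi))) = Complex.exp (Complex.I * k i * r) := by
  have h := toT3_add_smul_single 0 i r
  have h0 : toT3 0 = 0 := by ext j; simp [toT3]
  rw [h0, zero_add, zero_add] at h
  rw [← h, expo_toT3]
  congr 1
  rw [mul_assoc, Finset.sum_eq_single i]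
  · simp
  · intro j _ hj; simp [hj]
  · simp

lemma expo_add_arg (k : Freq) (x y : T3) : expo k (x + y) = expo k x * expo k y := by
  simp only [expo_apply, Pi.add_apply, fourier_apply, smul_add, AddCircle.toCircle_add,
    Circle.coe_mul, Finset.prod_mul_distrib]

lemma hasDerivAt_expo (k : Freq) (i : Fin 3) (x : T3) :
    HasDerivAt (fun r : ℝ => expo k (x + Pi.single i (r : AddCircle (2 * Real.pi))))
      (Complex.I * k i * expo k x) 0 := by
  simp only [expo_add_arg, expo_single_coe]
  have h1 : HasDerivAt (fun r : ℝ => Complex.I * (k i : ℂ) * (r : ℂ)) (Complex.I * k i) 0 := by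
    simpa using (Complex.ofRealCLM.hasDerivAt (x := (0 : ℝ))).const_mul (Complex.I * (k i : ℂ))
  have := h1.cexp.const_mul (expo k x)
  simpa [mul_comm] using this

lemma pd_expo (k : Freq) (i : Fin 3) (x : T3) : pd i (expo k) x = Complex.I * k i * expo k x :=
  (hasDerivAt_expo k i x).deriv

/-! ### Fourier coefficients of smooth functions -/

lemma norm_coef_le {f : T3 → ℂ} {C : ℝ} (h : ∀ x, ‖f x‖ ≤ C) (k : Freq) : ‖coef f k‖ ≤ C := by
  have hv : (volume : Measure T3).real univ = vol := by
    have := integral_expo 0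
    simp only [expo_zero, if_true, integral_const, Complex.real_smul, mul_one] at this
    exact_mod_cast this
  have h1 := norm_integral_le_of_norm_le_const (μ := (volume : Measure T3))
    (f := fun x => expo (-k) x * f x) (C := C)
    (Filter.Eventually.of_forall fun x => by rw [norm_mul, norm_expo_apply, one_mul]; exact h x)
  rw [hv] at h1
  rw [coef, norm_mul, norm_inv, Complex.norm_real, Real.norm_of_nonneg vol_pos.le]
  rw [inv_mul_le_iff₀ vol_pos]
  linarith

lemma integrable_expo_mul {f : T3 → ℂ} (h : Integrable f volume) (k : Freq) :
    Integrable (fun x => expo k x * f x) volume := by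
  refine h.mono ((expo k).continuous.aestronglyMeasurable.mul h.1)
    (Filter.Eventually.of_forall fun x => ?_)
  rw [norm_mul, norm_expo_apply, one_mul]

lemma coef_add {f g : T3 → ℂ} (hf : Integrable f volume) (hg : Integrable g volume) (k : Freq) :
    coef (fun x => f x + g x) k = coef f k + coef g k := by
  unfold coef
  simp only [mul_add]
  rw [integral_add (integrable_expo_mul hf _) (integrable_expo_mul hg _), mul_add]

lemma coef_finsetSum {ι : Type*} (s : Finset ι) {f : ι → T3 → ℂ}
    (hf : ∀ i ∈ s, Integrable (f i) volume) (k : Freq) :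
    coef (fun x => ∑ i ∈ s, f i x) k = ∑ i ∈ s, coef (f i) k := by
  unfold coef
  simp only [Finset.mul_sum]
  rw [integral_finsetSum _ fun i hi => integrable_expo_mul (hf i hi) _, Finset.mul_sum]

/-- Integration by parts: the integral of `∂ᵢ(e_{-k} f)` over the torus vanishes. -/
lemma coef_pd {f : T3 → ℂ} (h : SmoothT3 f) (i : Fin 3) (k : Freq) :
    coef (pd i f) k = Complex.I * k i * coef f k := by
  have hs : SmoothT3 fun x => expo (-k) x * f x := ContDiff.mul (smoothT3_expo (-k)) h
  have hp : ∀ x, pd i (fun x => expo (-k) x * f x) x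
      = -(Complex.I * k i) * (expo (-k) x * f x) + expo (-k) x * pd i f x := by
    intro x
    have h1 := hasDerivAt_expo (-k) i x
    have h2 := h.smoothST.hasDerivAt_space 0 x i 0
    have h3 := h1.mul h2
    have h4 := h3.deriv
    simp only [AddCircle.coe_zero, Pi.single_zero, add_zero] at h4
    refine Eq.trans ?_ (h4.trans ?_)
    · rfl
    · simp only [Pi.neg_apply, Int.cast_neg]; ring
  have h0 := integral_pd hs i
  simp only [hp] at h0
  have hi1 : Integrable (fun x => expo (-k) x * f x) volume :=
    integrable_expo_mul (integrable_of_continuous h.continuous) _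
  have hi2 : Integrable (fun x => expo (-k) x * pd i f x) volume :=
    integrable_expo_mul (integrable_of_continuous ((h.smoothST.pd i).smoothT3 0).continuous) _
  rw [integral_add (hi1.const_mul _) hi2, integral_const_mul] at h0
  unfold coef
  linear_combination (vol : ℂ)⁻¹ * h0

/-- The Fourier coefficients of a smooth function of time and space decay rapidly, uniformly on
bounded time intervals. -/
theorem SmoothST.exists_coef_bound {φ : ℝ → T3 → ℂ} (h : SmoothST φ) (a b : ℝ) :
    ∃ C, ∀ t ∈ Icc a b, ∀ k, ‖coef (φ t) k‖ ≤ C * (1 + ∑ i, (k i : ℝ) ^ 4)⁻¹ := by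
  -- The operator `1 + ∑ ∂ᵢ⁴` has symbol `1 + ∑ kᵢ⁴`, because `(i kᵢ)⁴ = kᵢ⁴`. A uniform bound on
  -- `ψ` is therefore the desired decay of the coefficients of `φ`.
  set ψ : ℝ → T3 → ℂ := fun t x =>
    φ t x + ∑ i, Magnetization.pd i (Magnetization.pd i (Magnetization.pd i
      (Magnetization.pd i (φ t)))) x with hψ
  have hs : ∀ i, SmoothST fun t => Magnetization.pd i (Magnetization.pd i (Magnetization.pd i
      (Magnetization.pd i (φ t)))) := fun i => (((h.pd i).pd i).pd i).pd i
  have hψs : SmoothST ψ := h.add (SmoothST.finsetSum _ fun i _ => hs i)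
  obtain ⟨C, hC⟩ := hψs.exists_bound a b
  refine ⟨C, fun t ht k => ?_⟩
  have hpos : (0 : ℝ) < 1 + ∑ i, (k i : ℝ) ^ 4 := by
    have : 0 ≤ ∑ i, (k i : ℝ) ^ 4 := Finset.sum_nonneg fun i _ => by positivity
    linarith
  have hint : ∀ {f : T3 → ℂ}, SmoothT3 f → Integrable f volume := fun hf =>
    integrable_of_continuous hf.continuous
  have hc : coef (ψ t) k = ((1 + ∑ i, (k i : ℝ) ^ 4 : ℝ) : ℂ) * coef (φ t) k := by
    rw [hψ, coef_add (hint (h.smoothT3 t))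
      (hint ((SmoothST.finsetSum Finset.univ fun i _ => hs i).smoothT3 t)),
      coef_finsetSum _ fun i _ => hint ((hs i).smoothT3 t)]
    have : ∀ i, coef (Magnetization.pd i (Magnetization.pd i (Magnetization.pd i
        (Magnetization.pd i (φ t))))) k = (k i : ℂ) ^ 4 * coef (φ t) k := by
      intro i
      rw [coef_pd ((((h.pd i).pd i).pd i).smoothT3 t), coef_pd (((h.pd i).pd i).smoothT3 t),
        coef_pd ((h.pd i).smoothT3 t), coef_pd (h.smoothT3 t)]
      linear_combination ((k i : ℂ) ^ 4 * coef (φ t) k) * Complex.I_pow_four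
    simp only [this]
    rw [← Finset.sum_mul]
    push_cast
    ring
  have h1 := norm_coef_le (hC t ht) k
  rw [hc, norm_mul, Complex.norm_real, Real.norm_of_nonneg hpos.le] at h1
  rw [← div_eq_mul_inv, le_div_iff₀ hpos]
  linarith

lemma SmoothT3.summable_coef {f : T3 → ℂ} (h : SmoothT3 f) : Summable (coef f) := by
  obtain ⟨C, hC⟩ := h.smoothST.exists_coef_bound 0 0
  exact .of_norm_bounded (summable_inv_one_add_sum_pow_four.mul_left C)
    fun k => hC 0 ⟨le_rfl, le_rfl⟩ k

lemma SmoothST.hasDerivAt_coef {φ : ℝ → T3 → ℂ} (h : SmoothST φ) (t : ℝ) (k : Freq) :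
    HasDerivAt (fun t => coef (φ t) k) (coef (fun x => deriv (fun τ => φ τ x) t) k) t := by
  obtain ⟨C, hC⟩ := h.time.exists_bound (t - 1) (t + 1)
  have hc : ∀ s, Continuous (φ s) := fun s => (h.smoothT3 s).continuous
  have hct : ∀ s, Continuous fun x => deriv (fun τ => φ τ x) s :=
    fun s => (h.time.smoothT3 s).continuous
  have hd := hasDerivAt_integral_of_dominated_loc_of_deriv_le (μ := (volume : Measure T3))
    (F := fun (s : ℝ) x => expo (-k) x * φ s x)
    (F' := fun (s : ℝ) x => expo (-k) x * deriv (fun τ => φ τ x) s)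
    (x₀ := t) (s := Icc (t - 1) (t + 1)) (bound := fun _ => C)
    (Icc_mem_nhds (by linarith) (by linarith))
    (Filter.Eventually.of_forall fun s =>
      ((expo (-k)).continuous.mul (hc s)).aestronglyMeasurable)
    (integrable_of_continuous ((expo (-k)).continuous.mul (hc t)))
    (((expo (-k)).continuous.mul (hct t)).aestronglyMeasurable)
    (Filter.Eventually.of_forall fun x s hs => by
      rw [norm_mul, norm_expo_apply, one_mul]; exact hC s hs x)
    (integrable_const C)
    (Filter.Eventually.of_forall fun x s _ => (h.hasDerivAt_time s x).const_mul _)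
  exact hd.2.const_mul _

lemma SmoothST.continuous_coef {φ : ℝ → T3 → ℂ} (h : SmoothST φ) (k : Freq) :
    Continuous fun t => coef (φ t) k :=
  continuous_iff_continuousAt.mpr fun t => (h.hasDerivAt_coef t k).continuousAt

/-- The integral of a smooth function against an integrable function, in terms of Fourier
coefficients. -/
theorem SmoothT3.hasSum_integral_mul {ψ h : T3 → ℂ} (hψ : SmoothT3 ψ) (hh : Integrable h volume) :
    HasSum (fun k => (vol : ℂ) * (coef ψ k * coef h (-k))) (∫ x, ψ x * h x) := by
  have hs := hψ.summable_coef
  -- Parseval is not available, since `h` is merely integrable, as are the nonlinear terms. Absolute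
  -- summability of the coefficients of `ψ` justifies integrating its Fourier series term by term.
  have hsum := hasSum_integral_of_summable_integral_norm (μ := (volume : Measure T3))
    (F := fun k x => coef ψ k * (expo k x * h x))
    (fun k => (integrable_expo_mul hh k).const_mul _) (by
      simp only [norm_mul, norm_expo_apply, one_mul, integral_const_mul]
      exact hs.norm.mul_right _)
  convert! hsum using 1
  · ext1 k
    rw [integral_const_mul, coef, coef, neg_neg]
    have := vol_ne
    field_simp
  · refine integral_congr_ae (Filter.Eventually.of_forall fun x => ?_)
    have h1 := (hasSum_coef_mul_expo ⟨ψ, hψ.continuous⟩ hs x).tsum_eq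
    simp only [ContinuousMap.coe_mk] at h1
    simp only [← mul_assoc, tsum_mul_right]
    rw [h1]

end Magnetization
end

noncomputable section
namespace Magnetization
open scoped ComplexConjugate ENNReal

/-! ### Vector fields and their Fourier coefficients -/

/-- The Fourier coefficients of a vector field. -/
def modes (f : L2) : Modes := fun k j => fourierCoef f k j

lemma modes_sub (f g : L2) : modes (f - g) = modes f - modes g := by
  ext k j
  simp only [modes, Pi.sub_apply, ← fourierCoefL_apply, map_sub]

lemma sob_one_modes (f : L2) : sob 1 (modes f) = hsNormSq (1 / 2) f := by
  unfold sob hsNormSq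
  refine tsum_congr fun k => ?_
  rw [pow_one, ewt, wt]
  norm_num [modes]

lemma ewt_cube_le (k : Freq) :
    ewt k ^ 3 ≤ 4 * ENNReal.ofReal (1 + Real.sqrt (∑ i, (k i : ℝ) ^ 2) ^ (2 * (3 / 2 : ℝ))) := by
  rw [ewt, wt, ← ENNReal.ofReal_pow (by positivity), show (4 : ℝ≥0∞) = ENNReal.ofReal 4 by simp,
    ← ENNReal.ofReal_mul (by norm_num)]
  apply ENNReal.ofReal_le_ofReal
  set x := Real.sqrt (∑ i, (k i : ℝ) ^ 2) with hx
  have hx0 : 0 ≤ x := Real.sqrt_nonneg _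
  rw [show (2 * (3 / 2 : ℝ)) = (3 : ℕ) by norm_num, Real.rpow_natCast]
  nlinarith [mul_nonneg (add_nonneg zero_le_one hx0) (sq_nonneg (1 - x))]

lemma le_ewt_cube (k : Freq) :
    ENNReal.ofReal (1 + Real.sqrt (∑ i, (k i : ℝ) ^ 2) ^ (2 * (3 / 2 : ℝ))) ≤ ewt k ^ 3 := by
  rw [ewt, wt, ← ENNReal.ofReal_pow (by positivity)]
  apply ENNReal.ofReal_le_ofReal
  set x := Real.sqrt (∑ i, (k i : ℝ) ^ 2) with hx
  have hx0 : 0 ≤ x := Real.sqrt_nonneg _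
  rw [show (2 * (3 / 2 : ℝ)) = (3 : ℕ) by norm_num, Real.rpow_natCast]
  nlinarith [sq_nonneg x]

lemma sob_three_modes_le (f : L2) : sob 3 (modes f) ≤ 4 * hsNormSq (3 / 2) f := by
  unfold sob hsNormSq
  rw [← ENNReal.tsum_mul_left]
  refine ENNReal.tsum_le_tsum fun k => ?_
  rw [← mul_assoc]
  exact mul_le_mul_left (ewt_cube_le k) _

lemma hsNormSq_le_sob_three (f : L2) : hsNormSq (3 / 2) f ≤ sob 3 (modes f) := by
  unfold sob hsNormSq
  exact ENNReal.tsum_le_tsum fun k => mul_le_mul_left (le_ewt_cube k) _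

lemma sob_zero_modes_ne_top (f : L2) : sob 0 (modes f) ≠ ⊤ := by
  have h := (hasSum_norm_sq_fourierCoef f).summable.tsum_ofReal_ne_top
  convert h using 1
  refine tsum_congr fun k => ?_
  rw [pow_zero, one_mul, ENNReal.ofReal_sum_of_nonneg fun _ _ => sq_nonneg _]
  refine Finset.sum_congr rfl fun j _ => ?_
  rw [ENNReal.ofReal_pow (norm_nonneg _), ofReal_norm]
  rfl

lemma memℓp_of_sob {a : Modes} (h : sob 0 a ≠ ⊤) (j : Fin 3) :
    Memℓp (fun k => a k j : Freq → ℂ) 2 := by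
  refine memℓp_gen ?_
  have h1 : ∑' k, ‖a k j‖ₑ ^ 2 ≠ ⊤ := by
    refine ne_top_of_le_ne_top h (ENNReal.tsum_le_tsum fun k => ?_)
    rw [pow_zero, one_mul]
    exact Finset.single_le_sum (f := fun j => ‖a k j‖ₑ ^ 2) (fun _ _ => zero_le) (Finset.mem_univ j)
  refine (ENNReal.summable_toReal h1).congr fun k => ?_
  simp

open scoped Classical in
/-- The real vector field `Re ∑ₖ aₖ e^{ik·x}`, if it is in `L²`. -/
def ofModes (a : Modes) : L2 :=
  if h : sob 0 a ≠ ⊤ then synth fun j => ⟨fun k => a k j, memℓp_of_sob h j⟩ else 0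

lemma fourierCoef_ofModes {a : Modes} (h : sob 0 a ≠ ⊤) (k : Freq) (j : Fin 3) :
    fourierCoef (ofModes a) k j = (1 / 2 : ℂ) * (a k j + conj (a (-k) j)) := by
  rw [ofModes, dif_pos h, fourierCoef_synth]

lemma modes_ofModes {a : Modes} (h : sob 0 a ≠ ⊤) (hs : ∀ k j, a (-k) j = conj (a k j)) :
    modes (ofModes a) = a := by
  ext k j
  rw [modes, fourierCoef_ofModes h, hs, Complex.conj_conj]
  ring

lemma hasSum_synthC (a : SqSeq) :
    HasSum (fun k => a k • ((Real.sqrt vol : ℂ) • expoN k)) (synthC a) := by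
  have h := (expoBasis.hasSum_repr_symm a).const_smul (Real.sqrt vol : ℂ)
  simp only [expoBasis_apply] at h
  convert! h using 1
  ext1 k
  rw [smul_comm]

/-- Finite partial sums are continuous in time with values in `L²`, and they converge in `L²` at
almost every time. -/
theorem aestronglyMeasurable_ofModes {μ : Measure ℝ} {w : ℝ → Modes}
    (hw : ∀ k j, Continuous fun t => w t k j) (hfin : ∀ᵐ t ∂μ, sob 0 (w t) ≠ ⊤) :
    AEStronglyMeasurable (fun t => ofModes (w t)) μ := by
  refine aestronglyMeasurable_of_tendsto_ae (Filter.atTop : Filter (Finset Freq))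
    (f := fun s t => ∑ j, ∑ k ∈ s, (reCoord j).compLpL 2 volume
      (w t k j • ((Real.sqrt vol : ℂ) • expoN k))) (fun s => ?_) ?_
  · refine Continuous.aestronglyMeasurable ?_
    refine continuous_finsetSum _ fun j _ => continuous_finsetSum _ fun k _ => ?_
    exact ContinuousLinearMap.continuous _ |>.comp ((hw k j).smul continuous_const)
  · filter_upwards [hfin] with t ht
    rw [ofModes, dif_pos ht, synth]
    refine tendsto_finsetSum _ fun j _ => ?_
    exact (hasSum_synthC ⟨fun k => w t k j, memℓp_of_sob ht j⟩).mapL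
      ((reCoord j).compLpL 2 volume)

lemma integrable_coord (f : L2) (j : Fin 3) : Integrable (fun x => ((f x j : ℝ) : ℂ)) volume :=
  ((Lp.memLp (compC j f)).integrable (by norm_num)).congr (compC_ae j f)

/-! ### Weak derivatives -/

/-- A real-linear functional on `ℂ` applied to the product of a real and a complex number. -/
lemma map_ofReal_mul (L : ℂ →L[ℝ] ℝ) (a : ℝ) (z : ℂ) : L ((a : ℂ) * z) = a * L z := by
  rw [← Complex.real_smul, map_smul, smul_eq_mul]

lemma eq_of_re_im {z w : ℂ} (h : ∀ L : ℂ →L[ℝ] ℝ, L z = L w) : z = w :=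
  Complex.ext (h Complex.reCLM) (h Complex.imCLM)

lemma integrable_smul_of_continuous {ψ : T3 → ℝ} (hψ : Continuous ψ) (f : L2) :
    Integrable (fun x => ψ x • f x) volume := by
  obtain ⟨C, hC⟩ := isCompact_univ.exists_bound_of_continuousOn hψ.continuousOn
  exact ((Lp.memLp f).integrable (by norm_num)).bdd_smul C hψ.aestronglyMeasurable
    (.of_forall fun x => hC x (mem_univ x))

lemma integrable_mul_of_continuous {ψ h : T3 → ℂ} (hψ : Continuous ψ) (hh : Integrable h volume) :
    Integrable (fun x => ψ x * h x) volume := by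
  obtain ⟨C, hC⟩ := isCompact_univ.exists_bound_of_continuousOn hψ.continuousOn
  exact hh.bdd_mul hψ.aestronglyMeasurable (.of_forall fun x => hC x (mem_univ x))

lemma integral_smul_coord {ψ : T3 → ℝ} (hψ : Continuous ψ) (f : L2) (j : Fin 3) :
    (((∫ x, ψ x • f x) j : ℝ) : ℂ) = ∫ x, ((ψ x : ℝ) : ℂ) * ((f x j : ℝ) : ℂ) := by
  have h := (coordC j).integral_comp_comm (integrable_smul_of_continuous hψ f)
  rw [← coordC_apply, ← h]
  refine integral_congr_ae (.of_forall fun x => ?_)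
  simp [coordC_apply]

lemma SmoothT3.pd {F : Type*} [NormedAddCommGroup F] [NormedSpace ℝ F] {f : T3 → F}
    (h : SmoothT3 f) (i : Fin 3) : SmoothT3 (pd i f) := (h.smoothST.pd i).smoothT3 0

lemma SmoothT3.clm {F G : Type*} [NormedAddCommGroup F] [NormedSpace ℝ F] [NormedAddCommGroup G]
    [NormedSpace ℝ G] {f : T3 → F} (L : F →L[ℝ] G) (h : SmoothT3 f) : SmoothT3 fun x => L (f x) :=
  L.contDiff.comp h

lemma SmoothT3.pd_clm {F G : Type*} [NormedAddCommGroup F] [NormedSpace ℝ F] [NormedAddCommGroup G]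
    [NormedSpace ℝ G] {f : T3 → F} (L : F →L[ℝ] G) (h : SmoothT3 f) (i : Fin 3) (x : T3) :
    Magnetization.pd i (fun x => L (f x)) x = L (Magnetization.pd i f x) :=
  h.smoothST.pd_clm L i 0 x

/-- The Fourier coefficients of a weak derivative. -/
theorem IsWeakPD.fourierCoef_eq {i : Fin 3} {f g : L2} (h : IsWeakPD i f g) (k : Freq) (j : Fin 3) :
    fourierCoef g k j = Complex.I * k i * fourierCoef f k j := by
  have hs := smoothT3_expo (-k)
  have key : ∫ x, pd i (expo (-k)) x * ((f x j : ℝ) : ℂ)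
      = -∫ x, expo (-k) x * ((g x j : ℝ) : ℂ) := by
    -- Weak derivatives are tested with real functions only, so the exponential is tested through an
    -- arbitrary real functional `L`, which covers its real and imaginary parts.
    refine eq_of_re_im fun L => ?_
    have h1 := congrArg (fun v : E3 => v j) (h (fun x => L (expo (-k) x)) (hs.clm L))
    have e1 := integral_smul_coord ((hs.clm L).pd i).continuous f j
    have e2 := integral_smul_coord (hs.clm L).continuous g j
    simp only [PiLp.neg_apply] at h1
    have h2 := congrArg (fun r : ℝ => (r : ℂ)) h1
    simp only [Complex.ofReal_neg] at h2
    rw [e1, e2] at h2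
    simp only [hs.pd_clm, ← Complex.ofReal_mul, integral_complex_ofReal] at h2
    have hi1 : Integrable (fun x => pd i (expo (-k)) x * ((f x j : ℝ) : ℂ)) volume :=
      integrable_mul_of_continuous (hs.pd i).continuous (integrable_coord f j)
    have hi2 : Integrable (fun x => expo (-k) x * ((g x j : ℝ) : ℂ)) volume :=
      integrable_mul_of_continuous hs.continuous (integrable_coord g j)
    rw [map_neg, ← L.integral_comp_comm hi1, ← L.integral_comp_comm hi2]
    have h3 : ∫ x, L (pd i (expo (-k)) x) * f x j = -∫ x, L (expo (-k) x) * g x j := by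
      exact_mod_cast h2
    simpa only [mul_comm _ ((_ : ℝ) : ℂ), map_ofReal_mul, mul_comm (L _)] using h3
  simp only [pd_expo, mul_assoc, integral_const_mul, Pi.neg_apply, Int.cast_neg] at key
  rw [fourierCoef_eq_coef, fourierCoef_eq_coef]
  unfold coef
  linear_combination (vol : ℂ)⁻¹ * key

/-- Both sides are expanded in Fourier series against `ψ`. The minus sign of integration by parts
arises because `ψ` at frequency `k` meets `g` at frequency `-k`. -/
theorem isWeakPD_of_fourierCoef {i : Fin 3} {f g : L2}
    (h : ∀ k j, fourierCoef g k j = Complex.I * k i * fourierCoef f k j) : IsWeakPD i f g := by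
  intro ψ hψ
  have hψc : SmoothT3 fun x => (ψ x : ℂ) := hψ.clm Complex.ofRealCLM
  have hp : ∀ x, ((pd i ψ x : ℝ) : ℂ) = pd i (fun x => (ψ x : ℂ)) x := fun x =>
    (hψ.pd_clm Complex.ofRealCLM i x).symm
  ext j
  have e1 := integral_smul_coord (hψ.pd i).continuous f j
  have e2 := integral_smul_coord hψ.continuous g j
  simp only [hp] at e1
  have s1 := (hψc.pd i).hasSum_integral_mul (integrable_coord f j)
  have s2 := (hψc.hasSum_integral_mul (integrable_coord g j)).neg
  simp only [coef_pd hψc, ← fourierCoef_eq_coef, h] at s1 s2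
  have : (((∫ x, pd i ψ x • f x) j : ℝ) : ℂ) = -(((∫ x, ψ x • g x) j : ℝ) : ℂ) := by
    rw [e1, e2]
    refine s1.unique ?_
    convert! s2 using 1
    ext1 k
    simp only [Pi.neg_apply, Int.cast_neg]; ring
  rw [PiLp.neg_apply]
  exact_mod_cast this

/-- For a field in `H¹` the sequence `i kᵢ f̂ₖ` is square summable and Hermitian, so a weak
derivative exists and the default value `0` of `wpd` is not taken. -/
theorem isWeakPD_wpd {f : L2} (h : sob 2 (modes f) ≠ ⊤) (i : Fin 3) : IsWeakPD i f (wpd i f) := by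
  have hex : ∃ g, IsWeakPD i f g := by
    set a : Modes := fun k j => Complex.I * k i * fourierCoef f k j with ha
    have ha0 : sob 0 a ≠ ⊤ := by
      refine ne_top_of_le_ne_top h (ENNReal.tsum_le_tsum fun k => ?_)
      rw [pow_zero, one_mul, Finset.mul_sum]
      refine Finset.sum_le_sum fun j _ => ?_
      rw [ha, enorm_mul, mul_pow]
      gcongr
      · exact enorm_I_mul_intCast_le k i
      · rfl
    refine ⟨ofModes a, isWeakPD_of_fourierCoef fun k j => ?_⟩
    rw [fourierCoef_ofModes ha0, ha]
    simp only [Pi.neg_apply, Int.cast_neg, fourierCoef_neg, map_mul, Complex.conj_conj, map_neg,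
      Complex.conj_I, map_intCast]
    ring
  rw [wpd, dif_pos hex]
  exact hex.choose_spec

theorem fourierCoef_wpd {f : L2} (h : sob 2 (modes f) ≠ ⊤) (i : Fin 3) (k : Freq) (j : Fin 3) :
    fourierCoef (wpd i f) k j = Complex.I * k i * fourierCoef f k j :=
  (isWeakPD_wpd h i).fourierCoef_eq k j

/-! ### Divergence-free fields -/

lemma continuous_grad {ψ : T3 → ℝ} (hψ : SmoothT3 ψ) : Continuous (grad ψ) :=
  (PiLp.continuous_toLp 2 _).comp (continuous_pi fun i => (hψ.pd i).continuous)

/-- A weakly divergence-free field has transversal Fourier coefficients. -/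
theorem sum_mul_fourierCoef_of_mem_solenoidal {v : L2} (hv : v ∈ solenoidal) (k : Freq) :
    ∑ j, (k j : ℂ) * fourierCoef v k j = 0 := by
  have hs := smoothT3_expo (-k)
  have hint : ∀ j, Integrable (fun x => pd j (expo (-k)) x * ((v x j : ℝ) : ℂ)) volume := fun j =>
    integrable_mul_of_continuous (hs.pd j).continuous (integrable_coord v j)
  have key : ∑ j, ∫ x, pd j (expo (-k)) x * ((v x j : ℝ) : ℂ) = 0 := by
    rw [← integral_finsetSum _ fun j _ => hint j]
    refine eq_of_re_im fun L => ?_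
    have hψ := hs.clm L
    set g : L2 := ContinuousMap.toLp (E := E3) 2 volume ℝ ⟨grad _, continuous_grad hψ⟩
    have hg : g =ᵐ[volume] grad fun x => L (expo (-k) x) := ContinuousMap.coeFn_toLp _ _
    have h0 := (Submodule.mem_orthogonal _ _).mp hv g
      (Submodule.subset_span ⟨_, hψ, hg⟩)
    rw [MeasureTheory.L2.inner_def] at h0
    rw [map_zero, ← L.integral_comp_comm (integrable_finsetSum _ fun j _ => hint j), ← h0]
    refine integral_congr_ae ?_
    filter_upwards [hg] with x hx
    rw [hx, PiLp.inner_apply, map_sum]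
    refine Finset.sum_congr rfl fun j _ => ?_
    rw [mul_comm, map_ofReal_mul]
    simp [grad, hs.pd_clm]
  simp only [pd_expo, mul_assoc, integral_const_mul, Pi.neg_apply, Int.cast_neg] at key
  simp only [fourierCoef_eq_coef, coef]
  have h2 : ∑ j, (k j : ℂ) * ((vol : ℂ)⁻¹ * ∫ x, expo (-k) x * ((v x j : ℝ) : ℂ))
      = Complex.I * (vol : ℂ)⁻¹ * ∑ j, Complex.I * (-(k j : ℂ) *
        ∫ x, expo (-k) x * ((v x j : ℝ) : ℂ)) := by
    rw [Finset.mul_sum]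
    refine Finset.sum_congr rfl fun j _ => ?_
    linear_combination (-(k j : ℂ) * ((vol : ℂ)⁻¹ * ∫ x, expo (-k) x * ((v x j : ℝ) : ℂ))) *
      (-Complex.I_mul_I)
  rw [h2, key, mul_zero]

theorem inner_eq_zero_of_fourierCoef {f g : L2}
    (h : ∀ k, ∑ j, fourierCoef f k j * conj (fourierCoef g k j) = 0) : inner ℝ f g = 0 := by
  have h1 := hasSum_inner_fourierCoef f g
  simp only [h] at h1
  have h2 := h1.unique hasSum_zero
  rw [mul_eq_zero, inv_eq_zero] at h2
  exact_mod_cast h2.resolve_left vol_ne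

/-- The coefficients of a gradient are parallel to `k`, so the inner product vanishes mode by mode;
linearity extends this to the span. -/
theorem mem_solenoidal_of_fourierCoef {v : L2}
    (hv : ∀ k, ∑ j, (k j : ℂ) * fourierCoef v k j = 0) : v ∈ solenoidal := by
  refine (Submodule.mem_orthogonal _ _).mpr fun g hg => ?_
  induction hg using Submodule.span_induction with
  | mem g hg =>
    obtain ⟨ψ, hψ, hg⟩ := hg
    refine inner_eq_zero_of_fourierCoef fun k => ?_
    have hψc : SmoothT3 fun x => (ψ x : ℂ) := hψ.clm Complex.ofRealCLM
    have h1 : ∀ j, fourierCoef g k j = Complex.I * k j * coef (fun x => (ψ x : ℂ)) k := by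
      intro j
      rw [fourierCoef_eq_coef, ← coef_pd hψc]
      refine coef_congr_ae ?_ k
      filter_upwards [hg] with x hx
      rw [hx]
      exact (hψ.pd_clm Complex.ofRealCLM j x).symm
    have h2 : ∑ j, fourierCoef g k j * conj (fourierCoef v k j)
        = Complex.I * coef (fun x => (ψ x : ℂ)) k * conj (∑ j, (k j : ℂ) * fourierCoef v k j) := by
      rw [map_sum, Finset.mul_sum]
      refine Finset.sum_congr rfl fun j _ => ?_
      rw [h1, map_mul, map_intCast]; ring
    rw [h2, hv, map_zero, mul_zero]
  | zero => exact inner_zero_left _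
  | add x y _ _ hx hy => rw [inner_add_left, hx, hy, add_zero]
  | smul c x _ hx => rw [inner_smul_left, hx, mul_zero]

end Magnetization
end

noncomputable section
namespace Magnetization
open scoped ComplexConjugate ENNReal

/-! ### Fourier coefficients of the nonlinear terms -/

lemma memLp_coord (f : L2) (j : Fin 3) : MemLp (fun x => f x j) 2 volume :=
  (EuclideanSpace.proj (𝕜 := ℝ) j).comp_memLp' (Lp.memLp f)

lemma integrable_mul_coord (f g : L2) (j i : Fin 3) :
    Integrable (fun x => ((f x j * g x i : ℝ) : ℂ)) volume :=
  ((memLp_coord f j).integrable_mul (memLp_coord g i)).ofReal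

lemma advect_apply (u w : L2) (x : T3) (i : Fin 3) :
    advect u w x i = ∑ j, u x j * wpd j w x i := by
  simp [advect]

lemma gradTranspose_apply (u w : L2) (x : T3) (i : Fin 3) :
    gradTranspose u w x i = ∑ j, wpd i u x j * w x j := rfl

lemma integrable_advect (u w : L2) (i : Fin 3) :
    Integrable (fun x => ((advect u w x i : ℝ) : ℂ)) volume := by
  simp only [advect_apply, Complex.ofReal_sum]
  exact integrable_finsetSum _ fun j _ => integrable_mul_coord u (wpd j w) j i

lemma integrable_gradTranspose (u w : L2) (i : Fin 3) :
    Integrable (fun x => ((gradTranspose u w x i : ℝ) : ℂ)) volume := by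
  simp only [gradTranspose_apply, Complex.ofReal_sum]
  exact integrable_finsetSum _ fun j _ => integrable_mul_coord (wpd i u) w j j

theorem coef_advect (u : L2) {w : L2} (hw : sob 2 (modes w) ≠ ⊤) (i : Fin 3) (m : Freq) :
    coef (fun x => ((advect u w x i : ℝ) : ℂ)) m = transport (modes u) (modes w) m i := by
  simp only [advect_apply, Complex.ofReal_sum]
  rw [coef_finsetSum _ fun j _ => integrable_mul_coord u (wpd j w) j i]
  have h := hasSum_sum (s := Finset.univ)
    fun j _ => hasSum_fourierCoef_convolution u (wpd j w) j i m
  rw [← h.tsum_eq]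
  simp only [fourierCoef_wpd hw]
  rfl

theorem coef_gradTranspose {u : L2} (hu : sob 2 (modes u) ≠ ⊤) (w : L2) (i : Fin 3) (m : Freq) :
    coef (fun x => ((gradTranspose u w x i : ℝ) : ℂ)) m = stretch (modes u) (modes w) m i := by
  simp only [gradTranspose_apply, Complex.ofReal_sum]
  rw [coef_finsetSum _ fun j _ => integrable_mul_coord (wpd i u) w j j]
  have h := hasSum_sum (s := Finset.univ)
    fun j _ => hasSum_fourierCoef_convolution (wpd i u) w j j m
  rw [← h.tsum_eq]
  simp only [fourierCoef_wpd hu]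
  rfl

theorem coef_advect_add_gradTranspose {u w : L2} (hu : sob 2 (modes u) ≠ ⊤)
    (hw : sob 2 (modes w) ≠ ⊤) (i : Fin 3) (m : Freq) :
    coef (fun x => (((advect u w x + gradTranspose u w x) i : ℝ) : ℂ)) m
      = bil (modes u) (modes w) m i := by
  simp only [PiLp.add_apply, Complex.ofReal_add]
  rw [coef_add (integrable_advect u w i) (integrable_gradTranspose u w i), coef_advect u hw,
    coef_gradTranspose hu]
  rfl

/-! ### Pairings with smooth fields -/

lemma pairing_eq (h φ : T3 → E3) : pairing h φ = ∫ x, ∑ j, φ x j * h x j := by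
  simp [pairing, PiLp.inner_apply]

theorem hasSum_pairing {h φ : T3 → E3} (hh : ∀ j, Integrable (fun x => ((h x j : ℝ) : ℂ)) volume)
    (hφ : SmoothT3 φ) :
    HasSum (fun k => (vol : ℂ) * ∑ j, coef (fun x => ((φ x j : ℝ) : ℂ)) k *
      coef (fun x => ((h x j : ℝ) : ℂ)) (-k)) (pairing h φ : ℂ) := by
  have hs : ∀ j, SmoothT3 fun x => ((φ x j : ℝ) : ℂ) := fun j =>
    hφ.clm (Complex.ofRealCLM.comp (EuclideanSpace.proj j))
  have h1 := hasSum_sum (s := Finset.univ) fun j _ => (hs j).hasSum_integral_mul (hh j)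
  rw [← integral_finsetSum _ fun j _ => integrable_mul_of_continuous (hs j).continuous (hh j)] at h1
  rw [pairing_eq, ← integral_complex_ofReal]
  simp only [Complex.ofReal_sum, Complex.ofReal_mul, Finset.mul_sum]
  exact h1

/-- The vector field `Re (c e^{-im·x})`. -/
def trig (m : Freq) (c : Fin 3 → ℂ) (x : T3) : E3 :=
  WithLp.toLp 2 fun j => (c j * expo (-m) x).re

/-- The functional `z ↦ Re (c z)`. -/
def reMul (c : ℂ) : ℂ →L[ℝ] ℝ := Complex.reCLM.comp (ContinuousLinearMap.mul ℝ ℂ c)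

lemma reMul_apply (c z : ℂ) : reMul c z = (c * z).re := rfl

lemma smoothT3_trig (m : Freq) (c : Fin 3 → ℂ) : SmoothT3 (trig m c) := by
  unfold SmoothT3
  rw [contDiff_euclidean]
  exact fun j => (smoothT3_expo (-m)).clm (reMul (c j))

lemma pd_trig (m : Freq) (c : Fin 3 → ℂ) (i : Fin 3) :
    pd i (trig m c) = trig m fun j => -(Complex.I * m i) * c j := by
  ext x j
  have h1 := (smoothT3_trig m c).pd_clm (EuclideanSpace.proj j) i x
  have h2 := (smoothT3_expo (-m)).pd_clm (reMul (c j)) i x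
  rw [pd_expo, reMul_apply] at h2
  change pd i (fun x => (c j * expo (-m) x).re) x = pd i (trig m c) x j at h1
  change pd i (fun x => (c j * expo (-m) x).re) x = _ at h2
  rw [← h1, h2]
  simp only [trig, Pi.neg_apply, Int.cast_neg]
  congr 1
  ring

lemma divergence_trig (m : Freq) (c : Fin 3 → ℂ) (hc : ∑ j, (m j : ℂ) * c j = 0) (x : T3) :
    divergence (trig m c) x = 0 := by
  have : divergence (trig m c) x
      = (-Complex.I * expo (-m) x * ∑ j, (m j : ℂ) * c j).re := by
    rw [divergence, Finset.mul_sum, Complex.re_sum]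
    refine Finset.sum_congr rfl fun j _ => ?_
    rw [pd_trig]
    simp only [trig]
    congr 1
    ring
  rw [this, hc, mul_zero, Complex.zero_re]

/-- A real trigonometric field reads off the `m`-th coefficients. Letting `c` vary over complex
vectors recovers them completely from real pairings. -/
theorem pairing_trig {h : T3 → E3} (hh : ∀ j, Integrable (fun x => ((h x j : ℝ) : ℂ)) volume)
    (m : Freq) (c : Fin 3 → ℂ) :
    pairing h (trig m c) = vol * (∑ j, c j * coef (fun x => ((h x j : ℝ) : ℂ)) m).re := by
  have hi : ∀ j, Integrable (fun x => expo (-m) x * ((h x j : ℝ) : ℂ)) volume := fun j =>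
    integrable_expo_mul (hh j) _
  have h1 : ∀ x j, trig m c x j * h x j = reMul (c j) (expo (-m) x * ((h x j : ℝ) : ℂ)) := by
    intro x j
    rw [mul_comm (expo (-m) x), map_ofReal_mul, mul_comm]
    rfl
  simp only [pairing_eq, h1]
  rw [integral_finsetSum _ fun j _ => (reMul (c j)).integrable_comp (hi j), Complex.re_sum,
    Finset.mul_sum]
  refine Finset.sum_congr rfl fun j _ => ?_
  rw [(reMul (c j)).integral_comp_comm (hi j), reMul_apply, coef, ← Complex.re_ofReal_mul]
  congr 1
  have := vol_ne
  field_simp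

theorem gradPairing_trig {w : L2} (hw : sob 2 (modes w) ≠ ⊤) (m : Freq) (c : Fin 3 → ℂ) :
    gradPairing w (trig m c) = vol * (∑ j, c j * (freqSq m * modes w m j)).re := by
  have h1 : ∀ i, pairing (wpd i w) (pd i (trig m c))
      = vol * (∑ j, c j * ((m i : ℂ) ^ 2 * modes w m j)).re := by
    intro i
    rw [pd_trig, pairing_trig (integrable_coord _)]
    congr 2
    refine Finset.sum_congr rfl fun j _ => ?_
    rw [← fourierCoef_eq_coef, fourierCoef_wpd hw]
    change -(Complex.I * m i) * c j * (Complex.I * m i * modes w m j) = _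
    linear_combination (-(m i : ℂ) ^ 2 * c j * modes w m j) * Complex.I_mul_I
  rw [gradPairing, Finset.sum_congr rfl fun i _ => h1 i, ← Finset.mul_sum, ← Complex.re_sum,
    Finset.sum_comm]
  congr 3
  ext j
  rw [← Finset.mul_sum, ← Finset.sum_mul, freqSq]
  push_cast
  rfl

end Magnetization
end

noncomputable section
namespace Magnetization
open scoped ComplexConjugate ENNReal

/-! ### Regularity classes in terms of Fourier coefficients -/

/-- The Fourier-side version of `L^∞(0, T; H^{1/2}) ∩ L²(0, T; H^{3/2})`. -/
structure Regular (T : ℝ) (v : ℝ → Modes) : Prop where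
  aemeasurable : ∀ k j, AEMeasurable (fun t => v t k j) (volume.restrict (Ioc 0 T))
  sob_one_le : ∃ M : ℝ≥0∞, M ≠ ⊤ ∧ ∀ᵐ s ∂(volume.restrict (Ioc 0 T)), sob 1 (v s) ≤ M
  lintegral_sob_three : ∫⁻ s in Ioc 0 T, sob 3 (v s) ≠ ⊤

lemma measurable_sob {v : ℝ → Modes} (hv : ∀ k j, Measurable fun t => v t k j) (n : ℕ) :
    Measurable fun t => sob n (v t) :=
  Measurable.tsum fun k => measurable_const.mul
    (Finset.measurable_fun_sum _ fun j _ => (hv k j).enorm.pow_const 2)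

/-- Interpolation of `H¹` between `H^{1/2}` and `H^{3/2}`: Cauchy–Schwarz with `(1 + |k|)² = (1 +
|k|)^{1/2} (1 + |k|)^{3/2}`. -/
lemma sob_two_sq_le (w : Modes) : sob 2 w ^ 2 ≤ sob 1 w * sob 3 w := by
  have h := tsum_mul_sq_le (fun p : Freq × Fin 3 => (ewt p.1 ^ (1 / 2 : ℝ) * ‖w p.1 p.2‖ₑ))
    (fun p => ewt p.1 ^ (3 / 2 : ℝ) * ‖w p.1 p.2‖ₑ)
  have e : ∀ (n : ℕ) (f : Freq × Fin 3 → ℝ≥0∞), (∀ p, f p = ewt p.1 ^ n * ‖w p.1 p.2‖ₑ ^ 2) →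
      ∑' p, f p = sob n w := by
    intro n f hf
    rw [ENNReal.tsum_prod', sob]
    refine tsum_congr fun k => ?_
    rw [tsum_fintype, Finset.mul_sum]
    exact Finset.sum_congr rfl fun j _ => hf _
  have r : ∀ (k : Freq) (a : ℝ) (n : ℕ), a * 2 = n → (ewt k ^ a) ^ 2 = ewt k ^ n := by
    intro k a n h
    rw [← ENNReal.rpow_natCast, ← ENNReal.rpow_mul]
    push_cast
    rw [h, ENNReal.rpow_natCast]
  rw [e 2, e 1, e 3] at h
  · exact h
  · intro p; rw [mul_pow, r _ _ 3 (by norm_num)]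
  · intro p; rw [mul_pow, r _ _ 1 (by norm_num)]
  · intro p
    rw [mul_mul_mul_comm, ← ENNReal.rpow_add _ _ (ewt_ne_zero _) (ewt_ne_top _), ← sq]
    norm_num

lemma sob_sub_le (n : ℕ) (a b : Modes) : sob n (a - b) ≤ 2 * sob n a + 2 * sob n b := by
  simp only [sob]
  rw [← ENNReal.tsum_mul_left, ← ENNReal.tsum_mul_left, ← ENNReal.tsum_add]
  refine ENNReal.tsum_le_tsum fun k => ?_
  rw [mul_left_comm, mul_left_comm 2, ← mul_add]
  gcongr
  rw [Finset.mul_sum, Finset.mul_sum, ← Finset.sum_add_distrib]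
  refine Finset.sum_le_sum fun j _ => ?_
  refine le_trans ?_ (add_sq_le_two_mul _ _)
  gcongr
  exact enorm_sub_le

namespace Regular

variable {T : ℝ} {u v : ℝ → Modes}

lemma exists_measurable (hv : Regular T v) : ∃ v' : ℝ → Modes,
    (∀ k j, Measurable fun t => v' t k j) ∧ v' =ᵐ[volume.restrict (Ioc 0 T)] v := by
  refine ⟨fun t k j => (hv.aemeasurable k j).mk _ t, fun k j => (hv.aemeasurable k j).measurable_mk,
    ?_⟩
  have := ae_all_iff.mpr fun k => ae_all_iff.mpr fun j => (hv.aemeasurable k j).ae_eq_mk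
  filter_upwards [this] with t ht
  ext k j
  exact (ht k j).symm

lemma aemeasurable_sob (hv : Regular T v) (n : ℕ) :
    AEMeasurable (fun t => sob n (v t)) (volume.restrict (Ioc 0 T)) := by
  obtain ⟨v', hm, he⟩ := hv.exists_measurable
  refine (measurable_sob hm n).aemeasurable.congr ?_
  filter_upwards [he] with t ht
  rw [ht]

/-- `L^∞ H^{1/2} ∩ L² H^{3/2} ⊆ L⁴ H¹`; `sob 2` is already a squared norm, so its square is the
fourth power. -/
lemma lintegral_sob_two_sq (hv : Regular T v) : ∫⁻ s in Ioc 0 T, sob 2 (v s) ^ 2 ≠ ⊤ := by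
  obtain ⟨M, hM, hle⟩ := hv.sob_one_le
  have h1 : ∫⁻ s in Ioc 0 T, sob 2 (v s) ^ 2 ≤ M * ∫⁻ s in Ioc 0 T, sob 3 (v s) := by
    rw [← lintegral_const_mul' _ _ hM]
    refine lintegral_mono_ae ?_
    filter_upwards [hle] with s hs
    exact (sob_two_sq_le _).trans (mul_le_mul_left hs _)
  exact ne_top_of_le_ne_top (ENNReal.mul_ne_top hM hv.lintegral_sob_three) h1

lemma sob_two_ne_top (hv : Regular T v) :
    ∀ᵐ s ∂(volume.restrict (Ioc 0 T)), sob 2 (v s) ≠ ⊤ := by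
  filter_upwards [ae_lt_top' ((hv.aemeasurable_sob 2).pow_const 2) hv.lintegral_sob_two_sq] with s hs
  exact ne_top_of_sq_le le_rfl hs.ne

lemma lintegral_sob_mul (hu : Regular T u) (hv : Regular T v) :
    ∫⁻ s in Ioc 0 T, sob 2 (u s) * sob 2 (v s) ≠ ⊤ := by
  have h1 : ∫⁻ s in Ioc 0 T, sob 2 (u s) * sob 2 (v s)
      ≤ ∫⁻ s in Ioc 0 T, (sob 2 (u s) ^ 2 + sob 2 (v s) ^ 2) := by
    refine lintegral_mono fun s => ?_
    rcases le_total (sob 2 (u s)) (sob 2 (v s)) with h | h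
    · exact (mul_le_mul_left h _).trans (by rw [← sq]; exact le_add_self)
    · exact (mul_le_mul_right h _).trans (by rw [← sq]; exact le_self_add)
  rw [lintegral_add_left' ((hu.aemeasurable_sob 2).pow_const 2)] at h1
  exact ne_top_of_le_ne_top
    (ENNReal.add_ne_top.mpr ⟨hu.lintegral_sob_two_sq, hv.lintegral_sob_two_sq⟩) h1

/-- Take `g = 1 + ‖u‖⁴_{H¹}` on `(0, T]` and `1` elsewhere, after replacing the norm by a measurable
version. -/
theorem exists_dominates (hv : Regular T v) : ∃ g, Dominates T g v := by
  have hm := (hv.aemeasurable_sob 2).pow_const 2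
  set h := hm.mk _ with hh
  have hmeas : Measurable h := hm.measurable_mk
  have hae := hm.ae_eq_mk
  have hlt : ∫⁻ s in Ioc 0 T, h s ≠ ⊤ := by
    rw [← lintegral_congr_ae hae]
    exact hv.lintegral_sob_two_sq
  refine ⟨fun t => 1 + (Ioc 0 T).indicator (fun s => (h s).toReal) t, fun t => ?_, ?_, ?_, ?_⟩
  · exact le_add_of_nonneg_right (indicator_nonneg (fun _ _ => ENNReal.toReal_nonneg) _)
  · exact measurable_const.add (hmeas.ennreal_toReal.indicator measurableSet_Ioc)
  · intro a b
    refine intervalIntegrable_const.add (Integrable.intervalIntegrable ?_)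
    rw [integrable_indicator_iff measurableSet_Ioc]
    exact integrable_toReal_of_lintegral_ne_top hmeas.aemeasurable hlt
  · filter_upwards [hae, ae_lt_top' hmeas.aemeasurable hlt, ae_restrict_mem measurableSet_Ioc]
      with s h1 h2 hs
    rw [indicator_of_mem hs]
    change sob 2 (v s) ^ 2 = h s at h1
    rw [h1]
    refine (ENNReal.ofReal_toReal h2.ne).symm.le.trans (ENNReal.ofReal_le_ofReal ?_)
    linarith

lemma mono (hv : Regular T v) {τ : ℝ} (h : τ ≤ T) : Regular τ v := by
  have hsub : Ioc 0 τ ⊆ Ioc 0 T := Ioc_subset_Ioc_right h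
  refine ⟨fun k j => (hv.aemeasurable k j).mono_measure (Measure.restrict_mono hsub le_rfl), ?_,
    ne_top_of_le_ne_top hv.lintegral_sob_three (lintegral_mono_set hsub)⟩
  obtain ⟨M, hM, hle⟩ := hv.sob_one_le
  exact ⟨M, hM, ae_restrict_of_ae_restrict_of_subset hsub hle⟩

lemma enorm_sq_le_sob (w : Modes) (n : ℕ) (k : Freq) (j : Fin 3) : ‖w k j‖ₑ ^ 2 ≤ sob n w := by
  calc ‖w k j‖ₑ ^ 2 ≤ ewt k ^ 0 * ∑ j, ‖w k j‖ₑ ^ 2 := by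
        rw [pow_zero, one_mul]
        exact Finset.single_le_sum (f := fun j => ‖w k j‖ₑ ^ 2) (fun _ _ => zero_le)
          (Finset.mem_univ j)
    _ ≤ sob 0 w := ENNReal.le_tsum (f := fun k => ewt k ^ 0 * ∑ j, ‖w k j‖ₑ ^ 2) k
    _ ≤ _ := sob_mono (Nat.zero_le n) w

lemma integrableOn_modes (hv : Regular T v) (k : Freq) (j : Fin 3) :
    IntegrableOn (fun s => v s k j) (Ioc 0 T) volume := by
  refine integrableOn_of_sq_le (B := fun s => sob 3 (v s)) (hv.aemeasurable k j).aestronglyMeasurable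
    (fun s => (enorm_sq_le_sob (v s) 3 k j).trans ?_) hv.lintegral_sob_three
  exact le_mul_of_one_le_left zero_le (by norm_num)

lemma aestronglyMeasurable_bil (hu : Regular T u) (hv : Regular T v) (k : Freq) (j : Fin 3) :
    AEStronglyMeasurable (fun s => bil (u s) (v s) k j) (volume.restrict (Ioc 0 T)) := by
  obtain ⟨u', hum, hue⟩ := hu.exists_measurable
  obtain ⟨v', hvm, hve⟩ := hv.exists_measurable
  refine (measurable_bil hum hvm k j).aestronglyMeasurable.congr ?_
  filter_upwards [hue, hve] with s h1 h2
  rw [h1, h2]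

lemma integrableOn_bil (hu : Regular T u) (hv : Regular T v) (k : Freq) (j : Fin 3) :
    IntegrableOn (fun s => bil (u s) (v s) k j) (Ioc 0 T) volume :=
  integrableOn_of_sq_le (hu.aestronglyMeasurable_bil hv k j)
    (fun _ => enorm_bil_sq_le _ _ k j) (hu.lintegral_sob_mul hv)

lemma sub (hu : Regular T u) (hv : Regular T v) : Regular T (fun s => u s - v s) := by
  refine ⟨fun k j => (hu.aemeasurable k j).sub (hv.aemeasurable k j), ?_, ?_⟩
  · obtain ⟨M, hM, h1⟩ := hu.sob_one_le
    obtain ⟨N, hN, h2⟩ := hv.sob_one_le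
    refine ⟨2 * M + 2 * N, by finiteness, ?_⟩
    filter_upwards [h1, h2] with s h1 h2
    refine (sob_sub_le 1 _ _).trans ?_
    gcongr
  · refine ne_top_of_le_ne_top ?_ (lintegral_mono fun s => sob_sub_le 3 _ _)
    rw [lintegral_add_left' ((hu.aemeasurable_sob 3).const_mul 2),
      lintegral_const_mul' _ _ (by simp), lintegral_const_mul' _ _ (by simp)]
    have := hu.lintegral_sob_three
    have := hv.lintegral_sob_three
    finiteness

lemma wnorm_ne_top (hv : Regular T v) (hT : 0 ≤ T) {g : ℝ → ℝ} (hg : Dominates T g u) :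
    wnorm g T v ≠ ⊤ := by
  obtain ⟨M, hM, hle⟩ := hv.sob_one_le
  exact Magnetization.wnorm_ne_top hT hg hM hle hv.lintegral_sob_three

end Regular

theorem regular_modes {T : ℝ} {u : ℝ → L2} (h1 : MemLinftyHs T (1 / 2) u)
    (h2 : MemL2Hs T (3 / 2) u) : Regular T fun t => modes (u t) := by
  have hμ : (volume.restrict (Ioo 0 T) : Measure ℝ) = volume.restrict (Ioc 0 T) :=
    Measure.restrict_congr_set Ioo_ae_eq_Ioc
  obtain ⟨hm, C, hC, hle⟩ := h1
  rw [hμ] at hm hle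
  refine ⟨fun k j => ?_, ⟨C, hC.ne, ?_⟩, ?_⟩
  · have := (fourierCoefL k j).continuous.comp_aestronglyMeasurable hm
    simp only [fourierCoefL_apply] at this
    exact this.aemeasurable
  · filter_upwards [hle] with s hs
    rwa [sob_one_modes]
  · have h3 := h2.2
    rw [hμ] at h3
    refine ne_top_of_le_ne_top ?_ (lintegral_mono fun s => sob_three_modes_le (u s))
    rw [lintegral_const_mul' _ _ (by simp)]
    finiteness

end Magnetization
end

noncomputable section
namespace Magnetization
open scoped ComplexConjugate ENNReal

/-! ### From the weak formulation to Fourier coefficients -/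

/-- A smooth function that is `1` on `(-∞, a]` and `0` on `[b, ∞)`. -/
def cutoff (a b s : ℝ) : ℝ := Real.smoothTransition ((b - s) / (b - a))

lemma cutoff_eq_one {a b s : ℝ} (hab : a < b) (hs : s ≤ a) : cutoff a b s = 1 :=
  Real.smoothTransition.one_of_one_le ((one_le_div (by linarith)).mpr (by linarith))

lemma cutoff_eq_zero {a b s : ℝ} (hab : a < b) (hs : b ≤ s) : cutoff a b s = 0 :=
  Real.smoothTransition.zero_of_nonpos (div_nonpos_of_nonpos_of_nonneg (by linarith) (by linarith))

/-- Makes a steady field admissible. When the cutoff starts to decrease after the time considered,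
the term with the time derivative drops out. -/
lemma isTestField_cutoff {T a b : ℝ} (hab : a < b) (hb : b < T) {τ : T3 → E3} (hτ : SmoothT3 τ) :
    IsTestField T fun s x => cutoff a b s • τ x := by
  refine ⟨?_, b, hb, fun t ht x => by
    beta_reduce
    rw [cutoff_eq_zero hab ht, zero_smul]⟩
  have h1 : ContDiff ℝ ⊤ (fun p : ℝ × (Fin 3 → ℝ) => (b - p.1) / (b - a)) := by fun_prop
  have h2 : ContDiff ℝ (⊤ : ℕ∞) (fun p : ℝ × (Fin 3 → ℝ) => cutoff a b p.1) :=
    Real.smoothTransition.contDiff.comp (h1.of_le le_top)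
  exact h2.smul (ContDiff.comp (g := fun y => τ (toT3 y)) hτ contDiff_snd)

lemma timeDeriv_cutoff {a b s : ℝ} (hab : a < b) (hs : s < a) (τ : T3 → E3) (x : T3) :
    timeDeriv (fun s x => cutoff a b s • τ x) s x = 0 := by
  have h : (fun r => cutoff a b r • τ x) =ᶠ[nhds s] fun _ => τ x := by
    filter_upwards [Iio_mem_nhds hs] with r hr
    rw [cutoff_eq_one hab (le_of_lt hr), one_smul]
  rw [timeDeriv, h.deriv_eq, deriv_const]

lemma divergence_smul (c : ℝ) {τ : T3 → E3} (hτ : SmoothT3 τ) (x : T3) :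
    divergence (fun x => c • τ x) x = c * divergence τ x := by
  simp only [divergence, Finset.mul_sum]
  refine Finset.sum_congr rfl fun i _ => ?_
  have := hτ.pd_clm (c • ContinuousLinearMap.id ℝ E3) i x
  change pd i (fun x => c • τ x) x = c • pd i τ x at this
  rw [this, PiLp.smul_apply, smul_eq_mul]

/-- The weak formulation of the Navier-Stokes equations, tested with a steady field. -/
theorem IsWeakNavierStokes.steady {T : ℝ} {u₀ : L2} {u : ℝ → L2} (h : IsWeakNavierStokes T u₀ u)
    {τ : T3 → E3} (hτ : SmoothT3 τ) (hdiv : ∀ x, divergence τ x = 0) {t : ℝ} (ht : t ∈ Ico 0 T) :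
    pairing (u t) τ
        + ∫ s in (0 : ℝ)..t, (pairing (advect (u s) (u s)) τ + gradPairing (u s) τ)
      = pairing u₀ τ := by
  obtain ⟨a, hta, haT⟩ := exists_between ht.2
  obtain ⟨b, hab, hbT⟩ := exists_between haT
  have h1 := h.weakForm _ (isTestField_cutoff hab hbT hτ) (fun s _ x => by
    rw [divergence_smul _ hτ, hdiv, mul_zero]) t ht
  have e : ∀ s ≤ t, (fun x => cutoff a b s • τ x) = τ := fun s hs => by
    ext1 x
    rw [cutoff_eq_one hab (hs.trans hta.le), one_smul]
  have et : ∀ s ≤ t, timeDeriv (fun s x => cutoff a b s • τ x) s = 0 := fun s hs => by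
    ext1 x
    exact timeDeriv_cutoff hab (hs.trans_lt hta) τ x
  beta_reduce at h1
  rw [e t le_rfl, e 0 ht.1] at h1
  have e1 : ∫ s in (0 : ℝ)..t, pairing (u s) (timeDeriv (fun s x => cutoff a b s • τ x) s) = 0 := by
    rw [intervalIntegral.integral_congr (g := fun _ => (0 : ℝ)), intervalIntegral.integral_zero]
    intro s hs
    rw [uIcc_of_le ht.1] at hs
    beta_reduce
    rw [et s hs.2]
    simp [pairing]
  rw [e1, add_zero] at h1
  rw [← h1]
  congr 1
  refine intervalIntegral.integral_congr fun s hs => ?_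
  rw [uIcc_of_le ht.1] at hs
  rw [e s hs.2]

/-- The weak formulation of the magnetization equation, tested with a steady field. -/
theorem IsStrongMagnetization.steady {T : ℝ} {u w : ℝ → L2} {w₀ : L2}
    (h : IsStrongMagnetization T u w₀ w) {τ : T3 → E3} (hτ : SmoothT3 τ) {t : ℝ}
    (ht : t ∈ Ico 0 T) :
    pairing (w t) τ
        + ∫ s in (0 : ℝ)..t, pairing (fun x => advect (u s) (w s) x + gradTranspose (u s) (w s) x) τ
      = pairing w₀ τ - ∫ s in (0 : ℝ)..t, gradPairing (w s) τ := by
  obtain ⟨a, hta, haT⟩ := exists_between ht.2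
  obtain ⟨b, hab, hbT⟩ := exists_between haT
  have h1 := h.weakForm _ (isTestField_cutoff hab hbT hτ) t ht
  have e : ∀ s ≤ t, (fun x => cutoff a b s • τ x) = τ := fun s hs => by
    ext1 x
    rw [cutoff_eq_one hab (hs.trans hta.le), one_smul]
  have et : ∀ s ≤ t, timeDeriv (fun s x => cutoff a b s • τ x) s = 0 := fun s hs => by
    ext1 x
    exact timeDeriv_cutoff hab (hs.trans_lt hta) τ x
  beta_reduce at h1
  rw [e t le_rfl, e 0 ht.1] at h1
  have e1 : ∫ s in (0 : ℝ)..t, pairing (w s) (timeDeriv (fun s x => cutoff a b s • τ x) s) = 0 := by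
    rw [intervalIntegral.integral_congr (g := fun _ => (0 : ℝ)), intervalIntegral.integral_zero]
    intro s hs
    rw [uIcc_of_le ht.1] at hs
    beta_reduce
    rw [et s hs.2]
    simp [pairing]
  rw [e1, add_zero] at h1
  convert h1 using 2
  · refine intervalIntegral.integral_congr fun s hs => ?_
    rw [uIcc_of_le ht.1] at hs
    rw [e s hs.2]
  · refine intervalIntegral.integral_congr fun s hs => ?_
    rw [uIcc_of_le ht.1] at hs
    rw [e s hs.2]

/-- The multipliers `ζ = 1` and `ζ = i` recover the real and the imaginary part of a complex
identity from real pairings. -/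
lemma eq_sub_integral {a b : ℂ} {R : ℝ → ℂ} {t : ℝ} (hR : IntervalIntegrable R volume 0 t)
    (h : ∀ ζ : ℂ, vol * (ζ * a).re + ∫ s in (0 : ℝ)..t, vol * (ζ * R s).re = vol * (ζ * b).re) :
    a = b - ∫ s in (0 : ℝ)..t, R s := by
  have h1 : ∀ ζ : ℂ, (ζ * a).re = (ζ * (b - ∫ s in (0 : ℝ)..t, R s)).re := by
    intro ζ
    have h2 := h ζ
    have h3 := (reMul ζ).intervalIntegral_comp_comm hR
    simp only [reMul_apply] at h3
    rw [intervalIntegral.integral_const_mul, h3, ← mul_add] at h2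
    have h4 := mul_left_cancel₀ vol_pos.ne' h2
    rw [mul_sub, Complex.sub_re, ← h4]
    ring
  have hr := h1 1
  have hi := h1 Complex.I
  rw [one_mul, one_mul] at hr
  rw [Complex.I_mul_re, Complex.I_mul_re] at hi
  exact Complex.ext hr (neg_injective hi)

/-- The mode equations of a strong solution of the magnetization equation. -/
theorem IsStrongMagnetization.modes_eq {T : ℝ} {u w : ℝ → L2} {w₀ : L2}
    (h : IsStrongMagnetization T u w₀ w) (hu : Regular T fun t => modes (u t)) {t : ℝ}
    (ht : t ∈ Ico 0 T) (m : Freq) (j : Fin 3) :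
    modes (w t) m j = modes w₀ m j - ∫ s in (0 : ℝ)..t,
      (bil (modes (u s)) (modes (w s)) m j + freqSq m * modes (w s) m j) := by
  have hu' := hu.mono ht.2.le
  have hw := (regular_modes h.memLinfty h.memL2).mono ht.2.le
  have hB : IntervalIntegrable (fun s => bil (modes (u s)) (modes (w s)) m j) volume 0 t :=
    (intervalIntegrable_iff_integrableOn_Ioc_of_le ht.1).mpr (hu'.integrableOn_bil hw m j)
  have hD : IntervalIntegrable (fun s => (freqSq m : ℂ) * modes (w s) m j) volume 0 t :=
    ((intervalIntegrable_iff_integrableOn_Ioc_of_le ht.1).mpr (hw.integrableOn_modes m j)).const_mul _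
  refine eq_sub_integral (hB.add hD) fun ζ => ?_
  have hc : ∀ z : Fin 3 → ℂ, ∑ i, (Pi.single j ζ : Fin 3 → ℂ) i * z i = ζ * z j := fun z => by
    rw [Finset.sum_eq_single j (fun i _ hi => by rw [Pi.single_eq_of_ne hi, zero_mul])
      (fun h => absurd (Finset.mem_univ j) h), Pi.single_eq_same]
  have h1 := h.steady (smoothT3_trig m (Pi.single j ζ)) ht
  simp only [pairing_trig (integrable_coord _), ← fourierCoef_eq_coef, hc] at h1
  have e1 : ∫ s in (0 : ℝ)..t, pairing (fun x => advect (u s) (w s) x + gradTranspose (u s) (w s) x)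
      (trig m (Pi.single j ζ))
      = ∫ s in (0 : ℝ)..t, vol * (ζ * bil (modes (u s)) (modes (w s)) m j).re := by
    refine intervalIntegral.integral_congr_ae ?_
    rw [uIoc_of_le ht.1, ← ae_restrict_iff' measurableSet_Ioc]
    filter_upwards [hu'.sob_two_ne_top, hw.sob_two_ne_top] with s hs1 hs2
    rw [pairing_trig fun i => ?_]
    · simp only [coef_advect_add_gradTranspose hs1 hs2, hc]
    · simp only [PiLp.add_apply, Complex.ofReal_add]
      exact (integrable_advect _ _ i).add (integrable_gradTranspose _ _ i)
  have e2 : ∫ s in (0 : ℝ)..t, gradPairing (w s) (trig m (Pi.single j ζ))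
      = ∫ s in (0 : ℝ)..t, vol * (ζ * (freqSq m * modes (w s) m j)).re := by
    refine intervalIntegral.integral_congr_ae ?_
    rw [uIoc_of_le ht.1, ← ae_restrict_iff' measurableSet_Ioc]
    filter_upwards [hw.sob_two_ne_top] with s hs2
    rw [gradPairing_trig hs2, hc]
  have i1 : IntervalIntegrable (fun s => vol * (ζ * bil (modes (u s)) (modes (w s)) m j).re)
      volume 0 t := IntervalIntegrable.const_mul
    ⟨(reMul ζ).integrable_comp hB.1, (reMul ζ).integrable_comp hB.2⟩ vol
  have i2 : IntervalIntegrable (fun s => vol * (ζ * (freqSq m * modes (w s) m j)).re)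
      volume 0 t := IntervalIntegrable.const_mul
    ⟨(reMul ζ).integrable_comp hD.1, (reMul ζ).integrable_comp hD.2⟩ vol
  rw [e1, e2] at h1
  have e3 := intervalIntegral.integral_add i1 i2
  simp only [← mul_add, ← Complex.add_re] at e3
  rw [e3]
  change vol * (ζ * modes (w t) m j).re + _ = vol * (ζ * modes w₀ m j).re - _ at h1
  linarith

/-! ### The Leray projection as a Fourier multiplier, and the modes of Navier–Stokes solutions -/

/-- The matrix entries of the projection onto the complement of `k`. -/
def projCoef (k : Freq) (i j : Fin 3) : ℝ :=
  (if i = j then 1 else 0) - (k i : ℝ) * (k j : ℝ) / freqSq k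

/-- The Leray projection on Fourier coefficients. -/
def projModes (a : Modes) : Modes := fun k i => ∑ j, (projCoef k i j : ℂ) * a k j

lemma freqSq_eq_zero {k : Freq} (h : freqSq k = 0) (i : Fin 3) : (k i : ℝ) = 0 := by
  have := (Finset.sum_eq_zero_iff_of_nonneg fun i _ => sq_nonneg (k i : ℝ)).mp h i
    (Finset.mem_univ i)
  exact pow_eq_zero_iff two_ne_zero |>.mp this

lemma sum_mul_projCoef (k : Freq) (i : Fin 3) : ∑ j, (k j : ℝ) * projCoef k i j = 0 := by
  have h1 : ∑ j, (k j : ℝ) * projCoef k i j = k i - k i * (freqSq k / freqSq k) := by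
    simp only [projCoef, mul_sub, Finset.sum_sub_distrib, mul_ite, mul_one, mul_zero,
      Finset.sum_ite_eq, Finset.mem_univ, if_true]
    congr 1
    nth_rewrite 2 [freqSq]
    rw [Finset.sum_div, Finset.mul_sum]
    exact Finset.sum_congr rfl fun j _ => by ring
  rw [h1]
  -- At `k = 0` division by zero gives `0`, so the matrix is the identity, as it should be: constant
  -- fields are divergence-free.
  rcases eq_or_ne (freqSq k) 0 with h | h
  · rw [freqSq_eq_zero h]; ring
  · rw [div_self h]; ring

lemma projCoef_symm (k : Freq) (i j : Fin 3) : projCoef k i j = projCoef k j i := by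
  simp only [projCoef, eq_comm (a := i), mul_comm (k i : ℝ)]

lemma projModes_eq (a : Modes) (k : Freq) (i : Fin 3) :
    projModes a k i = a k i - (k i : ℂ) * ((∑ j, (k j : ℂ) * a k j) / freqSq k) := by
  simp only [projModes, projCoef]
  push_cast
  simp only [sub_mul, Finset.sum_sub_distrib, apply_ite Complex.ofReal, Complex.ofReal_one,
    Complex.ofReal_zero, ite_mul, one_mul, zero_mul, Finset.sum_ite_eq, Finset.mem_univ, if_true]
  rw [Finset.sum_div, Finset.mul_sum]
  congr 1
  exact Finset.sum_congr rfl fun j _ => by ring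

lemma projModes_eq_self {a : Modes} {k : Freq} (h : ∑ j, (k j : ℂ) * a k j = 0) (i : Fin 3) :
    projModes a k i = a k i := by
  rw [projModes_eq, h]; ring

/-- Coefficients parallel to `k` are those of a gradient, which the projection removes. -/
lemma projModes_eq_zero {a : Modes} {k : Freq} {c : ℂ} (h : ∀ i, a k i = (k i : ℂ) * c)
    (i : Fin 3) : projModes a k i = 0 := by
  have h1 := congrArg (fun r : ℝ => (r : ℂ)) (sum_mul_projCoef k i)
  push_cast at h1
  simp only [projModes, h]
  rw [← zero_mul c, ← h1, Finset.sum_mul]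
  exact Finset.sum_congr rfl fun j _ => by ring

lemma sum_mul_projModes (a : Modes) (k : Freq) : ∑ i, (k i : ℂ) * projModes a k i = 0 := by
  simp only [projModes, Finset.mul_sum]
  rw [Finset.sum_comm]
  refine Finset.sum_eq_zero fun j _ => ?_
  have h1 := congrArg (fun r : ℝ => (r : ℂ)) (sum_mul_projCoef k j)
  push_cast at h1
  rw [← zero_mul (a k j), ← h1, Finset.sum_mul]
  refine Finset.sum_congr rfl fun i _ => ?_
  rw [projCoef_symm k i j]; ring

lemma abs_projCoef_le (k : Freq) (i j : Fin 3) : |projCoef k i j| ≤ 1 := by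
  rcases eq_or_ne (freqSq k) 0 with h | h
  · rw [projCoef, h, div_zero, sub_zero]
    split_ifs <;> simp
  have hp : 0 < freqSq k := lt_of_le_of_ne (freqSq_nonneg k) h.symm
  have hi : (k i : ℝ) ^ 2 ≤ freqSq k := Finset.single_le_sum (f := fun i => (k i : ℝ) ^ 2)
    (fun _ _ => sq_nonneg _) (Finset.mem_univ i)
  have hj : (k j : ℝ) ^ 2 ≤ freqSq k := Finset.single_le_sum (f := fun i => (k i : ℝ) ^ 2)
    (fun _ _ => sq_nonneg _) (Finset.mem_univ j)
  unfold projCoef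
  split_ifs with hij
  · subst hij
    rw [← sq, abs_le]
    have h1 : (k i : ℝ) ^ 2 / freqSq k ≤ 1 := (div_le_one hp).mpr hi
    have h2 : 0 ≤ (k i : ℝ) ^ 2 / freqSq k := by positivity
    constructor <;> linarith
  · rw [zero_sub, abs_neg, abs_div, abs_of_pos hp, div_le_one hp, abs_le]
    constructor <;> nlinarith [sq_nonneg ((k i : ℝ) + k j), sq_nonneg ((k i : ℝ) - k j)]

lemma sum_enorm_projModes_le (a : Modes) (k : Freq) :
    ∑ i, ‖projModes a k i‖ₑ ^ 2 ≤ 9 * ∑ j, ‖a k j‖ₑ ^ 2 := by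
  have h1 : ∀ i, ‖projModes a k i‖ₑ ^ 2 ≤ 3 * ∑ j, ‖a k j‖ₑ ^ 2 := by
    intro i
    calc _ ≤ (∑ j, ‖(projCoef k i j : ℂ) * a k j‖ₑ) ^ 2 := by
          gcongr; exact enorm_sum_le _ _
      _ ≤ 3 * ∑ j, ‖(projCoef k i j : ℂ) * a k j‖ₑ ^ 2 := sum_sq_le_three_mul _
      _ ≤ _ := by
          gcongr with j
          rw [enorm_mul, ← ofReal_norm (projCoef k i j : ℂ), Complex.norm_real, Real.norm_eq_abs]
          refine (mul_le_mul_left (ENNReal.ofReal_le_one.mpr (abs_projCoef_le k i j)) _).trans ?_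
          rw [one_mul]
  refine (Finset.sum_le_sum fun i _ => h1 i).trans ?_
  rw [Finset.sum_const, Finset.card_univ, Fintype.card_fin, nsmul_eq_mul, ← mul_assoc]
  norm_num

lemma projModes_sub (a b : Modes) (k : Freq) (i : Fin 3) :
    projModes (a - b) k i = projModes a k i - projModes b k i := by
  simp only [projModes, Pi.sub_apply, mul_sub, Finset.sum_sub_distrib]

lemma intervalIntegrable_projModes {a : ℝ → Modes} {t : ℝ} {k : Freq}
    (h : ∀ j, IntervalIntegrable (fun s => a s k j) volume 0 t) (i : Fin 3) :
    IntervalIntegrable (fun s => projModes (a s) k i) volume 0 t := by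
  have := IntervalIntegrable.sum Finset.univ fun j _ => (h j).const_mul (projCoef k i j : ℂ)
  convert! this using 1

/-- The mode equations of a weak solution of the Navier-Stokes equations. -/
theorem IsWeakNavierStokes.modes_eq {T : ℝ} {u₀ : L2} {u : ℝ → L2}
    (h : IsWeakNavierStokes T u₀ u) (hu₀ : u₀ ∈ solenoidal) (hu : Regular T fun t => modes (u t))
    {t : ℝ} (ht : t ∈ Ico 0 T) (m : Freq) (i : Fin 3) :
    modes (u t) m i = modes u₀ m i - ∫ s in (0 : ℝ)..t,
      (projModes (bil (modes (u s)) (modes (u s))) m i + freqSq m * modes (u s) m i) := by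
  have hu' := hu.mono ht.2.le
  have hB : ∀ j, IntervalIntegrable (fun s => bil (modes (u s)) (modes (u s)) m j) volume 0 t :=
    fun j => (intervalIntegrable_iff_integrableOn_Ioc_of_le ht.1).mpr (hu'.integrableOn_bil hu' m j)
  have hP := intervalIntegrable_projModes hB i
  have hD : IntervalIntegrable (fun s => (freqSq m : ℂ) * modes (u s) m i) volume 0 t :=
    ((intervalIntegrable_iff_integrableOn_Ioc_of_le ht.1).mpr (hu'.integrableOn_modes m i)).const_mul _
  refine eq_sub_integral (hP.add hD) fun ζ => ?_
  -- A multiple of row `i` of the projection matrix is orthogonal to `m`, so the test field is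
  -- divergence-free; pairing with it reads off component `i` of the projected coefficient.
  set c : Fin 3 → ℂ := fun j => ζ * projCoef m i j with hcdef
  have hc : ∀ a : Modes, ∑ j, c j * a m j = ζ * projModes a m i := fun a => by
    rw [projModes, Finset.mul_sum]
    exact Finset.sum_congr rfl fun j _ => by rw [hcdef]; ring
  have hdiv : ∑ j, (m j : ℂ) * c j = 0 := by
    have h1 := congrArg (fun r : ℝ => (r : ℂ)) (sum_mul_projCoef m i)
    push_cast at h1
    rw [← mul_zero ζ, ← h1, Finset.mul_sum]
    exact Finset.sum_congr rfl fun j _ => by rw [hcdef]; ring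
  have hself : ∀ v ∈ solenoidal, ∑ j, c j * modes v m j = ζ * modes v m i := fun v hv => by
    rw [hc, projModes_eq_self (a := modes v) (sum_mul_fourierCoef_of_mem_solenoidal hv m)]
  have h1 := h.steady (smoothT3_trig m c) (divergence_trig m c hdiv) ht
  rw [pairing_trig (integrable_coord _), pairing_trig (integrable_coord _)] at h1
  simp only [← fourierCoef_eq_coef] at h1
  change vol * (∑ j, c j * modes (u t) m j).re + _ = vol * (∑ j, c j * modes u₀ m j).re at h1
  rw [hself _ (h.divFree t ht), hself _ hu₀] at h1
  rw [← h1]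
  congr 1
  refine intervalIntegral.integral_congr_ae ?_
  rw [uIoc_of_le ht.1, ← ae_restrict_iff' measurableSet_Ioc]
  filter_upwards [hu'.sob_two_ne_top, ae_restrict_mem measurableSet_Ioc] with s hs hst
  rw [pairing_trig (integrable_advect _ _), gradPairing_trig hs]
  simp only [coef_advect _ hs]
  have h2 : ∑ j, c j * (freqSq m * modes (u s) m j) = ζ * (freqSq m * modes (u s) m i) := by
    have := hself _ (h.divFree s ⟨hst.1.le, hst.2.trans_lt ht.2⟩)
    calc _ = freqSq m * ∑ j, c j * modes (u s) m j := by
          rw [Finset.mul_sum]; exact Finset.sum_congr rfl fun j _ => by ring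
      _ = _ := by rw [this]; ring
  -- The weak formulation contains only `(u·∇)u`. The field `(∇u)ᵀu` is a gradient and may be added
  -- under the projection, which produces the same bilinear term as in the magnetization equation.
  obtain ⟨d, hd⟩ := stretch_self hs m
  have h3 : projModes (bil (modes (u s)) (modes (u s))) m i
      = projModes (transport (modes (u s)) (modes (u s))) m i := by
    have h4 : projModes (stretch (modes (u s)) (modes (u s))) m i = 0 := projModes_eq_zero hd i
    rw [← sub_eq_zero, ← projModes_sub, ← h4]
    congr 1
    ext k j
    simp [bil]
  rw [h2, hc, h3, mul_add, Complex.add_re]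
  ring

end Magnetization
end

noncomputable section
namespace Magnetization
open scoped ComplexConjugate ENNReal

/-! ### From Fourier coefficients to the weak formulation -/

/-- The summable majorant of the Fourier coefficients of smooth functions. -/
def majorant (k : Freq) : ℝ := (1 + ∑ i, (k i : ℝ) ^ 4)⁻¹

lemma majorant_nonneg (k : Freq) : 0 ≤ majorant k := by unfold majorant; positivity

lemma norm_le_one_add_toReal {z : ℂ} {B : ℝ≥0∞} (h : ‖z‖ₑ ^ 2 ≤ B) (hB : B ≠ ⊤) :
    ‖z‖ ≤ 1 + B.toReal := by
  have h1 : ‖z‖ ^ 2 ≤ B.toReal := by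
    have := ENNReal.toReal_mono hB h
    rwa [ENNReal.toReal_pow, toReal_enorm] at this
  nlinarith [sq_nonneg (‖z‖ - 1 / 2), norm_nonneg z]

/-- Dominated convergence for the Fourier series in time. The test coefficients provide the summable
factor and the modes of `z`, bounded uniformly in the frequency by `1 + B`, the integrable one. -/
theorem hasSum_integral_modes {t C : ℝ} (ht : 0 ≤ t) {a z : ℝ → Modes} {f : ℝ → ℂ}
    (ha : ∀ k j, Continuous fun s => a s k j)
    (haC : ∀ s ∈ Icc 0 t, ∀ k j, ‖a s k j‖ ≤ C * majorant k)
    (hz : ∀ k j, AEStronglyMeasurable (fun s => z s k j) (volume.restrict (Ioc 0 t)))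
    {B : ℝ → ℝ≥0∞} (hB : AEMeasurable B (volume.restrict (Ioc 0 t)))
    (hBi : ∫⁻ s in Ioc 0 t, B s ≠ ⊤)
    (hzB : ∀ᵐ s ∂(volume.restrict (Ioc 0 t)), ∀ k j, ‖z s k j‖ₑ ^ 2 ≤ B s)
    (hf : ∀ᵐ s ∂(volume.restrict (Ioc 0 t)),
      HasSum (fun k => (vol : ℂ) * ∑ j, a s k j * z s (-k) j) (f s)) :
    HasSum (fun k => ∫ s in (0 : ℝ)..t, (vol : ℂ) * ∑ j, a s k j * z s (-k) j)
      (∫ s in (0 : ℝ)..t, f s) := by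
  have hsum : Summable majorant := summable_inv_one_add_sum_pow_four
  have hbd : ∀ᵐ s ∂(volume.restrict (Ioc 0 t)), ∀ k,
      ‖(vol : ℂ) * ∑ j, a s k j * z s (-k) j‖ ≤ majorant k * (vol * (3 * (C * (1 + (B s).toReal)))) := by
    filter_upwards [hzB, ae_lt_top' hB hBi, ae_restrict_mem measurableSet_Ioc] with s h1 h2 hs k
    rw [norm_mul, Complex.norm_real, Real.norm_of_nonneg vol_pos.le]
    have h3 : ‖∑ j, a s k j * z s (-k) j‖ ≤ ∑ j : Fin 3, (C * majorant k) * (1 + (B s).toReal) := by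
      refine norm_sum_le_of_le _ fun j _ => ?_
      rw [norm_mul]
      exact mul_le_mul (haC s ⟨hs.1.le, hs.2⟩ k j) (norm_le_one_add_toReal (h1 _ j) h2.ne)
        (norm_nonneg _) ((norm_nonneg _).trans (haC s ⟨hs.1.le, hs.2⟩ k j))
    rw [Finset.sum_const, Finset.card_univ, Fintype.card_fin, nsmul_eq_mul] at h3
    refine (mul_le_mul_of_nonneg_left h3 vol_pos.le).trans_eq ?_
    push_cast
    ring
  refine intervalIntegral.hasSum_integral_of_dominated_convergence
    (fun k s => majorant k * (vol * (3 * (C * (1 + (B s).toReal))))) (fun k => ?_) (fun k => ?_)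
    (.of_forall fun s _ => hsum.mul_right _) ?_ ?_
  · rw [uIoc_of_le ht]
    refine AEStronglyMeasurable.const_mul (Finset.aestronglyMeasurable_fun_sum _ fun j _ => ?_) _
    exact (ha k j).aestronglyMeasurable.mul (hz (-k) j)
  · rw [uIoc_of_le ht, ← ae_restrict_iff' measurableSet_Ioc]
    filter_upwards [hbd] with s hs
    exact hs k
  · simp only [tsum_mul_right]
    have h1 : IntervalIntegrable (fun s => (B s).toReal) volume 0 t :=
      (intervalIntegrable_iff_integrableOn_Ioc_of_le ht).mpr
        (integrable_toReal_of_lintegral_ne_top hB hBi)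
    exact ((((intervalIntegrable_const.add h1).const_mul C).const_mul 3).const_mul vol).const_mul _
  · rwa [uIoc_of_le ht, ← ae_restrict_iff' measurableSet_Ioc]

/-- The Fourier coefficients of a continuous vector field. -/
def fieldModes (φ : T3 → E3) : Modes := fun k j => coef (fun x => ((φ x j : ℝ) : ℂ)) k

theorem hasSum_pairing_modes (v : L2) {φ : T3 → E3} (hφ : SmoothT3 φ) :
    HasSum (fun k => (vol : ℂ) * ∑ j, fieldModes φ k j * modes v (-k) j) (pairing v φ : ℂ) := by
  have h := hasSum_pairing (integrable_coord v) hφ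
  simp only [← fourierCoef_eq_coef] at h
  exact h

theorem hasSum_gradPairing {w : L2} (hw : sob 2 (modes w) ≠ ⊤) {φ : T3 → E3} (hφ : SmoothT3 φ) :
    HasSum (fun k => (vol : ℂ) * ∑ j, (freqSq k * fieldModes φ k j) * modes w (-k) j)
      (gradPairing w φ : ℂ) := by
  have h := hasSum_sum (s := Finset.univ) fun i _ => hasSum_pairing_modes (wpd i w) (hφ.pd i)
  rw [gradPairing, Complex.ofReal_sum]
  convert! h using 1
  ext1 k
  have e1 : ∀ i j, fieldModes (pd i φ) k j = Complex.I * k i * fieldModes φ k j := by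
    intro i j
    set L : E3 →L[ℝ] ℂ := Complex.ofRealCLM.comp (EuclideanSpace.proj j)
    have h1 := coef_pd (hφ.clm L) i k
    simp only [funext fun x => hφ.pd_clm L i x] at h1
    exact h1
  have e2 : ∀ i j, modes (wpd i w) (-k) j = -(Complex.I * k i * modes w (-k) j) := by
    intro i j
    rw [modes, fourierCoef_wpd hw]
    simp only [Pi.neg_apply, Int.cast_neg, modes]
    ring
  simp only [e1, e2, freqSq]
  rw [← Finset.mul_sum, Finset.sum_comm]
  congr 1
  refine Finset.sum_congr rfl fun j _ => ?_
  push_cast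
  rw [Finset.sum_mul, Finset.sum_mul]
  refine Finset.sum_congr rfl fun i _ => ?_
  linear_combination (-(k i : ℂ) ^ 2 * fieldModes φ k j * modes w (-k) j) * (-Complex.I_mul_I)

section

variable {φ : ℝ → T3 → E3}

lemma SmoothST.coord (hφ : SmoothST φ) (j : Fin 3) : SmoothST fun s x => ((φ s x j : ℝ) : ℂ) :=
  hφ.clm (Complex.ofRealCLM.comp (EuclideanSpace.proj j))

lemma SmoothST.continuous_fieldModes (hφ : SmoothST φ) (k : Freq) (j : Fin 3) :
    Continuous fun s => fieldModes (φ s) k j := (hφ.coord j).continuous_coef k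

lemma SmoothST.exists_fieldModes_bound (hφ : SmoothST φ) (t : ℝ) :
    ∃ C, ∀ s ∈ Icc 0 t, ∀ k j, ‖fieldModes (φ s) k j‖ ≤ C * majorant k := by
  choose C hC using fun j => (hφ.coord j).exists_coef_bound 0 t
  refine ⟨∑ j, |C j|, fun s hs k j => (hC j s hs k).trans ?_⟩
  refine mul_le_mul_of_nonneg_right ((le_abs_self _).trans ?_) (majorant_nonneg k)
  exact Finset.single_le_sum (f := fun j => |C j|) (fun _ _ => abs_nonneg _) (Finset.mem_univ j)

lemma SmoothST.exists_freqSq_fieldModes_bound (hφ : SmoothST φ) (t : ℝ) :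
    ∃ C, ∀ s ∈ Icc 0 t, ∀ k j, ‖(freqSq k : ℂ) * fieldModes (φ s) k j‖ ≤ C * majorant k := by
  -- The coefficients in question are, up to sign, those of `Δφ`, which is again smooth.
  have h1 := SmoothST.finsetSum Finset.univ fun i _ => (hφ.pd i).pd i
  obtain ⟨C, hC⟩ := h1.exists_fieldModes_bound t
  refine ⟨C, fun s hs k j => ?_⟩
  have e : fieldModes (fun x => ∑ i, Magnetization.pd i (Magnetization.pd i (φ s)) x) k j
      = -((freqSq k : ℂ) * fieldModes (φ s) k j) := by
    set L : E3 →L[ℝ] ℂ := Complex.ofRealCLM.comp (EuclideanSpace.proj j)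
    have hs := hφ.smoothT3 s
    have h2 : ∀ i, (fun x => L (Magnetization.pd i (Magnetization.pd i (φ s)) x)) = Magnetization.pd i (Magnetization.pd i (fun x => L (φ s x))) := by
      intro i
      have h3 : Magnetization.pd i (fun x => L (φ s x)) = fun x => L (Magnetization.pd i (φ s) x) := funext fun x =>
        hs.pd_clm L i x
      rw [h3]
      ext x
      exact ((hs.pd i).pd_clm L i x).symm
    calc fieldModes (fun x => ∑ i, Magnetization.pd i (Magnetization.pd i (φ s)) x) k j
        = coef (fun x => ∑ i, L (Magnetization.pd i (Magnetization.pd i (φ s)) x)) k := by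
          rw [fieldModes]; congr 1; ext x
          rw [← map_sum]; rfl
      _ = ∑ i, coef (fun x => L (Magnetization.pd i (Magnetization.pd i (φ s)) x)) k :=
          coef_finsetSum _ (fun i _ => integrable_of_continuous
            ((((hs.pd i).pd i).clm L).continuous)) k
      _ = ∑ i, Complex.I * k i * (Complex.I * k i * coef (fun x => L (φ s x)) k) := by
          refine Finset.sum_congr rfl fun i _ => ?_
          rw [h2, coef_pd ((hs.clm L).pd i), coef_pd (hs.clm L)]
      _ = _ := by
          rw [freqSq]
          push_cast
          rw [Finset.sum_mul, ← Finset.sum_neg_distrib]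
          refine Finset.sum_congr rfl fun i _ => ?_
          change _ = -((k i : ℂ) ^ 2 * coef (fun x => L (φ s x)) k)
          linear_combination ((k i : ℂ) ^ 2 * coef (fun x => L (φ s x)) k) * Complex.I_mul_I
  have := hC s hs k j
  rwa [e, norm_neg] at this

lemma SmoothST.timeDeriv (hφ : SmoothST φ) : SmoothST (Magnetization.timeDeriv φ) := hφ.time

lemma SmoothST.hasDerivAt_fieldModes (hφ : SmoothST φ) (t : ℝ) (k : Freq) (j : Fin 3) :
    HasDerivAt (fun t => fieldModes (φ t) k j)
      (fieldModes (Magnetization.timeDeriv φ t) k j) t := by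
  have h := (hφ.coord j).hasDerivAt_coef t k
  have h2 : ∀ x, deriv (fun τ => ((φ τ x j : ℝ) : ℂ)) t = ((Magnetization.timeDeriv φ t x j : ℝ) : ℂ) :=
    fun x => hφ.time_clm (Complex.ofRealCLM.comp (EuclideanSpace.proj j)) t x
  simp only [h2] at h
  exact h

end

/-- Solutions of the mode equations satisfy the weak formulation. -/
theorem weakForm_of_modes {T : ℝ} {u w : ℝ → L2} (hu : Regular T fun t => modes (u t))
    (hw : Regular T fun t => modes (w t))
    (hsol : IsModeSol T (fun s => bil (modes (u s)) (modes (w s))) fun s => modes (w s))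
    {φ : ℝ → T3 → E3} (hφ : SmoothST φ) {t : ℝ} (ht : t ∈ Icc 0 T) :
    pairing (w t) (φ t)
        + ∫ s in (0 : ℝ)..t, pairing (fun x => advect (u s) (w s) x + gradTranspose (u s) (w s) x) (φ s)
      = pairing (w 0) (φ 0) + (∫ s in (0 : ℝ)..t, pairing (w s) (timeDeriv φ s))
        - ∫ s in (0 : ℝ)..t, gradPairing (w s) (φ s) := by
  replace hu := hu.mono ht.2
  replace hw := hw.mono ht.2
  replace hsol : ∀ k j, _ := fun k j => (hsol k j).mono ht
  obtain ⟨C1, hC1⟩ := hφ.exists_fieldModes_bound t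
  obtain ⟨C2, hC2⟩ := hφ.timeDeriv.exists_fieldModes_bound t
  obtain ⟨C3, hC3⟩ := hφ.exists_freqSq_fieldModes_bound t
  have hwm := fun k j => (hw.aemeasurable k j).aestronglyMeasurable
  have hw3 : ∀ᵐ s ∂(volume.restrict (Ioc 0 t)), ∀ k j, ‖modes (w s) k j‖ₑ ^ 2 ≤ sob 3 (modes (w s)) :=
    .of_forall fun s k j => Regular.enorm_sq_le_sob _ 3 k j
  have s1 := hasSum_integral_modes ht.1 (z := fun s => bil (modes (u s)) (modes (w s)))
    (f := fun s => (pairing (fun x => advect (u s) (w s) x + gradTranspose (u s) (w s) x) (φ s) : ℂ))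
    hφ.continuous_fieldModes hC1 (hu.aestronglyMeasurable_bil hw)
    (((hu.aemeasurable_sob 2).mul (hw.aemeasurable_sob 2)).const_mul 36)
    (by
      have := hu.lintegral_sob_mul hw
      rw [lintegral_const_mul' _ _ (by simp)]
      exact ENNReal.mul_ne_top (by simp) this)
    (.of_forall fun s k j => enorm_bil_sq_le _ _ k j)
    (by
      filter_upwards [hu.sob_two_ne_top, hw.sob_two_ne_top] with s h1 h2
      have h := hasSum_pairing (h := fun x => advect (u s) (w s) x + gradTranspose (u s) (w s) x)
        (fun i => by
          simp only [PiLp.add_apply, Complex.ofReal_add]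
          exact (integrable_advect _ _ i).add (integrable_gradTranspose _ _ i)) (hφ.smoothT3 s)
      simp only [coef_advect_add_gradTranspose h1 h2] at h
      exact h)
  have s2 := hasSum_integral_modes ht.1 (f := fun s => (pairing (w s) (timeDeriv φ s) : ℂ))
    hφ.timeDeriv.continuous_fieldModes hC2 hwm
    (hw.aemeasurable_sob 3) hw.lintegral_sob_three hw3
    (.of_forall fun s => hasSum_pairing_modes (w s) (hφ.timeDeriv.smoothT3 s))
  have s3 := hasSum_integral_modes ht.1 (f := fun s => (gradPairing (w s) (φ s) : ℂ))
    (a := fun s k j => freqSq k * fieldModes (φ s) k j)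
    (fun k j => (hφ.continuous_fieldModes k j).const_mul _) hC3 hwm
    (hw.aemeasurable_sob 3) hw.lintegral_sob_three hw3
    (by
      filter_upwards [hw.sob_two_ne_top] with s h2
      exact hasSum_gradPairing h2 (hφ.smoothT3 s))
  have st := hasSum_pairing_modes (w t) (hφ.smoothT3 t)
  have s0 := hasSum_pairing_modes (w 0) (hφ.smoothT3 0)
  -- The weak formulation holds frequency by frequency: it is the product rule for `φ̂ₖ ŵ₋ₖ`,
  -- integrated from `0` to `t`. The pairing of real fields matches `k` with `-k`.
  have key : ∀ k, (vol : ℂ) * ∑ j, fieldModes (φ t) k j * modes (w t) (-k) j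
      + ∫ s in (0 : ℝ)..t, (vol : ℂ) * ∑ j, fieldModes (φ s) k j *
          bil (modes (u s)) (modes (w s)) (-k) j
      = (vol : ℂ) * ∑ j, fieldModes (φ 0) k j * modes (w 0) (-k) j
      + (∫ s in (0 : ℝ)..t, (vol : ℂ) * ∑ j, fieldModes (timeDeriv φ s) k j * modes (w s) (-k) j)
      - ∫ s in (0 : ℝ)..t, (vol : ℂ) * ∑ j, (freqSq k * fieldModes (φ s) k j) *
          modes (w s) (-k) j := by
    intro k
    have hwi : ∀ j, IntervalIntegrable (fun s => modes (w s) (-k) j) volume 0 t := fun j =>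
      (intervalIntegrable_iff_integrableOn_Ioc_of_le ht.1).mpr (hw.integrableOn_modes _ j)
    have hbi : ∀ j, IntervalIntegrable (fun s => bil (modes (u s)) (modes (w s)) (-k) j) volume 0 t :=
      fun j => (intervalIntegrable_iff_integrableOn_Ioc_of_le ht.1).mpr (hu.integrableOn_bil hw _ j)
    have i1 : ∀ j, IntervalIntegrable (fun s => fieldModes (φ s) k j *
        bil (modes (u s)) (modes (w s)) (-k) j) volume 0 t := fun j =>
      (hbi j).continuousOn_mul (hφ.continuous_fieldModes k j).continuousOn
    have i2 : ∀ j, IntervalIntegrable (fun s => fieldModes (timeDeriv φ s) k j *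
        modes (w s) (-k) j) volume 0 t := fun j =>
      (hwi j).continuousOn_mul (hφ.timeDeriv.continuous_fieldModes k j).continuousOn
    have i3 : ∀ j, IntervalIntegrable (fun s => (freqSq k * fieldModes (φ s) k j) *
        modes (w s) (-k) j) volume 0 t := fun j =>
      (hwi j).continuousOn_mul ((hφ.continuous_fieldModes k j).const_mul _).continuousOn
    have hk : freqSq (-k) = freqSq k := by simp [freqSq]
    have step : ∀ j, fieldModes (φ t) k j * modes (w t) (-k) j
        + ∫ s in (0 : ℝ)..t, fieldModes (φ s) k j * bil (modes (u s)) (modes (w s)) (-k) j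
        = fieldModes (φ 0) k j * modes (w 0) (-k) j
        + (∫ s in (0 : ℝ)..t, fieldModes (timeDeriv φ s) k j * modes (w s) (-k) j)
        - ∫ s in (0 : ℝ)..t, (freqSq k * fieldModes (φ s) k j) * modes (w s) (-k) j := by
      intro j
      have hprim : IsPrim t (fun s => fieldModes (φ s) k j)
          (fun s => fieldModes (timeDeriv φ s) k j) :=
        .of_hasDerivAt (fun s => hφ.hasDerivAt_fieldModes s k j)
          (hφ.timeDeriv.continuous_fieldModes k j)
      have h1 := (hprim.mul ht.1 (hsol (-k) j)).2 t ⟨ht.1, le_rfl⟩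
      beta_reduce at h1
      rw [h1, hk, add_sub_assoc, add_assoc, ← intervalIntegral.integral_sub (i2 j) (i3 j),
        ← intervalIntegral.integral_add ?_ (i1 j)]
      · congr 1
        refine intervalIntegral.integral_congr fun s _ => ?_
        ring
      · refine ((i2 j).sub ((i1 j).add (i3 j))).congr_ae (.of_forall fun s => ?_)
        beta_reduce
        ring
    simp only [intervalIntegral.integral_const_mul]
    rw [intervalIntegral.integral_finsetSum fun j _ => i1 j,
      intervalIntegral.integral_finsetSum fun j _ => i2 j,
      intervalIntegral.integral_finsetSum fun j _ => i3 j, ← mul_add, ← mul_add, ← mul_sub,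
      ← Finset.sum_add_distrib, ← Finset.sum_add_distrib, ← Finset.sum_sub_distrib]
    congr 1
    exact Finset.sum_congr rfl fun j _ => step j
  have l := st.add s1
  simp only [key] at l
  have := l.unique ((s0.add s2).sub s3)
  simp only [intervalIntegral.integral_ofReal] at this
  exact_mod_cast this

end Magnetization
end

noncomputable section
namespace Magnetization
open scoped ComplexConjugate ENNReal

/-! ### Existence -/

/-- The Fourier coefficients of the complex conjugate. -/
def reflect (a : Modes) : Modes := fun k j => conj (a (-k) j)

lemma conj_tsum_neg (f : Freq → ℂ) : conj (∑' k, f k) = ∑' k, conj (f (-k)) := by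
  rw [← (Equiv.neg Freq).tsum_eq f]
  exact Complex.conjCLE.map_tsum

/-- `reflect` is complex conjugation in physical space, and the bilinear operator has real
coefficients. -/
lemma bil_reflect (u w : Modes) : bil (reflect u) (reflect w) = reflect (bil u w) := by
  ext m i
  have h1 : ∀ k : Freq, -m - -k = -(m - k) := fun k => by abel
  simp only [bil, transport, stretch, reflect, map_add, conj_tsum_neg, map_sum, map_mul,
    Complex.conj_I, map_intCast, h1]
  congr 1
  · refine tsum_congr fun k => Finset.sum_congr rfl fun j _ => ?_
    simp only [Pi.neg_apply, Int.cast_neg]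
    ring
  · refine tsum_congr fun k => Finset.sum_congr rfl fun j _ => ?_
    simp only [Pi.neg_apply, Int.cast_neg]
    ring

lemma sob_reflect (n : ℕ) (a : Modes) : sob n (reflect a) = sob n a := by
  unfold sob
  rw [← (Equiv.neg Freq).tsum_eq (fun k => ewt k ^ n * ∑ j, ‖a k j‖ₑ ^ 2)]
  refine tsum_congr fun k => ?_
  have : ewt (-k) = ewt k := by simp [ewt, wt]
  simp [reflect, this]

lemma bil_midpoint {u w w' : Modes} (hu : sob 2 u ≠ ⊤) (hw : sob 2 w ≠ ⊤) (hw' : sob 2 w' ≠ ⊤)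
    (m : Freq) (i : Fin 3) : bil u (fun k j => 1 / 2 * (w k j + w' k j)) m i
      = 1 / 2 * (bil u w m i + bil u w' m i) := by
  simp only [bil, transport, stretch]
  rw [add_add_add_comm, ← (summable_transport hu hw m i).tsum_add (summable_transport hu hw' m i),
    ← (summable_stretch hu hw m i).tsum_add (summable_stretch hu hw' m i), mul_add,
    ← tsum_mul_left, ← tsum_mul_left]
  congr 1
  · refine tsum_congr fun k => ?_
    rw [← Finset.sum_add_distrib, Finset.mul_sum]
    exact Finset.sum_congr rfl fun j _ => by ring
  · refine tsum_congr fun k => ?_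
    rw [← Finset.sum_add_distrib, Finset.mul_sum]
    exact Finset.sum_congr rfl fun j _ => by ring

lemma sob_midpoint_le (n : ℕ) (a b : Modes) :
    sob n (fun k j => 1 / 2 * (a k j + b k j)) ≤ sob n a + sob n b := by
  unfold sob
  rw [← ENNReal.tsum_add]
  refine ENNReal.tsum_le_tsum fun k => ?_
  rw [← mul_add, ← Finset.sum_add_distrib]
  gcongr with j
  have h : ‖(1 / 2 : ℂ) * (a k j + b k j)‖ ^ 2 ≤ ‖a k j‖ ^ 2 + ‖b k j‖ ^ 2 := by
    have h1 := norm_add_le (a k j) (b k j)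
    have h0 := norm_nonneg (a k j + b k j)
    rw [norm_mul, show ‖(1 / 2 : ℂ)‖ = 1 / 2 by simp]
    nlinarith [sq_nonneg (‖a k j‖ - ‖b k j‖), norm_nonneg (a k j), norm_nonneg (b k j)]
  simp only [← ofReal_norm]
  rw [← ENNReal.ofReal_pow (norm_nonneg _), ← ENNReal.ofReal_pow (norm_nonneg _),
    ← ENNReal.ofReal_pow (norm_nonneg _), ← ENNReal.ofReal_add (sq_nonneg _) (sq_nonneg _)]
  exact ENNReal.ofReal_le_ofReal h

lemma IsModeSol.mono {τ t : ℝ} {G y : ℝ → Modes} (h : IsModeSol τ G y) (ht : t ∈ Icc 0 τ) :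
    IsModeSol t G y := fun k j => (h k j).mono ht

/-- Solutions of the mode equations in the energy space are bounded in `H^{1/2}`. -/
theorem exists_sob_one_le {T : ℝ} {g : ℝ → ℝ} {u w : ℝ → Modes} (hg : Dominates T g u)
    (hw : IsModeSol T (fun s => bil (u s) (w s)) w) (h0 : sob 1 (w 0) ≠ ⊤)
    (hfin : wnorm g T w ≠ ⊤) : ∃ M : ℝ≥0∞, M ≠ ⊤ ∧ ∀ t ∈ Icc 0 T, sob 1 (w t) ≤ M := by
  -- The weight is smallest at `T`; dividing the energy estimate by this value gives a bound uniform
  -- in `t`.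
  refine ⟨(ENNReal.ofReal (decay rate g T))⁻¹ * (sob 1 (w 0) + 8⁻¹ * wnorm g T w), ?_,
    fun t ht => ?_⟩
  · have := ENNReal.inv_ne_top.mpr (ofReal_decay_ne_zero rate g T)
    exact ENNReal.mul_ne_top this (by finiteness)
  have h1 := energy_le_of_bound ht.1 ht.2 hg (hw.mono ht) (v := w)
    (.of_forall fun s => tsum_bil_sq_le' (u s) (w s))
  have h2 : ENNReal.ofReal (decay rate g T) * sob 1 (w t) ≤ sob 1 (w 0) + 8⁻¹ * wnorm g T w := by
    refine le_trans ?_ ((le_self_add.trans h1).trans ?_)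
    · exact mul_le_mul_left (ENNReal.ofReal_le_ofReal (decay_anti rate_nonneg
        (fun s => zero_le_one.trans (hg.one_le s)) hg.intervalIntegrable ht.2)) _
    · gcongr
      exact lintegral_mono_set (Ioc_subset_Ioc_right ht.2)
  rwa [mul_comm, ← div_eq_mul_inv,
    ENNReal.le_div_iff_mul_le (.inl (ofReal_decay_ne_zero rate g T)) (.inl ENNReal.ofReal_ne_top),
    mul_comm]

theorem lintegral_sob_three_ne_top {T : ℝ} {g : ℝ → ℝ} {u w : ℝ → Modes} (hg : Dominates T g u)
    (hfin : wnorm g T w ≠ ⊤) : ∫⁻ s in Ioc 0 T, sob 3 (w s) ≠ ⊤ := by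
  have h1 : ENNReal.ofReal (decay rate g T) * ∫⁻ s in Ioc 0 T, sob 3 (w s) ≤ wnorm g T w := by
    rw [wnorm, ← lintegral_const_mul' _ _ ENNReal.ofReal_ne_top]
    refine setLIntegral_mono_ae' measurableSet_Ioc (.of_forall fun s hs => ?_)
    rw [sob, ← ENNReal.tsum_mul_left]
    refine ENNReal.tsum_le_tsum fun k => ?_
    rw [← mul_assoc, dens, ewt, ← ENNReal.ofReal_pow (wt_pos k).le,
      ← ENNReal.ofReal_mul (decay_pos _ _ _).le]
    gcongr
    · exact pow_nonneg (wt_pos k).le 3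
    · exact (decay_pos _ _ _).le
    · exact decay_anti rate_nonneg (fun s => zero_le_one.trans (hg.one_le s))
        hg.intervalIntegrable hs.2
    · exact le_add_of_nonneg_left (mul_nonneg (mul_nonneg rate_nonneg
        (zero_le_one.trans (hg.one_le s))) (wt_pos k).le)
  intro h
  rw [h, ENNReal.mul_top (ofReal_decay_ne_zero rate g T)] at h1
  exact hfin (top_le_iff.mp h1)

/-- The fixed point of the iteration is not known to be Hermitian. `ofModes` takes its real part,
whose modes average `v` with its reflection. Since `u` is real, the reflection solves the same
linear system, and so does the average; the real initial value is unchanged. -/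
theorem exists_regular_solution {T : ℝ} (hT : 0 ≤ T) {u : ℝ → L2}
    (hu : Regular T fun t => modes (u t)) {w₀ : L2} (h0 : sob 1 (modes w₀) ≠ ⊤) :
    ∃ w : ℝ → L2, w 0 = w₀ ∧ AEStronglyMeasurable w (volume.restrict (Ioc 0 T)) ∧
      Regular T (fun t => modes (w t)) ∧
      IsModeSol T (fun s => bil (modes (u s)) (modes (w s))) fun s => modes (w s) := by
  obtain ⟨g, hg⟩ := hu.exists_dominates
  obtain ⟨u', hum, hue⟩ := hu.exists_measurable
  have hg' : Dominates T g u' := by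
    refine ⟨hg.one_le, hg.measurable, hg.intervalIntegrable, ?_⟩
    filter_upwards [hue, hg.sob_sq_le] with s h1 h2
    rwa [h1]
  obtain ⟨v, hv0, hvc, hvs, hvn⟩ := exists_modeSol hT hg' hum h0
  obtain ⟨M, hM, hle⟩ := exists_sob_one_le hg' hvs (by rwa [hv0]) hvn
  have h3 := lintegral_sob_three_ne_top hg' hvn
  have hv : Regular T v := ⟨fun k j => (hvc k j).measurable.aemeasurable, ⟨M, hM,
    (ae_restrict_iff' measurableSet_Ioc).mpr (.of_forall fun t ht => hle t ⟨ht.1.le, ht.2⟩)⟩, h3⟩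
  have hfin : ∀ t ∈ Icc 0 T, sob 0 (v t) ≠ ⊤ := fun t ht =>
    ne_top_of_le_ne_top hM ((sob_mono zero_le_one _).trans (hle t ht))
  have hmodes : ∀ t ∈ Icc 0 T, modes (ofModes (v t))
      = fun k j => 1 / 2 * (v t k j + reflect (v t) k j) := fun t ht => by
    ext k j
    exact fourierCoef_ofModes (hfin t ht) k j
  have hb : ∀ n, ∀ t ∈ Icc 0 T, sob n (modes (ofModes (v t))) ≤ 2 * sob n (v t) := by
    intro n t ht
    rw [hmodes t ht, two_mul]
    refine (sob_midpoint_le n _ _).trans ?_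
    rw [sob_reflect]
  refine ⟨fun t => ofModes (v t), ?_, ?_, ⟨fun k j => ?_, ⟨2 * M, by finiteness, ?_⟩, ?_⟩, ?_⟩
  · beta_reduce
    rw [hv0]
    refine ext_fourierCoef fun k j => ?_
    rw [fourierCoef_ofModes (sob_zero_modes_ne_top w₀)]
    simp only [modes, fourierCoef_neg, Complex.conj_conj]
    ring
  · refine aestronglyMeasurable_ofModes hvc ?_
    exact (ae_restrict_iff' measurableSet_Ioc).mpr (.of_forall fun t ht => hfin t ⟨ht.1.le, ht.2⟩)
  · have hc : Continuous fun t => 1 / 2 * (v t k j + conj (v t (-k) j)) :=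
      continuous_const.mul ((hvc k j).add (Complex.continuous_conj.comp (hvc (-k) j)))
    refine hc.measurable.aemeasurable.congr ?_
    refine (ae_restrict_iff' measurableSet_Ioc).mpr (.of_forall fun t ht => ?_)
    beta_reduce
    rw [hmodes t ⟨ht.1.le, ht.2⟩]
    rfl
  · refine (ae_restrict_iff' measurableSet_Ioc).mpr (.of_forall fun t ht => ?_)
    have ht' : t ∈ Icc 0 T := ⟨ht.1.le, ht.2⟩
    exact (hb 1 t ht').trans (mul_le_mul_right (hle t ht') 2)
  · have h4 : ∫⁻ s in Ioc 0 T, sob 3 (modes (ofModes (v s))) ≤ 2 * ∫⁻ s in Ioc 0 T, sob 3 (v s) := by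
      rw [← lintegral_const_mul' _ _ (by simp)]
      exact setLIntegral_mono_ae' measurableSet_Ioc
        (.of_forall fun s hs => hb 3 s ⟨hs.1.le, hs.2⟩)
    exact ne_top_of_le_ne_top (by finiteness) h4
  · intro k j
    have p1 := hvs k j
    have p2 := (hvs (-k) j).clm Complex.conjCLE.toContinuousLinearMap
    have p3 := (p1.add p2).clm (ContinuousLinearMap.mul ℝ ℂ (1 / 2))
    refine p3.congr hT (fun t ht => ?_) ?_
    · change _ = modes (ofModes (v t)) k j
      rw [hmodes t ht]
      rfl
    rw [← ae_restrict_iff' measurableSet_Ioc]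
    filter_upwards [hue, hu.sob_two_ne_top, hv.sob_two_ne_top, ae_restrict_mem measurableSet_Ioc]
      with s h1 h2 h3 hs
    have hr : reflect (modes (u s)) = modes (u s) := by
      ext k j
      rw [reflect, modes, fourierCoef_neg, Complex.conj_conj]
      rfl
    have h5 := bil_reflect (modes (u s)) (v s)
    rw [hr] at h5
    have hk : freqSq (-k) = freqSq k := by simp [freqSq]
    rw [hmodes s ⟨hs.1.le, hs.2⟩, bil_midpoint h2 h3 (by rwa [sob_reflect]), h5, h1, hk]
    change (1 / 2 : ℂ) * (-(bil (modes (u s)) (v s) k j + freqSq k * v s k j)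
      + conj (-(bil (modes (u s)) (v s) (-k) j + freqSq k * v s (-k) j))) = _
    simp only [reflect, map_neg, map_add, map_mul, Complex.conj_ofReal]
    ring

lemma memLinftyHs_memL2Hs_of_regular {T : ℝ} {w : ℝ → L2}
    (hm : AEStronglyMeasurable w (volume.restrict (Ioc 0 T)))
    (hw : Regular T fun t => modes (w t)) : MemLinftyHs T (1 / 2) w ∧ MemL2Hs T (3 / 2) w := by
  have hμ : (volume.restrict (Ioo 0 T) : Measure ℝ) = volume.restrict (Ioc 0 T) :=
    Measure.restrict_congr_set Ioo_ae_eq_Ioc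
  obtain ⟨M, hM, hle⟩ := hw.sob_one_le
  simp only [sob_one_modes] at hle
  unfold MemLinftyHs MemL2Hs
  rw [hμ]
  exact ⟨⟨hm, M, hM.lt_top, hle⟩, hm, (lintegral_mono fun s =>
    hsNormSq_le_sob_three (w s)).trans_lt hw.lintegral_sob_three.lt_top⟩

theorem exists_isStrongMagnetization {T : ℝ} (hT : 0 < T) {u : ℝ → L2}
    (hu : Regular T fun t => modes (u t)) {w₀ : L2} (h0 : hsNormSq (1 / 2) w₀ < ⊤) :
    ∃ w : ℝ → L2, IsStrongMagnetization T u w₀ w := by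
  obtain ⟨w, hw0, hm, hreg, hsol⟩ := exists_regular_solution hT.le hu
    (w₀ := w₀) (by rw [sob_one_modes]; exact h0.ne)
  obtain ⟨h1, h2⟩ := memLinftyHs_memL2Hs_of_regular hm hreg
  refine ⟨w, h1, h2, fun φ hφ t ht => ?_⟩
  rw [weakForm_of_modes hu hreg hsol hφ.1 ⟨ht.1, ht.2.le⟩, hw0]

/-! ### Uniqueness -/

section

variable {T : ℝ} {u w : ℝ → L2} {w₀ u₀ : L2}

/-- At `t = 0` the weak formulation has no integral terms. -/
lemma IsStrongMagnetization.zero_eq (h : IsStrongMagnetization T u w₀ w)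
    (hu : Regular T fun t => modes (u t)) (hT : 0 < T) : w 0 = w₀ := by
  refine ext_fourierCoef fun k j => ?_
  have := h.modes_eq hu ⟨le_rfl, hT⟩ k j
  rwa [intervalIntegral.integral_same, sub_zero] at this

theorem IsStrongMagnetization.isModeSol (h : IsStrongMagnetization T u w₀ w)
    (hu : Regular T fun t => modes (u t)) {t : ℝ} (ht : t ∈ Ico 0 T) :
    IsModeSol t (fun s => bil (modes (u s)) (modes (w s))) fun s => modes (w s) := by
  have hw := (regular_modes h.memLinfty h.memL2).mono ht.2.le
  intro k j
  refine ⟨(intervalIntegrable_iff_integrableOn_Ioc_of_le ht.1).mpr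
    (((hu.mono ht.2.le).integrableOn_bil hw k j).add ((hw.integrableOn_modes k j).const_mul _)).neg,
    fun s hs => ?_⟩
  beta_reduce
  rw [h.modes_eq hu ⟨hs.1, hs.2.trans_lt ht.2⟩ k j, h.zero_eq hu (ht.1.trans_lt ht.2),
    intervalIntegral.integral_neg, sub_eq_add_neg]

theorem IsStrongMagnetization.unique {w' : ℝ → L2} (h : IsStrongMagnetization T u w₀ w)
    (h' : IsStrongMagnetization T u w₀ w') (hu : Regular T fun t => modes (u t)) {t : ℝ}
    (ht : t ∈ Ico 0 T) : w' t = w t := by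
  have hT := ht.1.trans_lt ht.2
  have hw := (regular_modes h.memLinfty h.memL2).mono ht.2.le
  have hw' := (regular_modes h'.memLinfty h'.memL2).mono ht.2.le
  obtain ⟨g, hg⟩ := (hu.mono ht.2.le).exists_dominates
  have hy : IsModeSol t (fun s => bil (modes (u s)) (modes (w' s) - modes (w s)))
      fun s => modes (w' s) - modes (w s) := by
    intro k j
    refine ((h'.isModeSol hu ht k j).sub (h.isModeSol hu ht k j)).congr ht.1 (fun s _ => rfl) ?_
    rw [← ae_restrict_iff' measurableSet_Ioc]
    filter_upwards [(hu.mono ht.2.le).sob_two_ne_top, hw.sob_two_ne_top, hw'.sob_two_ne_top]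
      with s h1 h2 h3
    rw [bil_sub h1 h3 h2, Pi.sub_apply, Pi.sub_apply]
    ring
  have h0 : ∀ k j, (modes (w' 0) - modes (w 0)) k j = 0 := fun k j => by
    rw [h.zero_eq hu hT, h'.zero_eq hu hT, sub_self]; rfl
  have := modes_eq_zero ht.1 le_rfl hg hy (.of_forall fun s => tsum_bil_sq_le' _ _) h0
    ((hw'.sub hw).wnorm_ne_top ht.1 hg)
  exact ext_fourierCoef fun k j => sub_eq_zero.mp (this k j)

/-! ### The projection of the solution -/

lemma sob_projModes_le (n : ℕ) (a : Modes) : sob n (projModes a) ≤ 9 * sob n a := by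
  simp only [sob]
  rw [← ENNReal.tsum_mul_left]
  refine ENNReal.tsum_le_tsum fun k => ?_
  rw [mul_left_comm]
  gcongr
  exact sum_enorm_projModes_le a k

lemma Regular.projModes {v : ℝ → Modes} (hv : Regular T v) :
    Regular T fun s => projModes (v s) := by
  obtain ⟨M, hM, hle⟩ := hv.sob_one_le
  refine ⟨fun k j => ?_, ⟨9 * M, by finiteness, ?_⟩, ?_⟩
  · exact Finset.aemeasurable_fun_sum _ fun i _ => (hv.aemeasurable k i).const_mul _
  · filter_upwards [hle] with s hs
    exact (sob_projModes_le 1 _).trans (mul_le_mul_right hs 9)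
  · refine ne_top_of_le_ne_top ?_ (lintegral_mono fun s => sob_projModes_le 3 (v s))
    rw [lintegral_const_mul' _ _ (by simp)]
    have := hv.lintegral_sob_three
    finiteness

/-- The symbol `|k|²` is scalar, so the projection commutes with it at each frequency. -/
lemma IsModeSol.projModes {τ : ℝ} {G y : ℝ → Modes} (h : IsModeSol τ G y) :
    IsModeSol τ (fun s => projModes (G s)) fun s => projModes (y s) := by
  intro k i
  have h1 := IsPrim.finsetSum Finset.univ fun j _ =>
    (h k j).clm (ContinuousLinearMap.mul ℝ ℂ (projCoef k i j : ℂ))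
  convert! h1 using 1
  ext s
  simp only [ContinuousLinearMap.mul_apply', Magnetization.projModes]
  rw [Finset.mul_sum, ← Finset.sum_add_distrib, ← Finset.sum_neg_distrib]
  exact Finset.sum_congr rfl fun j _ => by ring

theorem IsWeakNavierStokes.isModeSol (h : IsWeakNavierStokes T u₀ u) (hu₀ : u₀ ∈ solenoidal)
    (hu : Regular T fun t => modes (u t)) {t : ℝ} (ht : t ∈ Ico 0 T) :
    IsModeSol t (fun s => projModes (bil (modes (u s)) (modes (u s)))) fun s => modes (u s) := by
  have hu' := hu.mono ht.2.le
  intro k j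
  refine ⟨((intervalIntegrable_projModes (fun j => (intervalIntegrable_iff_integrableOn_Ioc_of_le
    ht.1).mpr (hu'.integrableOn_bil hu' k j)) j).add ((intervalIntegrable_iff_integrableOn_Ioc_of_le
    ht.1).mpr ((hu'.integrableOn_modes k j).const_mul _))).neg, fun s hs => ?_⟩
  beta_reduce
  rw [h.modes_eq hu₀ hu ⟨hs.1, hs.2.trans_lt ht.2⟩ k j,
    h.modes_eq hu₀ hu ⟨le_rfl, ht.1.trans_lt ht.2⟩ k j, intervalIntegral.integral_same, sub_zero,
    intervalIntegral.integral_neg, sub_eq_add_neg]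

lemma IsWeakNavierStokes.modes_zero_eq (h : IsWeakNavierStokes T u₀ u) (hu₀ : u₀ ∈ solenoidal)
    (hu : Regular T fun t => modes (u t)) (hT : 0 < T) : modes (u 0) = modes u₀ := by
  ext k j
  have := h.modes_eq hu₀ hu ⟨le_rfl, hT⟩ k j
  rwa [intervalIntegral.integral_same, sub_zero] at this

/-- The Fourier coefficients of the Leray projection. -/
theorem modes_leray (f : L2) : modes (leray f) = projModes (modes f) := by
  have hfin : sob 0 (projModes (modes f)) ≠ ⊤ :=
    ne_top_of_le_ne_top (by have := sob_zero_modes_ne_top f; finiteness) (sob_projModes_le 0 _)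
  have hm : modes (ofModes (projModes (modes f))) = projModes (modes f) := by
    refine modes_ofModes hfin fun k j => ?_
    have : ∀ i, projCoef (-k) j i = projCoef k j i := fun i => by simp [projCoef, freqSq]
    simp only [projModes, this, map_sum, map_mul, Complex.conj_ofReal]
    simp only [modes, fourierCoef_neg]
  have hsol : ofModes (projModes (modes f)) ∈ solenoidal := by
    refine mem_solenoidal_of_fourierCoef fun k => ?_
    have := sum_mul_projModes (modes f) k
    rwa [← hm] at this
  rw [leray, Submodule.eq_starProjection_of_mem_of_inner_eq_zero hsol, hm]
  intro v hv
  refine inner_eq_zero_of_fourierCoef fun k => ?_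
  -- The remainder is parallel to `k` at each frequency, whereas divergence-free fields are
  -- transversal; this is the orthogonality that characterizes the projection.
  have h1 : ∀ j, fourierCoef (f - ofModes (projModes (modes f))) k j
      = (k j : ℂ) * ((∑ i, (k i : ℂ) * modes f k i) / freqSq k) := fun j => by
    have h2 := congrFun₂ (modes_sub f (ofModes (projModes (modes f)))) k j
    rw [hm, Pi.sub_apply, Pi.sub_apply, projModes_eq] at h2
    exact h2.trans (by ring)
  have h3 := congrArg conj (sum_mul_fourierCoef_of_mem_solenoidal hv k)
  rw [map_zero, map_sum] at h3
  rw [← mul_zero ((∑ i, (k i : ℂ) * modes f k i) / freqSq k), ← h3, Finset.mul_sum]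
  refine Finset.sum_congr rfl fun j _ => ?_
  rw [h1, map_mul, map_intCast]
  ring

/-- The Leray projection of a magnetization is the velocity field. -/
theorem IsStrongMagnetization.leray_eq (hw : IsStrongMagnetization T u w₀ w)
    (h : IsWeakNavierStokes T u₀ u) (hP : leray w₀ = u₀) (hu : Regular T fun t => modes (u t))
    {t : ℝ} (ht : t ∈ Ico 0 T) : leray (w t) = u t := by
  have hu₀ : u₀ ∈ solenoidal := hP ▸ Submodule.starProjection_apply_mem _ _
  have hT := ht.1.trans_lt ht.2
  have hu' := hu.mono ht.2.le
  have hwr := (regular_modes hw.memLinfty hw.memL2).mono ht.2.le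
  obtain ⟨g, hg⟩ := hu'.exists_dominates
  have hy : IsModeSol t (fun s => projModes (bil (modes (u s))
      (projModes (modes (w s)) - modes (u s)))) fun s => projModes (modes (w s)) - modes (u s) := by
    intro k i
    refine (((hw.isModeSol hu ht).projModes k i).sub (h.isModeSol hu₀ hu ht k i)).congr ht.1
      (fun s _ => rfl) ?_
    rw [← ae_restrict_iff' measurableSet_Ioc]
    filter_upwards [hu'.sob_two_ne_top, hwr.sob_two_ne_top] with s h1 h2
    have hp : sob 2 (projModes (modes (w s))) ≠ ⊤ :=
      ne_top_of_le_ne_top (by finiteness) (sob_projModes_le 2 _)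
    -- Up to a factor `i`, these are the coefficients of the potential of the gradient part of `w`.
    set q : Freq → ℂ := fun k => (∑ j, (k j : ℂ) * modes (w s) k j) / freqSq k
    have hK : (fun k j => (k j : ℂ) * q k) = modes (w s) - projModes (modes (w s)) := by
      ext k j
      rw [Pi.sub_apply, Pi.sub_apply, projModes_eq]
      ring
    obtain ⟨c, hc⟩ := bil_gradient q h1 (by
      rw [hK]
      exact ne_top_of_le_ne_top (by finiteness) (sob_sub_le 2 _ _)) k
    -- The gradient part of `w` disappears under the projection, so `ℙw` satisfies a closed
    -- equation.
    have e1 : projModes (bil (modes (u s)) (modes (w s))) k i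
        = projModes (bil (modes (u s)) (projModes (modes (w s)))) k i := by
      rw [← sub_eq_zero, ← projModes_sub, ← projModes_eq_zero hc i, hK]
      congr 1
      ext m l
      rw [bil_sub h1 h2 hp]; rfl
    have e2 : projModes (bil (modes (u s)) (projModes (modes (w s)) - modes (u s))) k i
        = projModes (bil (modes (u s)) (projModes (modes (w s)))) k i
          - projModes (bil (modes (u s)) (modes (u s))) k i := by
      rw [← projModes_sub]
      congr 1
      ext m l
      rw [bil_sub h1 hp h1]; rfl
    rw [e1, e2, Pi.sub_apply, Pi.sub_apply]
    ring
  have h0 : ∀ k j, (projModes (modes (w 0)) - modes (u 0)) k j = 0 := fun k j => by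
    rw [hw.zero_eq hu hT, h.modes_zero_eq hu₀ hu hT, ← modes_leray, hP, sub_self]; rfl
  -- The factor 9 bounds the projection of three-component coefficients, and `9 · 10368 = 93312` is
  -- the constant for which the basic estimate was set up.
  have hG : ∀ s, ∑' k, (ewt k)⁻¹ * ∑ j, ‖projModes (bil (modes (u s))
      (projModes (modes (w s)) - modes (u s))) k j‖ₑ ^ 2
      ≤ 93312 * (sob 2 (modes (u s)) * sob 2 (projModes (modes (w s)) - modes (u s))) := by
    intro s
    calc _ ≤ ∑' k, 9 * ((ewt k)⁻¹ * ∑ j, ‖bil (modes (u s))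
          (projModes (modes (w s)) - modes (u s)) k j‖ₑ ^ 2) := by
          refine ENNReal.tsum_le_tsum fun k => ?_
          rw [mul_left_comm]
          gcongr
          exact sum_enorm_projModes_le _ k
      _ ≤ 9 * (10368 * _) := by
          rw [ENNReal.tsum_mul_left]
          exact mul_le_mul_right (tsum_bil_sq_le _ _) 9
      _ = _ := by rw [← mul_assoc]; norm_num
  have := modes_eq_zero ht.1 le_rfl hg hy (.of_forall hG) h0
    ((hwr.projModes.sub hu').wnorm_ne_top ht.1 hg)
  refine ext_fourierCoef fun k j => ?_
  change modes _ k j = _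
  rw [modes_leray]
  exact sub_eq_zero.mp (this k j)

end

end Magnetization
end

/-! ### The proposition -/

theorem mainTheorem2 (T : ℝ) (hT : 0 < T)
    (u₀ w₀ : Magnetization.L2) (u : ℝ → Magnetization.L2)
    (hu_Linfty : Magnetization.MemLinftyHs T (1 / 2) u)
    (hu_L2 : Magnetization.MemL2Hs T (3 / 2) u)
    (hu : Magnetization.IsWeakNavierStokes T u₀ u)
    (hw₀ : Magnetization.hsNormSq (1 / 2) w₀ < ⊤)
    (hP : Magnetization.leray w₀ = u₀) :
    ∃ w : ℝ → Magnetization.L2,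
      Magnetization.IsStrongMagnetization T u w₀ w ∧
      (∀ w' : ℝ → Magnetization.L2, Magnetization.IsStrongMagnetization T u w₀ w' →
        ∀ t ∈ Set.Ico 0 T, w' t = w t) ∧
      ∀ t ∈ Set.Ico 0 T, Magnetization.leray (w t) = u t := by
  have hreg := Magnetization.regular_modes hu_Linfty hu_L2
  obtain ⟨w, hw⟩ := Magnetization.exists_isStrongMagnetization hT hreg hw₀
  exact ⟨w, hw, fun w' hw' t ht => hw.unique hw' hreg ht, fun t ht => hw.leray_eq hu hP hreg ht⟩
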